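/- Let $M$ be a smooth manifold (Hausdorff, second countable, without boundary, of some dimension $n\ge 0$), let $k\ge 0$ be an integer, and let $\mathcal C$ be a category with a zero object and all small limits. For a manifold $N$ let $\mathcal O(N)$ be the poset of open subsets of $N$. An inclusion $U\subseteq W$ of open subsets is an \emph{isotopy equivalence} if there is a continuous map $L\colon U\times[0,1]\to W$ such that $L_0$ is the inclusion, $L_1(U)=W$, and every $L_t$ is a smooth embedding. A contravariant functor defined on a subcategory of $\mathcal O(N)$ is \emph{very good} if it sends isotopy equivalences to isomorphisms. For an integer $j$ and $U\in\mathcal O(N)$ let $\mathcal O_j(U)$ be the poset of open subsets of $U$ diffeomorphic to a disjoint union of at most $j$ open balls (so $\mathcal O_{-1}(U)=\emptyset$), and put $T_jF(U)=\lim_{V\in\mathcal O_j(U)}F(V)$. A \emph{very good homogeneous functor of degree $j\ge 0$} is a very good contravariant functor $F\colon\mathcal O(N)\to\mathcal C$ such that, for all $U$, the canonical map $F(U)\to T_jF(U)$ is an isomorphism and $T_{j-1}F(U)$ is a zero object; these functors and their natural transformations form the category $\mathcal F_j(\mathcal O(N);\mathcal C)$. For $j=1$ they are called very good \emph{linear}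 functors. Let $F_k(M)$ be the unordered configuration space of $k$ points in $M$, with its topology and smooth structure as the quotient of the ordered configuration space (open in $M^k$) by the symmetric group. Then there is an equivalence of categories $$T\colon \mathcal F_k(\mathcal O(M);\mathcal C)\;\simeq\;\mathcal F_1(\mathcal O(F_k(M));\mathcal C).$$ It is compatible with restriction to bases in the following sense. Let $\mathcal B$ be any basis of the topology of $M$ consisting of open subsets diffeomorphic to a ball. Let $\mathcal B^{(k)}(M)$ be the category whose objects are the disjoint unions of exactly $k$ elements of $\mathcal B$ and whose morphisms are the inclusions that are isotopy equivalences. Then the products of $k$ pairwise disjoint elements of $\mathcal B$, i.e. the sets of configurations with exactly one point in each of them, form a basis of the topology of $F_k(M)$ consisting of open subsets diffeomorphic to a ball; let $\mathcal B^{(1)}(F_k(M))$ be the category whose objects are these products and whose morphisms are the inclusions that are isotopy equivalences in $F_k(M)$. There is an isomorphism of categories $$\Phi\colon \mathcal B^{(k)}(M)\cong\mathcal B^{(1)}(F_k(M)),\qquad B_1\sqcup\dots\sqcup B_k\mapsto B_1\times\dots\times B_k ,$$ the restriction functors $\mathcal F_k(\mathcal O(M);\mathcal C)\to\mathcal F(\mathcal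 B^{(k)}(M);\mathcal C)$ and $\mathcal F_1(\mathcal O(F_k(M));\mathcal C)\to\mathcal F(\mathcal B^{(1)}(F_k(M));\mathcal C)$ to the categories of very good contravariant functors are equivalences, and, up to natural isomorphism, $T$ followed by restriction to $\mathcal B^{(1)}(F_k(M))$ and precomposition with $\Phi$ is restriction to $\mathcal B^{(k)}(M)$. -/

import Mathlib

open CategoryTheory CategoryTheory.Limits Opposite TopologicalSpace Set Topology
open scoped Manifold ContDiff

universe u v w

namespace ManifoldCalculus

/-! ### Smooth embeddings, isotopies, balls -/

section Isotopy

variable {E : Type*} [NormedAddCommGroup E] [NormedSpace ℝ E]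

/-- A smooth embedding between (finite-dimensional, boundaryless) manifolds modelled on `E`:
a smooth map with injective differentials which is a homeomorphism onto its image. -/
structure IsSmoothEmb {X Y : Type*} [TopologicalSpace X] [ChartedSpace E X]
    [TopologicalSpace Y] [ChartedSpace E Y] (f : X → Y) : Prop where
  contMDiff : ContMDiff 𝓘(ℝ, E) 𝓘(ℝ, E) ∞ f
  injective_mfderiv : ∀ x, Function.Injective (mfderiv 𝓘(ℝ, E) 𝓘(ℝ, E) f x)
  isEmbedding : IsEmbedding f

theorem IsSmoothEmb.comp {X Y Z : Type*} [TopologicalSpace X] [ChartedSpace E X]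
    [TopologicalSpace Y] [ChartedSpace E Y] [TopologicalSpace Z] [ChartedSpace E Z]
    {g : Y → Z} {f : X → Y} (hg : IsSmoothEmb (E := E) g) (hf : IsSmoothEmb (E := E) f) :
    IsSmoothEmb (E := E) (g ∘ f) where
  contMDiff := hg.contMDiff.comp hf.contMDiff
  injective_mfderiv x := by
    rw [mfderiv_comp x (hg.contMDiff.mdifferentiable (by simp) _)
      (hf.contMDiff.mdifferentiable (by simp) _)]
    exact (hg.injective_mfderiv _).comp (hf.injective_mfderiv _)
  isEmbedding := hg.isEmbedding.comp hf.isEmbedding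

variable (E)
variable {N : Type*} [TopologicalSpace N] [ChartedSpace E N]

/-- For `i : U ⊆ W` and `i' : U' ⊆ W`, the inclusion `i` is isotopic to `i'`: there is a continuous
`L : U × [0, 1] → W` with `L₀ = i` and `L₁(U) = U'`, all of whose stages are smooth embeddings. -/
def IsIsotopic {U U' W : Opens N} (i : U ≤ W) (_i' : U' ≤ W) : Prop :=
  ∃ L : U × unitInterval → W, Continuous L ∧
    (∀ x : U, L (x, 0) = ⟨x, i x.2⟩) ∧
    (range (fun x : U => ((L (x, 1) : W) : N)) = U') ∧
    ∀ t : unitInterval, IsSmoothEmb (E := E) (fun x : U => L (x, t))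

/-- `U ⊆ W` and the inclusion is an isotopy equivalence, that is, it is isotopic to the identity
of `W`. -/
def IsIsotopyEquiv (U W : Opens N) : Prop :=
  ∃ i : U ≤ W, IsIsotopic E i (le_refl W)

theorem IsIsotopyEquiv.refl (U : Opens N) : IsIsotopyEquiv E U U := by
  refine ⟨le_rfl, fun p => p.1, continuous_fst, fun x => rfl, by simp, fun t => ?_⟩
  exact
    { contMDiff := contMDiff_id
      injective_mfderiv := fun x => by
        have h : mfderiv 𝓘(ℝ, E) 𝓘(ℝ, E) (fun x : U => x) x = _ := mfderiv_id
        rw [h]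
        exact fun a b hab => hab
      isEmbedding := IsEmbedding.id }

variable {E} in
theorem IsIsotopyEquiv.trans {U V W : Opens N} (h₁ : IsIsotopyEquiv E U V)
    (h₂ : IsIsotopyEquiv E V W) : IsIsotopyEquiv E U W := by
  obtain ⟨i, L, hLc, hL0, hL1, hL⟩ := h₁
  obtain ⟨j, K, hKc, hK0, hK1, hK⟩ := h₂
  have hinc : IsSmoothEmb (E := E) (fun x : V => K (x, 0)) := hK 0
  let f₀ : C(U, W) := ⟨fun x => K (L (x, 0), 0), by fun_prop⟩
  let f₁ : C(U, W) := ⟨fun x => K (L (x, 1), 0), by fun_prop⟩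
  let f₂ : C(U, W) := ⟨fun x => K (L (x, 1), 1), by fun_prop⟩
  let H : ContinuousMap.Homotopy f₀ f₁ :=
    { toFun := fun p => K (L (p.2, p.1), 0)
      continuous_toFun := by fun_prop
      map_zero_left := fun x => rfl
      map_one_left := fun x => rfl }
  let G : ContinuousMap.Homotopy f₁ f₂ :=
    { toFun := fun p => K (L (p.2, 1), p.1)
      continuous_toFun := by fun_prop
      map_zero_left := fun x => rfl
      map_one_left := fun x => rfl }
  refine ⟨i.trans j, fun p => H.trans G (p.2, p.1), by fun_prop, fun x => ?_, ?_, fun t => ?_⟩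
  · simp [f₀, hL0, hK0]
  · have hs : ∀ y : V, ∃ x : U, L (x, 1) = y := fun y => by
      have : (y : N) ∈ range (fun x : U => ((L (x, 1) : V) : N)) := by rw [hL1]; exact y.2
      obtain ⟨x, hx⟩ := this
      exact ⟨x, Subtype.ext hx⟩
    rw [← hK1]
    ext z
    simp only [ContinuousMap.Homotopy.apply_one, mem_range]
    constructor
    · rintro ⟨x, rfl⟩
      exact ⟨L (x, 1), rfl⟩
    · rintro ⟨y, rfl⟩
      obtain ⟨x, rfl⟩ := hs y
      exact ⟨x, rfl⟩
  · by_cases ht : (t : ℝ) ≤ 1 / 2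
    · have : (fun x : U => H.trans G (t, x)) = (fun y : V => K (y, 0)) ∘
          (fun x : U => L (x, ⟨2 * t, (unitInterval.mul_pos_mem_iff zero_lt_two).2 ⟨t.2.1, ht⟩⟩)) := by
        funext x
        rw [ContinuousMap.Homotopy.trans_apply, dif_pos ht]
        rfl
      simp only [this]
      exact (hK 0).comp (hL _)
    · have : (fun x : U => H.trans G (t, x)) =
          (fun y : V => K (y, ⟨2 * t - 1, unitInterval.two_mul_sub_one_mem_iff.2
            ⟨(not_le.1 ht).le, t.2.2⟩⟩)) ∘ (fun x : U => L (x, 1)) := by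
        funext x
        rw [ContinuousMap.Homotopy.trans_apply, dif_neg ht]
        rfl
      simp only [this]
      exact (hK _).comp (hL 1)

/-- The open unit ball of the model space. -/
def unitBall : Opens E := ⟨Metric.ball (0 : E) 1, Metric.isOpen_ball⟩

/-- The open subset `U` is diffeomorphic to an open ball. -/
def IsBall (U : Opens N) : Prop :=
  Nonempty (Diffeomorph 𝓘(ℝ, E) 𝓘(ℝ, E) U (unitBall E) ∞)

/-- The open subset `U` is diffeomorphic to the disjoint union of exactly `j` open balls. -/
def IsBallUnion (j : ℕ) (U : Opens N) : Prop :=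
  ∃ B : Fin j → Opens N, (∀ i, IsBall E (B i)) ∧ Pairwise (Function.onFun Disjoint B) ∧
    U = ⨆ i, B i

end Isotopy

/-! ### Very good homogeneous functors -/

section Functors

variable (E : Type*) [NormedAddCommGroup E] [NormedSpace ℝ E]
variable {N : Type w} [TopologicalSpace N] [ChartedSpace E N]
variable {C : Type u} [Category.{v} C]

/-- A contravariant functor `F` on a category `A` of open subsets of `N` (with forgetful functor
`i : A ⥤ O(N)`) is very good if it sends isotopy equivalences to isomorphisms. -/
def IsVeryGood {A : Type*} [Category A] (i : A ⥤ Opens N) (F : Aᵒᵖ ⥤ C) : Prop :=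
  ∀ ⦃U V : A⦄ (f : U ⟶ V), IsIsotopyEquiv E (i.obj U) (i.obj V) → IsIso (F.map f.op)

/-- `O_k(U)`: the poset of open subsets of `U` diffeomorphic to the disjoint union of at most `k`
open balls. The index is an integer so that `O_{k-1}` is literally available; `O_{-1}` is empty. -/
abbrev BallOpens (k : ℤ) (U : Opens N) : Type w :=
  {V : Opens N // V ≤ U ∧ ∃ j : ℕ, (j : ℤ) ≤ k ∧ IsBallUnion E j V}

/-- The inclusion `O_k(U) ⥤ O(N)`. -/
def ballOpensIncl (k : ℤ) (U : Opens N) : BallOpens E k U ⥤ Opens N :=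
  Monotone.functor (f := fun V : BallOpens E k U => (V : Opens N)) fun _ _ h => h

variable [HasLimitsOfSize.{w, w} C]

/-- The value `T_k F(U) = lim_{V ∈ O_k(U)} F(V)` of the `k`-th polynomial approximation. -/
noncomputable def polyApprox (k : ℤ) (F : (Opens N)ᵒᵖ ⥤ C) (U : Opens N) : C :=
  limit ((ballOpensIncl E k U).op ⋙ F)

/-- The canonical map `F(U) ⟶ T_k F(U)` induced by the inclusions `V ⊆ U`. -/
noncomputable def toPolyApprox (k : ℤ) (F : (Opens N)ᵒᵖ ⥤ C) (U : Opens N) :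
    F.obj (op U) ⟶ polyApprox E k F U :=
  limit.lift ((ballOpensIncl E k U).op ⋙ F)
    { pt := F.obj (op U)
      π :=
        { app := fun V => F.map (homOfLE V.unop.2.1).op
          naturality := fun V _ f =>
            (Category.id_comp _).trans
              (F.map_comp (homOfLE V.unop.2.1).op ((ballOpensIncl E k U).op.map f)) } }

/-- `F` is polynomial of degree `≤ k`: the canonical map `F(U) ⟶ lim_{V ∈ O_k(U)} F(V)` is an
isomorphism for every `U`. -/
def IsPolynomial (k : ℤ) (F : (Opens N)ᵒᵖ ⥤ C) : Prop :=
  ∀ U : Opens N, IsIso (toPolyApprox E k F U)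

/-- `F` is a very good homogeneous functor of degree `k`. -/
structure IsVeryGoodHomogeneous (k : ℕ) (F : (Opens N)ᵒᵖ ⥤ C) : Prop where
  veryGood : IsVeryGood E (𝟭 (Opens N)) F
  polynomial : IsPolynomial E k F
  isZero : ∀ U : Opens N, IsZero (polyApprox E ((k : ℤ) - 1) F U)

variable (N C) in
/-- `F_k(O(N); C)`: the category of very good homogeneous functors of degree `k` on `O(N)` and
natural transformations. For `k = 1` these are the very good linear functors. -/
abbrev VGHomogeneous (k : ℕ) :=
  ObjectProperty.FullSubcategory
    (fun F : (Opens N)ᵒᵖ ⥤ C => IsVeryGoodHomogeneous E k F)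

end Functors

/-! ### The category of disjoint unions of basis elements -/

section Basis

variable (E : Type*) [NormedAddCommGroup E] [NormedSpace ℝ E]
variable {N : Type w} [TopologicalSpace N] [ChartedSpace E N]
variable (C : Type u) [Category.{v} C]

/-- `𝓑` is a basis for the topology, consisting of open subsets diffeomorphic to a ball. -/
def IsBallBasis (𝓑 : Set (Opens N)) : Prop :=
  Opens.IsBasis 𝓑 ∧ ∀ B ∈ 𝓑, IsBall E B

/-- The objects of `𝓑^(k)(N)`: disjoint unions of exactly `k` elements of `𝓑`. -/
@[ext]
structure BasisUnion (E : Type*) [NormedAddCommGroup E] [NormedSpace ℝ E]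
    {N : Type w} [TopologicalSpace N] [ChartedSpace E N] (k : ℕ) (𝓑 : Set (Opens N)) :
    Type w where
  /-- the underlying open subset -/
  carrier : Opens N
  exists_eq : ∃ B : Fin k → Opens N, (∀ i, B i ∈ 𝓑) ∧ Pairwise (Function.onFun Disjoint B) ∧
    carrier = ⨆ i, B i

/-- The morphisms of `𝓑^(k)(N)` are the inclusions that are isotopy equivalences. -/
instance (k : ℕ) (𝓑 : Set (Opens N)) : Preorder (BasisUnion E k 𝓑) where
  le U V := IsIsotopyEquiv E U.carrier V.carrier
  le_refl U := IsIsotopyEquiv.refl E U.carrier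
  le_trans _ _ _ h₁ h₂ := h₁.trans h₂

/-- The inclusion `𝓑^(k)(N) ⥤ O(N)`. -/
def basisIncl (k : ℕ) (𝓑 : Set (Opens N)) : BasisUnion E k 𝓑 ⥤ Opens N :=
  Monotone.functor (f := BasisUnion.carrier) fun _ _ h => h.choose

/-- `F(𝓑^(k)(N); C)`: the category of very good functors on `𝓑^(k)(N)`. -/
abbrev VGBasis (k : ℕ) (𝓑 : Set (Opens N)) :=
  ObjectProperty.FullSubcategory
    (fun F : (BasisUnion E k 𝓑)ᵒᵖ ⥤ C => IsVeryGood E (basisIncl E k 𝓑) F)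

/-- The restriction functor `F_k(O(N); C) ⥤ F(𝓑^(k)(N); C)`. -/
def restrictToBasis [HasLimitsOfSize.{w, w} C] (k : ℕ) (𝓑 : Set (Opens N)) :
    VGHomogeneous E N C k ⥤ VGBasis E C k 𝓑 :=
  ObjectProperty.lift _
    (ObjectProperty.ι _ ⋙ (Functor.whiskeringLeft _ _ C).obj (basisIncl E k 𝓑).op)
    fun F _ _ f h => F.property.veryGood ((basisIncl E k 𝓑).map f) h

variable {E}

/-- An isomorphism of categories `𝓑^(k)(N) ≅ 𝓑'^(l)(N')` induces by precomposition a functor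
`F(𝓑'^(l)(N'); C) ⥤ F(𝓑^(k)(N); C)`. -/
def precompBasis {E' : Type*} [NormedAddCommGroup E'] [NormedSpace ℝ E']
    {N' : Type w} [TopologicalSpace N'] [ChartedSpace E' N'] {k l : ℕ}
    {𝓑 : Set (Opens N)} {𝓑' : Set (Opens N')}
    (Φ : BasisUnion E k 𝓑 ≃o BasisUnion E' l 𝓑') :
    VGBasis E' C l 𝓑' ⥤ VGBasis E C k 𝓑 :=
  ObjectProperty.lift _
    (ObjectProperty.ι _ ⋙ (Functor.whiskeringLeft _ _ C).obj (Φ.monotone.functor).op)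
    fun F _ _ f _ => F.property (Φ.monotone.functor.map f) (Φ.monotone.functor.map f).le

end Basis

/-! ### Unordered configuration spaces -/

section Configuration

variable (k : ℕ) (M : Type w)

/-- The ordered configuration space, with the subspace topology from `M^k`. -/
abbrev OrdConf : Type w := {x : Fin k → M // Function.Injective x}

/-- The unordered configuration space `F_k(M)`: the set of `k`-element subsets of `M`. -/
structure Conf : Type w where
  /-- the underlying set of points -/
  points : Finset M
  card_points : points.card = k

variable {k M}

/-- The quotient map from ordered to unordered configurations, `x ↦ {x₁, …, x_k}`. -/
def Conf.mk' (x : OrdConf k M) : Conf k M :=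
  ⟨Finset.univ.map ⟨x.1, x.2⟩, by simp⟩

theorem Conf.mk'_surjective : Function.Surjective (Conf.mk' : OrdConf k M → Conf k M) := by
  rintro ⟨s, hs⟩
  let e := s.equivFinOfCardEq hs
  refine ⟨⟨fun i => e.symm i, fun i j h => e.symm.injective (Subtype.ext h)⟩, ?_⟩
  simp only [Conf.mk', Conf.mk.injEq]
  ext a
  simp only [Finset.mem_map, Finset.mem_univ, Function.Embedding.coeFn_mk, true_and]
  exact ⟨fun ⟨i, hi⟩ => hi ▸ (e.symm i).2, fun ha => ⟨e ⟨a, ha⟩, by simp⟩⟩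

theorem Conf.mem_mk' {x : OrdConf k M} {a : M} : a ∈ (Conf.mk' x).points ↔ ∃ i, x.1 i = a := by
  simp [Conf.mk']

theorem Conf.mk'_eq_iff {x y : OrdConf k M} :
    Conf.mk' x = Conf.mk' y ↔ ∃ σ : Equiv.Perm (Fin k), ∀ i, y.1 i = x.1 (σ i) := by
  constructor
  · intro h
    have h1 : ∀ i, ∃ j, x.1 j = y.1 i := fun i => by
      rw [← Conf.mem_mk', h, Conf.mem_mk']
      exact ⟨i, rfl⟩
    choose σ hσ using h1
    have hinj : Function.Injective σ := fun i j hij => y.2 (by rw [← hσ, ← hσ, hij])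
    exact ⟨Equiv.ofBijective σ (Finite.injective_iff_bijective.1 hinj), fun i => (hσ i).symm⟩
  · rintro ⟨σ, hσ⟩
    have : (Conf.mk' x).points = (Conf.mk' y).points := by
      ext a
      rw [Conf.mem_mk', Conf.mem_mk']
      exact ⟨fun ⟨i, hi⟩ => ⟨σ.symm i, by simp [hσ, hi]⟩, fun ⟨i, hi⟩ => ⟨σ i, by rw [← hσ, hi]⟩⟩
    cases hx : Conf.mk' x
    cases hy : Conf.mk' y
    simp_all

variable [TopologicalSpace M]

/-- The topology of `F_k(M)` as the quotient of the ordered configuration space. -/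
instance : TopologicalSpace (Conf k M) := TopologicalSpace.coinduced Conf.mk' inferInstance

theorem Conf.isOpenMap_mk' : IsOpenMap (Conf.mk' : OrdConf k M → Conf k M) := by
  intro U hU
  rw [isOpen_coinduced]
  have : Conf.mk' ⁻¹' (Conf.mk' '' U) = ⋃ σ : Equiv.Perm (Fin k),
      (fun x : OrdConf k M => (⟨fun i => x.1 (σ i), x.2.comp σ.injective⟩ : OrdConf k M)) ⁻¹' U := by
    ext x
    simp only [mem_preimage, mem_image, mem_iUnion]
    constructor
    · rintro ⟨y, hy, hyx⟩
      obtain ⟨σ, hσ⟩ := Conf.mk'_eq_iff.1 hyx.symm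
      refine ⟨σ, ?_⟩
      convert hy using 1
      exact Subtype.ext (funext fun i => (hσ i).symm)
    · rintro ⟨σ, hσ⟩
      exact ⟨_, hσ, (Conf.mk'_eq_iff.2 ⟨σ, fun _ => rfl⟩).symm⟩
  rw [this]
  refine isOpen_iUnion fun σ => hU.preimage ?_
  exact Continuous.subtype_mk
    (continuous_pi fun i => (continuous_apply (A := fun _ : Fin k => M) (σ i)).comp
      continuous_subtype_val) _

variable [T2Space M]

theorem Conf.exists_separation (x : OrdConf k M) : ∃ O : Fin k → Set M,
    (∀ i, x.1 i ∈ O i ∧ IsOpen (O i)) ∧ Pairwise (Function.onFun Disjoint O) := by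
  obtain ⟨V, hV, hd⟩ := (Set.finite_range x.1).t2_separation
  refine ⟨fun i => V (x.1 i), fun i => hV _, fun i j hij => ?_⟩
  exact hd ⟨i, rfl⟩ ⟨j, rfl⟩ (fun h => hij (x.2 h))

theorem Conf.isLocalHomeomorph_mk' :
    IsLocalHomeomorph (Conf.mk' : OrdConf k M → Conf k M) := by
  rw [isLocalHomeomorph_iff_isOpenEmbedding_restrict]
  intro x
  obtain ⟨O, hO, hd⟩ := Conf.exists_separation x
  have hW : IsOpen {z : OrdConf k M | ∀ i, z.1 i ∈ O i} := by
    simp only [ofPred_forall]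
    exact isOpen_iInter_of_finite fun i =>
      (hO i).2.preimage ((continuous_apply i).comp continuous_subtype_val)
  refine ⟨{z | ∀ i, z.1 i ∈ O i}, hW.mem_nhds fun i => (hO i).1, ?_⟩
  refine IsOpenEmbedding.of_continuous_injective_isOpenMap
    (continuous_coinduced_rng.comp continuous_subtype_val) ?_
    (Conf.isOpenMap_mk'.domRestrict hW)
  rintro ⟨z, hz⟩ ⟨z', hz'⟩ h
  obtain ⟨σ, hσ⟩ := Conf.mk'_eq_iff.1 h
  have : ∀ i, σ i = i := fun i => by
    by_contra hne
    exact Set.disjoint_left.1 (hd hne) (hz (σ i)) (hσ i ▸ hz' i)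
  refine Subtype.ext (Subtype.ext (funext fun i => ?_))
  rw [hσ, this]

theorem isOpen_ordConf : IsOpen {x : Fin k → M | Function.Injective x} := by
  rw [isOpen_iff_mem_nhds]
  intro x hx
  obtain ⟨O, hO, hd⟩ := Conf.exists_separation (⟨x, hx⟩ : OrdConf k M)
  have hW : IsOpen {z : Fin k → M | ∀ i, z i ∈ O i} := by
    simp only [ofPred_forall]
    exact isOpen_iInter_of_finite fun i => (hO i).2.preimage (by fun_prop)
  refine Filter.mem_of_superset (hW.mem_nhds fun i => (hO i).1) fun z hz i j hij => ?_
  by_contra hne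
  exact Set.disjoint_left.1 (hd hne) (hz i) (hij ▸ hz j)

/-- The open inclusion of the ordered configuration space into `M^k`. -/
theorem isOpenEmbedding_ordConf :
    IsOpenEmbedding (Subtype.val : OrdConf k M → (Fin k → M)) :=
  (isOpen_ordConf (k := k) (M := M)).isOpenEmbedding_subtypeVal

variable (E : Type*) [NormedAddCommGroup E] [NormedSpace ℝ E] [ChartedSpace E M]

/-- The model space of `F_k(M)`: the `k`-fold product of `E` with its Euclidean norm. -/
abbrev ConfModel (k : ℕ) (E : Type*) [NormedAddCommGroup E] : Type _ :=
  PiLp 2 (fun _ : Fin k => E)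

/-- The chart of the ordered configuration space around `x`: apply the chart of `M` around `x_i` to
the `i`-th point. -/
noncomputable def ordConfChart (x : OrdConf k M) :
    OpenPartialHomeomorph (OrdConf k M) (ConfModel k E) :=
  haveI : Nonempty (OrdConf k M) := ⟨x⟩
  isOpenEmbedding_ordConf.toOpenPartialHomeomorph.trans
    ((OpenPartialHomeomorph.pi fun i => chartAt E (x.1 i)).trans
      (PiLp.continuousLinearEquiv 2 ℝ (fun _ : Fin k => E)).symm.toHomeomorph.toOpenPartialHomeomorph)

/-- The chart of `F_k(M)` around `{x₁, …, x_k}`: lift a configuration near it to an ordered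
configuration near `(x₁, …, x_k)` and apply the chart of `M` around `x_i` to the `i`-th point. -/
noncomputable def confChart (x : OrdConf k M) :
    OpenPartialHomeomorph (Conf k M) (ConfModel k E) :=
  (Conf.isLocalHomeomorph_mk'.localInverseAt x).trans (ordConfChart E x)

theorem mem_confChart_source (x : OrdConf k M) :
    Conf.mk' x ∈ (confChart E x).source := by
  simp [confChart, ordConfChart]

theorem ordConfChart_apply (x z : OrdConf k M) (i : Fin k) :
    (ordConfChart E x z) i = chartAt E (x.1 i) (z.1 i) := by
  simp [ordConfChart]

theorem mem_ordConfChart_source {x z : OrdConf k M} :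
    z ∈ (ordConfChart E x).source ↔ ∀ i, z.1 i ∈ (chartAt E (x.1 i)).source := by
  simp [ordConfChart]

theorem ordConfChart_symm_apply {x : OrdConf k M} {v : ConfModel k E}
    (hv : v ∈ (ordConfChart E x).target) (i : Fin k) :
    v i ∈ (chartAt E (x.1 i)).target ∧
      ((ordConfChart E x).symm v).1 i = (chartAt E (x.1 i)).symm (v i) := by
  have h1 := (mem_ordConfChart_source E).1 ((ordConfChart E x).map_target hv) i
  have h2 : v i = chartAt E (x.1 i) (((ordConfChart E x).symm v).1 i) := by
    rw [← ordConfChart_apply, (ordConfChart E x).right_inv hv]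
  rw [h2]
  exact ⟨(chartAt E (x.1 i)).map_source h1, ((chartAt E (x.1 i)).left_inv h1).symm⟩

/-- The smooth structure of `F_k(M)` (the one for which the quotient map from the ordered
configuration space is a local diffeomorphism). -/
noncomputable instance : ChartedSpace (ConfModel k E) (Conf k M) where
  atlas := range (confChart E)
  chartAt s := confChart E (Conf.mk'_surjective s).choose
  mem_chart_source s := by
    have := mem_confChart_source E (Conf.mk'_surjective s).choose
    rwa [(Conf.mk'_surjective s).choose_spec] at this
  chart_mem_atlas s := ⟨_, rfl⟩

/-- The transition maps of the atlas of `F_k(M)` are smooth. -/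
instance [IsManifold 𝓘(ℝ, E) ∞ M] : IsManifold 𝓘(ℝ, ConfModel k E) ∞ (Conf k M) := by
  apply isManifold_of_contDiffOn
  rintro _ _ ⟨x, rfl⟩ ⟨y, rfl⟩
  simp only [modelWithCornersSelf_coe, modelWithCornersSelf_coe_symm, Function.comp_id,
    Function.id_comp, preimage_id, range_id, inter_univ]
  intro v hv
  refine ContDiffAt.contDiffWithinAt ?_
  set lx := Conf.isLocalHomeomorph_mk'.localInverseAt x with hlx
  set ly := Conf.isLocalHomeomorph_mk'.localInverseAt y with hly
  simp only [confChart, OpenPartialHomeomorph.trans_source, OpenPartialHomeomorph.symm_source,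
    OpenPartialHomeomorph.trans_target, OpenPartialHomeomorph.coe_trans_symm, mem_inter_iff,
    mem_preimage, Function.comp_apply, ← hlx, ← hly] at hv
  obtain ⟨⟨hv1, hv2⟩, hv3, hv4⟩ := hv
  let z : ConfModel k E → OrdConf k M := (ordConfChart E x).symm
  let w : ConfModel k E → OrdConf k M := fun v => ly (lx.symm (z v))
  have hz : ContinuousAt z v := (ordConfChart E x).continuousAt_symm hv1
  have hw : ContinuousAt w v :=
    (ly.continuousAt hv3).comp (f := fun v => lx.symm (z v)) <|
      (lx.continuousAt_symm hv2).comp (f := z) hz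
  have hlxs : ∀ u, lx.symm u = Conf.mk' u := fun u => by
    rw [hlx, IsLocalHomeomorph.localInverseAt_symm]
  have hev1 : ∀ᶠ v' in 𝓝 v, v' ∈ (ordConfChart E x).target :=
    (ordConfChart E x).open_target.mem_nhds hv1
  have hev3 : ∀ᶠ v' in 𝓝 v, lx.symm (z v') ∈ ly.source :=
    ((lx.continuousAt_symm hv2).comp (f := z) hz).eventually_mem (ly.open_source.mem_nhds hv3)
  have hperm : ∀ v', lx.symm (z v') ∈ ly.source →
      ∃ σ : Equiv.Perm (Fin k), ∀ i, (w v').1 i = (z v').1 (σ i) := fun v' h' => by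
    rw [← Conf.mk'_eq_iff, ← hlxs]
    exact (Conf.isLocalHomeomorph_mk'.apply_localInverseAt_of_mem h').symm
  obtain ⟨σ, hσ⟩ := hperm v hv3
  obtain ⟨O, hO, hd⟩ := Conf.exists_separation (z v)
  have hzc : ∀ i, ContinuousAt (fun v' => (z v').1 i) v := fun i =>
    ((continuous_apply (A := fun _ : Fin k => M) i).comp continuous_subtype_val).continuousAt.comp
      hz
  have hwc : ∀ i, ContinuousAt (fun v' => (w v').1 i) v := fun i =>
    ((continuous_apply (A := fun _ : Fin k => M) i).comp continuous_subtype_val).continuousAt.comp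
      hw
  have hzO : ∀ᶠ v' in 𝓝 v, ∀ i, (z v').1 i ∈ O i :=
    Filter.eventually_all.2 fun i => (hzc i).eventually_mem ((hO i).2.mem_nhds (hO i).1)
  have hwO : ∀ᶠ v' in 𝓝 v, ∀ i, (w v').1 i ∈ O (σ i) :=
    Filter.eventually_all.2 fun i => (hwc i).eventually_mem
      ((hO (σ i)).2.mem_nhds (by rw [hσ]; exact (hO (σ i)).1))
  rw [contDiffAt_piLp]
  intro i
  have hcd : ContDiffAt ℝ ∞ ((chartAt E (y.1 i)) ∘ (chartAt E (x.1 (σ i))).symm) (v (σ i)) := by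
    have hg := (contDiffGroupoid ∞ 𝓘(ℝ, E)).compatible (chart_mem_atlas E (x.1 (σ i)))
      (chart_mem_atlas E (y.1 i))
    rw [contDiffGroupoid, mem_groupoid_of_pregroupoid] at hg
    have hc : ContDiffOn ℝ ∞ ((chartAt E (y.1 i)) ∘ (chartAt E (x.1 (σ i))).symm)
        ((chartAt E (x.1 (σ i))).symm.trans (chartAt E (y.1 i))).source := by
      simpa [contDiffPregroupoid] using hg.1
    refine hc.contDiffAt (((chartAt E (x.1 (σ i))).symm.trans
      (chartAt E (y.1 i))).open_source.mem_nhds ⟨(ordConfChart_symm_apply E hv1 (σ i)).1, ?_⟩)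
    have h4 := (mem_ordConfChart_source E).1 hv4 i
    change (w v).1 i ∈ _ at h4
    rw [hσ, (ordConfChart_symm_apply E hv1 (σ i)).2] at h4
    exact h4
  refine (hcd.comp v (f := fun v' : ConfModel k E => v' (σ i)) (by fun_prop)).congr_of_eventuallyEq ?_
  filter_upwards [hev1, hev3, hzO, hwO] with v' h1 h3 hz' hw'
  obtain ⟨τ, hτ⟩ := hperm v' h3
  have : τ i = σ i := by
    by_contra hne
    exact Set.disjoint_left.1 (hd hne) (hz' (τ i)) (hτ i ▸ hw' i)
  change (ordConfChart E y (w v')) i = _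
  rw [ordConfChart_apply, hτ, this, (ordConfChart_symm_apply E h1 (σ i)).2]
  rfl

end Configuration

/-! ### The product basis of the unordered configuration space -/

section ConfBasis

variable {k : ℕ} {M : Type w}

/-- The product `B₁ × ⋯ × B_k` of pairwise disjoint sets, as a subset of `F_k(M)`: the
configurations `{x₁, …, x_k}` with `x_i ∈ B_i`. -/
def confProd [TopologicalSpace M] (B : Fin k → Opens M) : Set (Conf k M) :=
  Conf.mk' '' {x | ∀ i, x.1 i ∈ B i}

variable (k) in
/-- The open subsets of `F_k(M)` that are products of `k` pairwise disjoint elements of `𝓑`. -/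
def confBasis [TopologicalSpace M] (𝓑 : Set (Opens M)) : Set (Opens (Conf k M)) :=
  {W | ∃ B : Fin k → Opens M, (∀ i, B i ∈ 𝓑) ∧ Pairwise (Function.onFun Disjoint B) ∧
    (W : Set (Conf k M)) = confProd B}

end ConfBasis

end ManifoldCalculus

namespace ManifoldCalculus

/-! ### Configurations with at most one point in each component -/

section Linked

variable {N N' : Type*} [TopologicalSpace N] [TopologicalSpace N']

/-! A very good homogeneous functor of degree `k` on `N` is a locally constant object on `F_k(N)` in
disguise. To an open `U` attach `spread k U`, the open set of configurations in `U` with at most one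
point in each component. If `U` is a union of `k` disjoint balls, then `spread k U` is their product
(`confProd_eq_spreadSet`). For two such unions an inclusion is an isotopy equivalence exactly when
the products are nested. So the category of unions of `k` elements of a ball basis is a basis of
connected open sets of `F_k(N)`, ordered by inclusion (`isConnectedBasis_spread`).

A very good functor `G` on the basis inverts every morphism. For a test object `c`, the germs of
maps `c ⟶ G(V)` form a covering space of `F_k(N)` (`isCoveringMap_proj`); test objects stand in for
elements, since objects of `C` have none. The extension of `G` to `O(N)` sends `U` to the sections
over `spread k U`, that is, to a limit over the basis. `spread` is not monotone: for `U ⊆ U'` the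
configurations in `U` that are spread in `U'` form an open and closed part of `spread k U`, and the
transition map restricts a section to this part and extends it by zero. This is where the zero
object enters.

The extension is very good because an isotopy acts on spread configurations and homotopies lift to
covering spaces. It is polynomial because compatible families vanish on products that are not spread
in `U`: if two points lie in one component of `U`, one of them can be moved until it shares a small
ball with another, and the configuration then lies in a union of fewer than `k` balls, where the
functor is zero (`IsVeryGood.eq_zero_of_not_spread_le`). Any homogeneous `F` maps to the extension
of its restriction. This map is invertible on unions of at most `k` balls, hence everywhere, both
sides being polynomial. So restriction to a ball basis is an equivalence
(`restrictToBasis_isEquivalence`).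

The same result in degree 1 applies to `F_k(M)` with the basis of products, which are again balls.
Both functor categories are thereby identified with very good functors on isomorphic basis
categories. Building `T` from the basis of all balls makes it compatible with every smaller basis.
-/

/-- `a` and `b` lie in the same connected component of `V`. -/
def Linked (V : Set N) (a b : N) : Prop :=
  ∃ S ⊆ V, IsPreconnected S ∧ a ∈ S ∧ b ∈ S

theorem Linked.mono {V W : Set N} (h : V ⊆ W) {a b : N} (hab : Linked V a b) : Linked W a b := by
  obtain ⟨S, hS, hp, ha, hb⟩ := hab
  exact ⟨S, hS.trans h, hp, ha, hb⟩

theorem Linked.symm {V : Set N} {a b : N} (h : Linked V a b) : Linked V b a := by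
  obtain ⟨S, hS, hp, ha, hb⟩ := h
  exact ⟨S, hS, hp, hb, ha⟩

theorem Linked.trans {V : Set N} {a b c : N} (h : Linked V a b) (h' : Linked V b c) :
    Linked V a c := by
  obtain ⟨S, hS, hp, ha, hb⟩ := h
  obtain ⟨T, hT, hq, hb', hc⟩ := h'
  exact ⟨S ∪ T, union_subset hS hT, hp.union b hb hb' hq, Or.inl ha, Or.inr hc⟩

theorem Linked.map {V : Set N} {W : Set N'} {f : V → W} (hf : Continuous f) {a b : V}
    (h : Linked V (a : N) b) : Linked W (f a : N') (f b) := by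
  obtain ⟨S, hS, hp, ha, hb⟩ := h
  refine ⟨(fun x => (f x : N')) '' (Subtype.val ⁻¹' S), ?_, ?_, ⟨a, ha, rfl⟩, ⟨b, hb, rfl⟩⟩
  · rintro _ ⟨x, -, rfl⟩
    exact (f x).2
  · refine IsPreconnected.image ?_ _ (continuous_subtype_val.comp hf).continuousOn
    rw [← IsInducing.subtypeVal.isPreconnected_image]
    rwa [Subtype.image_preimage_coe, inter_eq_self_of_subset_right hS]

theorem linked_iff {V : Set N} {a b : N} : Linked V a b ↔ a ∈ V ∧ b ∈ connectedComponentIn V a := by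
  constructor
  · rintro ⟨S, hS, hp, ha, hb⟩
    exact ⟨hS ha, hp.subset_connectedComponentIn ha hS hb⟩
  · rintro ⟨ha, hb⟩
    exact ⟨_, connectedComponentIn_subset V a, isPreconnected_connectedComponentIn,
      mem_connectedComponentIn ha, hb⟩

end Linked

/-! ### Topology of `F_k(N)` and its open sets of spread configurations -/

section Spread

variable {k : ℕ} {N : Type w} [TopologicalSpace N]

theorem Conf.continuous_mk' : Continuous (Conf.mk' : OrdConf k N → Conf k N) :=
  continuous_coinduced_rng

theorem Conf.isOpen_iff {s : Set (Conf k N)} :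
    IsOpen s ↔ IsOpen (Conf.mk' ⁻¹' s : Set (OrdConf k N)) :=
  isOpen_coinduced

theorem OrdConf.continuous_apply (i : Fin k) : Continuous fun x : OrdConf k N => x.1 i :=
  (_root_.continuous_apply i).comp continuous_subtype_val

/-- The restriction theorem is applied a second time with `F_k(M)` as the manifold, so `F_k(M)` has
to be Hausdorff. Take a point `a` of `p` outside `q` and disjoint neighbourhoods of `a` and of the
points of `q`: having a point near `a` excludes having all points near `q`. -/
instance [T2Space N] : T2Space (Conf k N) := by
  classical
  refine ⟨fun p q hpq => ?_⟩
  obtain ⟨a, hap, haq⟩ : ∃ a ∈ p.points, a ∉ q.points := by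
    by_contra! h
    refine hpq ?_
    have := Finset.eq_of_subset_of_card_le h (by rw [p.card_points, q.card_points])
    cases p; cases q; simp_all
  obtain ⟨O, hO, hd⟩ := (insert a q.points).finite_toSet.t2_separation
  have hV : IsOpen (⋃ b ∈ q.points, O b) := isOpen_biUnion fun b _ => (hO b).2
  refine ⟨{r | ∃ b ∈ r.points, b ∈ O a}, {r | ∀ b ∈ r.points, b ∈ ⋃ c ∈ q.points, O c},
    ?_, ?_, ⟨a, hap, (hO a).1⟩, fun b hb => mem_biUnion hb (hO b).1, ?_⟩
  · rw [Conf.isOpen_iff]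
    have : (Conf.mk' ⁻¹' {r | ∃ b ∈ r.points, b ∈ O a} : Set (OrdConf k N)) =
        ⋃ i, (fun x : OrdConf k N => x.1 i) ⁻¹' O a := by
      ext x; simp [Conf.mem_mk']
    rw [this]
    exact isOpen_iUnion fun i => (hO a).2.preimage (OrdConf.continuous_apply i)
  · rw [Conf.isOpen_iff]
    have : (Conf.mk' ⁻¹' {r | ∀ b ∈ r.points, b ∈ ⋃ c ∈ q.points, O c} : Set (OrdConf k N)) =
        ⋂ i, (fun x : OrdConf k N => x.1 i) ⁻¹' (⋃ c ∈ q.points, O c) := by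
      ext x; simp [Conf.mem_mk']
    rw [this]
    exact isOpen_iInter_of_finite fun i => hV.preimage (OrdConf.continuous_apply i)
  · refine Set.disjoint_left.2 fun r hr hr' => ?_
    obtain ⟨b, hb, hba⟩ := hr
    obtain ⟨c, hc, hbc⟩ := mem_iUnion₂.1 (hr' b hb)
    have hac : a ≠ c := fun h => haq (h ▸ hc)
    exact Set.disjoint_left.1 (hd (by simp) (by simp [hc]) hac) hba hbc

variable (k) in
/-- The configurations of `k` points in `V` with at most one point in each connected component. -/
def spreadSet (V : Set N) : Set (Conf k N) :=
  {p | (∀ a ∈ p.points, a ∈ V) ∧ ∀ a ∈ p.points, ∀ b ∈ p.points, a ≠ b → ¬ Linked V a b}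

theorem mk'_mem_spreadSet {V : Set N} {x : OrdConf k N} :
    Conf.mk' x ∈ spreadSet k V ↔ (∀ i, x.1 i ∈ V) ∧ ∀ i j, i ≠ j → ¬ Linked V (x.1 i) (x.1 j) := by
  simp only [spreadSet, mem_ofPred_eq, Conf.mem_mk', forall_exists_index, forall_apply_eq_imp_iff]
  refine and_congr Iff.rfl ⟨fun h i j hij => h i j fun he => hij (x.2 he), fun h i j hij => ?_⟩
  exact h i j fun he => hij (he ▸ rfl)

/-- The open set of all configurations contained in `U`. -/
theorem isOpen_setOf_points_subset (U : Opens N) : IsOpen {p : Conf k N | ∀ a ∈ p.points, a ∈ U} := by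
  rw [Conf.isOpen_iff]
  have : (Conf.mk' ⁻¹' {p : Conf k N | ∀ a ∈ p.points, a ∈ U} : Set (OrdConf k N)) =
      ⋂ i, (fun x : OrdConf k N => x.1 i) ⁻¹' U := by
    ext x; simp [Conf.mem_mk']
  rw [this]
  exact isOpen_iInter_of_finite fun i => U.2.preimage (OrdConf.continuous_apply i)

/-- Shrinking the ambient set can only separate points. `spreadSet` itself is not monotone:
enlarging the set may merge components. -/
theorem spreadSet_mono_of_subset {V W : Set N} (h : V ⊆ W) {p : Conf k N}
    (hp : p ∈ spreadSet k W) (hpV : ∀ a ∈ p.points, a ∈ V) : p ∈ spreadSet k V :=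
  ⟨hpV, fun a ha b hb hab hl => hp.2 a ha b hb hab (hl.mono h)⟩

variable (k) in
/-- The open set of configurations of `k` points in `V` with at most one point in each connected
component. -/
def spread [LocallyConnectedSpace N] (V : Opens N) : Opens (Conf k N) where
  carrier := spreadSet k V
  is_open' := by
    rw [Conf.isOpen_iff, isOpen_iff_mem_nhds]
    intro x hx
    rw [mem_preimage, mk'_mem_spreadSet] at hx
    -- Components of an open set are open here, and moving each point within its component changes
    -- neither condition.
    have hW : IsOpen {z : OrdConf k N | ∀ i, z.1 i ∈ connectedComponentIn (V : Set N) (x.1 i)} := by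
      simp only [ofPred_forall]
      exact isOpen_iInter_of_finite fun i =>
        (V.2.connectedComponentIn).preimage (OrdConf.continuous_apply i)
    refine Filter.mem_of_superset
      (hW.mem_nhds fun i => mem_connectedComponentIn (hx.1 i)) fun z hz => ?_
    rw [mem_preimage, mk'_mem_spreadSet]
    have hl : ∀ i, Linked (V : Set N) (x.1 i) (z.1 i) := fun i => linked_iff.2 ⟨hx.1 i, hz i⟩
    exact ⟨fun i => connectedComponentIn_subset _ _ (hz i),
      fun i j hij h => hx.2 i j hij (((hl i).trans h).trans (hl j).symm)⟩

@[simp]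
theorem coe_spread [LocallyConnectedSpace N] (V : Opens N) :
    (spread k V : Set (Conf k N)) = spreadSet k V := rfl

theorem mem_spread [LocallyConnectedSpace N] {V : Opens N} {p : Conf k N} :
    p ∈ spread k V ↔ p ∈ spreadSet k (V : Set N) := Iff.rfl

end Spread

/-! ### Disjoint unions of connected open subsets -/

section ComponentUnion

variable {k j : ℕ} {N : Type w} [TopologicalSpace N]

/-- `B i` and the union of the other `B l` are disjoint open sets, so no preconnected subset of the
union meets both. -/
theorem eq_of_linked_iSup {B : Fin j → Opens N} (hd : Pairwise (Function.onFun Disjoint B))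
    {a b : N} {i i' : Fin j} (ha : a ∈ B i) (hb : b ∈ B i')
    (h : Linked ((⨆ i, B i : Opens N) : Set N) a b) : i = i' := by
  by_contra hne
  obtain ⟨S, hS, hp, haS, hbS⟩ := h
  have hO : IsOpen (⋃ l ≠ i, (B l : Set N)) := isOpen_biUnion fun l _ => (B l).2
  obtain ⟨c, -, hc, hc'⟩ := hp _ _ (B i).2 hO (fun c hc => by
      obtain ⟨l, hl⟩ := Opens.mem_iSup.1 (hS hc)
      by_cases h : l = i
      · exact Or.inl (h ▸ hl)
      · exact Or.inr (mem_biUnion (x := l) h hl)) ⟨a, haS, ha⟩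
    ⟨b, hbS, mem_biUnion (x := i') (Ne.symm hne) hb⟩
  obtain ⟨l, hl, hcl⟩ := mem_iUnion₂.1 hc'
  exact Set.disjoint_left.1 (Opens.coe_disjoint.2 (hd hl)) hcl hc

theorem linked_of_mem {B : Opens N} (hB : IsPreconnected (B : Set N)) {V : Set N}
    (h : (B : Set N) ⊆ V) {a b : N} (ha : a ∈ B) (hb : b ∈ B) : Linked V a b :=
  ⟨B, h, hB, ha, hb⟩

theorem mem_confProd {B : Fin k → Opens N} {p : Conf k N} :
    p ∈ confProd B ↔ ∃ x : OrdConf k N, (∀ i, x.1 i ∈ B i) ∧ Conf.mk' x = p := Iff.rfl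

/-- The `B i` are connected and pairwise separated in their union, so `k` points spread among `k` of
them hit each exactly once; the resulting bijection of indices reorders the configuration. -/
theorem confProd_eq_spreadSet {B : Fin k → Opens N} (hB : ∀ i, IsPreconnected (B i : Set N))
    (hd : Pairwise (Function.onFun Disjoint B)) :
    confProd B = spreadSet k ((⨆ i, B i : Opens N) : Set N) := by
  ext p
  constructor
  · rintro ⟨x, hx, rfl⟩
    rw [mk'_mem_spreadSet]
    exact ⟨fun i => Opens.mem_iSup.2 ⟨i, hx i⟩,
      fun i j hij h => hij (eq_of_linked_iSup hd (hx i) (hx j) h)⟩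
  · obtain ⟨x, rfl⟩ := Conf.mk'_surjective p
    rw [mk'_mem_spreadSet]
    rintro ⟨h1, h2⟩
    choose σ hσ using fun i => Opens.mem_iSup.1 (h1 i)
    have hinj : Function.Injective σ := fun i i' h => by
      by_contra hne
      exact h2 i i' hne (linked_of_mem (hB (σ i))
        (SetLike.coe_subset_coe.2 (le_iSup B (σ i))) (hσ i) (h ▸ hσ i'))
    let τ := Equiv.ofBijective σ (Finite.injective_iff_bijective.1 hinj)
    refine ⟨⟨fun i => x.1 (τ.symm i), x.2.comp τ.symm.injective⟩, fun i => ?_, ?_⟩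
    · have := hσ (τ.symm i)
      rwa [show σ (τ.symm i) = i from τ.apply_symm_apply i] at this
    · exact (Conf.mk'_eq_iff.2 ⟨τ.symm, fun _ => rfl⟩).symm

/-- A point of `⨆ B` extends to a configuration with one point in each `B i`. -/
theorem exists_mem_confProd {B : Fin k → Opens N} (hB : ∀ i, (B i : Set N).Nonempty)
    (hd : Pairwise (Function.onFun Disjoint B)) : (confProd B).Nonempty := by
  choose x hx using hB
  refine ⟨Conf.mk' ⟨x, fun i j h => ?_⟩, mem_confProd.2 ⟨_, fun i => hx i, rfl⟩⟩
  by_contra hne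
  exact Set.disjoint_left.1 (Opens.coe_disjoint.2 (hd hne)) (hx i) (h ▸ hx j)

theorem exists_mem_confProd_of_mem {B : Fin k → Opens N} (hB : ∀ i, (B i : Set N).Nonempty)
    (hd : Pairwise (Function.onFun Disjoint B)) {a : N} (ha : a ∈ (⨆ i, B i : Opens N)) :
    ∃ p ∈ confProd B, a ∈ p.points := by
  classical
  choose x hx using hB
  obtain ⟨i, hi⟩ := Opens.mem_iSup.1 ha
  have hx' : ∀ l, Function.update x i a l ∈ B l := fun l => by
    by_cases h : l = i
    · subst h; simpa using hi
    · simpa [h] using hx l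
  refine ⟨Conf.mk' ⟨Function.update x i a, fun l l' h => ?_⟩,
    mem_confProd.2 ⟨_, fun l => hx' l, rfl⟩, Conf.mem_mk'.2 ⟨i, by simp⟩⟩
  by_contra hne
  exact Set.disjoint_left.1 (Opens.coe_disjoint.2 (hd hne)) (hx' l) (h ▸ hx' l')

theorem isPreconnected_confProd {B : Fin k → Opens N} (hB : ∀ i, IsPreconnected (B i : Set N))
    (hd : Pairwise (Function.onFun Disjoint B)) : IsPreconnected (confProd B) := by
  have hinj : ∀ y ∈ univ.pi fun i => (B i : Set N), Function.Injective y := fun y hy i j h => by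
    by_contra hne
    exact Set.disjoint_left.1 (Opens.coe_disjoint.2 (hd hne)) (hy i trivial) (h ▸ hy j trivial)
  refine IsPreconnected.image ?_ _ Conf.continuous_mk'.continuousOn
  have hind : IsInducing (Subtype.val : OrdConf k N → Fin k → N) := ⟨rfl⟩
  rw [← hind.isPreconnected_image]
  convert isPreconnected_univ_pi hB using 1
  ext y
  constructor
  · rintro ⟨x, hx, rfl⟩ i -
    exact hx i
  · exact fun hy => ⟨⟨y, hinj y hy⟩, fun i => hy i trivial, rfl⟩

/-- If a configuration with one point in each `B i` is spread out in `U`, then so are all of them. -/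
theorem confProd_subset_spreadSet {B : Fin k → Opens N} (hB : ∀ i, IsPreconnected (B i : Set N))
    {U : Set N} (hU : ∀ i, (B i : Set N) ⊆ U) {p : Conf k N} (hp : p ∈ confProd B)
    (hpU : p ∈ spreadSet k U) : confProd B ⊆ spreadSet k U := by
  obtain ⟨x, hx, rfl⟩ := hp
  rintro _ ⟨y, hy, rfl⟩
  rw [mk'_mem_spreadSet] at hpU ⊢
  have hl : ∀ i, Linked U (x.1 i) (y.1 i) := fun i => linked_of_mem (hB i) (hU i) (hx i) (hy i)
  exact ⟨fun i => hU i (hy i),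
    fun i l hil h => hpU.2 i l hil (((hl i).trans h).trans (hl l).symm)⟩

/-- Pigeonhole: two of `k` points share one of `j < k` connected pieces. -/
theorem spreadSet_eq_empty {B : Fin j → Opens N} (hB : ∀ i, IsPreconnected (B i : Set N))
    (hjk : j < k) : spreadSet k ((⨆ i, B i : Opens N) : Set N) = ∅ := by
  refine eq_empty_of_forall_notMem fun p hp => ?_
  obtain ⟨x, rfl⟩ := Conf.mk'_surjective p
  rw [mk'_mem_spreadSet] at hp
  choose σ hσ using fun i => Opens.mem_iSup.1 (hp.1 i)
  obtain ⟨i, i', hne, h⟩ := Fintype.exists_ne_map_eq_of_card_lt σ (by simpa using hjk)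
  exact hp.2 i i' hne (linked_of_mem (hB (σ i)) (SetLike.coe_subset_coe.2 (le_iSup B (σ i)))
    (hσ i) (h ▸ hσ i'))

/-- The disjoint sets `B i` label the points, so a configuration in the product has a unique
ordering adapted to `B`. -/
theorem eq_of_mk'_eq_mk' {B : Fin k → Opens N} (hd : Pairwise (Function.onFun Disjoint B))
    {y z : OrdConf k N} (hy : ∀ i, y.1 i ∈ B i) (hz : ∀ i, z.1 i ∈ B i)
    (h : Conf.mk' y = Conf.mk' z) : y = z := by
  obtain ⟨σ, hσ⟩ := Conf.mk'_eq_iff.1 h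
  refine Subtype.ext (funext fun i => ?_)
  have : σ i = i := by
    by_contra hne
    exact Set.disjoint_left.1 (Opens.coe_disjoint.2 (hd hne)) (hy (σ i)) (hσ i ▸ hz i)
  rw [hσ, this]

/-- The products of pairwise disjoint elements of a basis of `N` form a basis of `F_k(N)`. -/
theorem exists_confProd_subset [T2Space N] {𝓑 : Set (Opens N)} (h𝓑 : Opens.IsBasis 𝓑)
    {O : Set (Conf k N)} (hO : IsOpen O) {x : OrdConf k N} (hx : Conf.mk' x ∈ O) :
    ∃ B : Fin k → Opens N, (∀ i, B i ∈ 𝓑) ∧ Pairwise (Function.onFun Disjoint B) ∧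
      (∀ i, x.1 i ∈ B i) ∧ confProd B ⊆ O := by
  have h1 : (Conf.mk' ⁻¹' O : Set (OrdConf k N)) ∈ 𝓝 x := (Conf.isOpen_iff.1 hO).mem_nhds hx
  rw [nhds_subtype_eq_comap, Filter.mem_comap] at h1
  obtain ⟨t, ht, htO⟩ := h1
  rw [nhds_pi, Filter.mem_pi'] at ht
  obtain ⟨I, A, hA, hAt⟩ := ht
  obtain ⟨S, hS, hSd⟩ := Conf.exists_separation x
  have h2 : ∀ i, ∃ B ∈ 𝓑, x.1 i ∈ B ∧ (B : Set N) ⊆ interior (A i) ∩ S i := fun i => by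
    obtain ⟨_, ⟨B, hB, rfl⟩, hxB, hBs⟩ := h𝓑.mem_nhds_iff.1
      ((isOpen_interior.inter (hS i).2).mem_nhds ⟨mem_interior_iff_mem_nhds.2 (hA i), (hS i).1⟩)
    exact ⟨B, hB, hxB, hBs⟩
  choose B hB hxB hBs using h2
  refine ⟨B, hB, fun i l hil => ?_, hxB, ?_⟩
  · exact Opens.coe_disjoint.1 ((hSd hil).mono (fun _ h => (hBs i h).2) fun _ h => (hBs l h).2)
  · rintro _ ⟨y, hy, rfl⟩
    exact htO (hAt fun i _ => interior_subset (hBs i (hy i)).1)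

end ComponentUnion

/-! ### The étale space of a locally constant functor on a basis -/

section Etale

variable {X : Type*} [TopologicalSpace X] {P : Type w} [Preorder P] {Q : P → Opens X}

/-- The preorder `P` is identified by `Q` with a basis of connected open subsets of `X`. -/
structure IsConnectedBasis (Q : P → Opens X) : Prop where
  le_iff : ∀ {V W : P}, V ≤ W ↔ Q V ≤ Q W
  exists_mem : ∀ {O : Set X}, IsOpen O → ∀ {x}, x ∈ O → ∃ V, x ∈ Q V ∧ (Q V : Set X) ⊆ O
  isConnected : ∀ V, IsConnected (Q V : Set X)

/-- Substitute for intersections, which need not belong to the basis: near any point, `P` is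
directed downwards. -/
theorem IsConnectedBasis.exists_le (hQ : IsConnectedBasis Q) {V W : P} {x : X} (hV : x ∈ Q V)
    (hW : x ∈ Q W) : ∃ V', V' ≤ V ∧ V' ≤ W ∧ x ∈ Q V' := by
  obtain ⟨V', hx, h⟩ := hQ.exists_mem ((Q V).2.inter (Q W).2) (x := x) ⟨hV, hW⟩
  exact ⟨V', hQ.le_iff.2 fun y hy => (h hy).1, hQ.le_iff.2 fun y hy => (h hy).2, hx⟩

variable {C : Type u} [Category.{v} C]

/-- Restriction of generalized elements of a contravariant functor on a preorder. -/
abbrev restr (G : Pᵒᵖ ⥤ C) {c : C} {V W : P} (h : V ≤ W) (g : c ⟶ G.obj (op W)) :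
    c ⟶ G.obj (op V) :=
  g ≫ G.map (homOfLE h).op

theorem restr_restr (G : Pᵒᵖ ⥤ C) {c : C} {V W Z : P} (h : V ≤ W) (h' : W ≤ Z)
    (g : c ⟶ G.obj (op Z)) : restr G h (restr G h' g) = restr G (h.trans h') g := by
  simp only [restr, Category.assoc, ← G.map_comp, ← op_comp, homOfLE_comp]

/-- The functor `G` sends all morphisms to isomorphisms. -/
def InvertsAll (G : Pᵒᵖ ⥤ C) : Prop :=
  ∀ ⦃V W : P⦄ (h : V ≤ W), IsIso (G.map (homOfLE h).op)

theorem InvertsAll.restr_injective {G : Pᵒᵖ ⥤ C} (hG : InvertsAll G) {c : C} {V W : P} (h : V ≤ W)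
    {g g' : c ⟶ G.obj (op W)} (he : restr G h g = restr G h g') : g = g' := by
  have := hG h
  exact (cancel_mono _).1 he

theorem InvertsAll.restr_surjective {G : Pᵒᵖ ⥤ C} (hG : InvertsAll G) {c : C} {V W : P} (h : V ≤ W)
    (g : c ⟶ G.obj (op V)) : ∃ g', restr G h g' = g := by
  have := hG h
  exact ⟨g ≫ inv (G.map (homOfLE h).op), by simp [restr]⟩

variable (hQ : IsConnectedBasis Q) (G : Pᵒᵖ ⥤ C) (c : C)

/-- Two sections near a point are identified if they agree near this point. -/
def germSetoid : Setoid (Σ V : P, (Q V) × (c ⟶ G.obj (op V))) where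
  r a b := (a.2.1 : X) = b.2.1 ∧ ∃ (V : P) (ha : V ≤ a.1) (hb : V ≤ b.1), (a.2.1 : X) ∈ Q V ∧
    restr G ha a.2.2 = restr G hb b.2.2
  iseqv :=
    { refl := fun a => ⟨rfl, a.1, le_rfl, le_rfl, a.2.1.2, rfl⟩
      symm := by
        rintro a b ⟨h, V, ha, hb, hV, he⟩
        exact ⟨h.symm, V, hb, ha, h ▸ hV, he.symm⟩
      trans := by
        rintro a b d ⟨h, V, ha, hb, hV, he⟩ ⟨h', W, hb', hd, hW, he'⟩
        obtain ⟨Z, hZV, hZW, hZ⟩ := hQ.exists_le hV (h ▸ hW)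
        refine ⟨h.trans h', Z, hZV.trans ha, hZW.trans hd, hZ, ?_⟩
        rw [← restr_restr G hZV ha, he, restr_restr, ← restr_restr G hZW hd, ← he',
          restr_restr] }

/-- The étale space of germs of generalized elements of `G`. -/
def Etale : Type _ := Quotient (germSetoid hQ G c)

variable {c}

/-- The germ at `p` of a generalized element. -/
def germ (V : P) (p : X) (hp : p ∈ Q V) (g : c ⟶ G.obj (op V)) : Etale hQ G c :=
  Quotient.mk (germSetoid hQ G c) ⟨V, ⟨p, hp⟩, g⟩

variable (c) in
/-- The projection of the étale space. -/
def Etale.proj : Etale hQ G c → X :=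
  Quotient.lift (fun a => (a.2.1 : X)) fun _ _ h => h.1

variable {hQ G}

@[simp]
theorem proj_germ {V : P} {p : X} {hp : p ∈ Q V} {g : c ⟶ G.obj (op V)} :
    Etale.proj hQ G c (germ hQ G V p hp g) = p := rfl

theorem germ_eq_iff {V W : P} {p q : X} {hp : p ∈ Q V} {hq : q ∈ Q W} {g : c ⟶ G.obj (op V)}
    {g' : c ⟶ G.obj (op W)} : germ hQ G V p hp g = germ hQ G W q hq g' ↔
      p = q ∧ ∃ (V' : P) (ha : V' ≤ V) (hb : V' ≤ W), p ∈ Q V' ∧ restr G ha g = restr G hb g' :=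
  Quotient.eq (r := germSetoid hQ G c)

theorem germ_restr {V W : P} (h : V ≤ W) {p : X} (hp : p ∈ Q V) (g : c ⟶ G.obj (op W)) :
    germ hQ G V p hp (restr G h g) = germ hQ G W p (hQ.le_iff.1 h hp) g := by
  rw [germ_eq_iff]
  exact ⟨rfl, V, le_rfl, h, hp, restr_restr _ _ _ _⟩

/-- Restrictions are invertible, so agreement near one point of `Q V` already forces equality on
`V`. -/
theorem germ_injective (hG : InvertsAll G) {V : P} {p : X} {hp : p ∈ Q V}
    {g g' : c ⟶ G.obj (op V)} (h : germ hQ G V p hp g = germ hQ G V p hp g') : g = g' := by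
  obtain ⟨-, V', ha, hb, hp', he⟩ := germ_eq_iff.1 h
  exact hG.restr_injective ha he

theorem exists_germ_eq (hG : InvertsAll G) (e : Etale hQ G c) {V : P}
    (hV : Etale.proj hQ G c e ∈ Q V) : ∃ g, germ hQ G V _ hV g = e := by
  obtain ⟨⟨W, ⟨p, hp⟩, g⟩, rfl⟩ := Quotient.exists_rep e
  obtain ⟨Z, hZV, hZW, hZ⟩ := hQ.exists_le hV hp
  obtain ⟨g', hg'⟩ := hG.restr_surjective hZV (restr G hZW g)
  exact ⟨g', germ_eq_iff.2 ⟨rfl, Z, hZV, hZW, hZ, hg'⟩⟩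

/-- The finest topology for which every local section `p ↦ germ V p g` is continuous. -/
instance : TopologicalSpace (Etale hQ G c) where
  IsOpen O := ∀ V g, IsOpen {p : X | ∃ hp : p ∈ Q V, germ hQ G V p hp g ∈ O}
  isOpen_univ V g := by simpa using (Q V).2
  isOpen_inter O O' h h' V g := by
    convert (h V g).inter (h' V g) using 1
    ext p
    exact ⟨fun ⟨hp, h1, h2⟩ => ⟨⟨hp, h1⟩, hp, h2⟩, fun ⟨⟨hp, h1⟩, _, h2⟩ => ⟨hp, h1, h2⟩⟩
  isOpen_sUnion S hS V g := by
    have : {p : X | ∃ hp : p ∈ Q V, germ hQ G V p hp g ∈ ⋃₀ S} =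
        ⋃ O ∈ S, {p : X | ∃ hp : p ∈ Q V, germ hQ G V p hp g ∈ O} := by
      ext p
      simp only [mem_sUnion, mem_ofPred_eq, mem_iUnion]
      exact ⟨fun ⟨hp, O, hO, h⟩ => ⟨O, hO, hp, h⟩, fun ⟨O, hO, hp, h⟩ => ⟨hp, O, hO, h⟩⟩
    rw [this]
    exact isOpen_biUnion fun O hO => hS O hO V g

theorem Etale.isOpen_iff {O : Set (Etale hQ G c)} :
    IsOpen O ↔ ∀ V g, IsOpen {p : X | ∃ hp : p ∈ Q V, germ hQ G V p hp g ∈ O} := Iff.rfl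

theorem Etale.continuous_proj : Continuous (Etale.proj hQ G c) := by
  refine continuous_def.2 fun O hO V g => ?_
  convert (Q V).2.inter hO using 1
  ext p
  exact ⟨fun ⟨h, h'⟩ => ⟨h, h'⟩, fun ⟨h, h'⟩ => ⟨h, h'⟩⟩

theorem continuous_germ (V : P) (g : c ⟶ G.obj (op V)) :
    Continuous fun p : Q V => germ hQ G V p p.2 g := by
  refine continuous_def.2 fun O hO => ?_
  convert (Etale.isOpen_iff.1 hO V g).preimage continuous_subtype_val using 1
  ext p
  exact ⟨fun h => ⟨p.2, h⟩, fun ⟨_, h⟩ => h⟩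

/-- Two generalized elements with the same germ at a point agree on a whole basis element around it,
so local sections are open maps. -/
theorem isOpen_image_germ {V : P} (g : c ⟶ G.obj (op V)) {O : Set X} (hO : IsOpen O) :
    IsOpen {e : Etale hQ G c | ∃ (p : X) (hp : p ∈ Q V), p ∈ O ∧ germ hQ G V p hp g = e} := by
  intro W g'
  rw [isOpen_iff_mem_nhds]
  rintro p ⟨hp, q, hq, hqO, he⟩
  obtain ⟨rfl, Z, hZV, hZW, hZ, hr⟩ := germ_eq_iff.1 he
  refine Filter.mem_of_superset (((Q Z).2.inter hO).mem_nhds ⟨hZ, hqO⟩) ?_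
  rintro r ⟨hrZ, hrO⟩
  exact ⟨hQ.le_iff.1 hZW hrZ, r, hQ.le_iff.1 hZV hrZ, hrO,
    germ_eq_iff.2 ⟨rfl, Z, hZV, hZW, hrZ, hr⟩⟩

/-- Over `Q V` every germ comes from exactly one element of `c ⟶ G(V)`, because `G` inverts all
morphisms. Hence the étale space is there the product of `Q V` with this discrete set. -/
theorem isCoveringMap_proj (hG : InvertsAll G) : IsCoveringMap (Etale.proj hQ G c) := by
  intro x
  obtain ⟨V, hxV, -⟩ := hQ.exists_mem isOpen_univ (mem_univ x)
  let I := c ⟶ G.obj (op V)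
  let _ : TopologicalSpace I := ⊥
  have : DiscreteTopology I := ⟨rfl⟩
  refine IsEvenlyCovered.to_isEvenlyCovered_preimage (I := I)
    ⟨inferInstance, Q V, hxV, (Q V).2, (Q V).2.preimage Etale.continuous_proj, ?_⟩
  let f : Q V × I → Etale.proj hQ G c ⁻¹' (Q V) := fun a => ⟨germ hQ G V a.1 a.1.2 a.2, a.1.2⟩
  have hf : Function.Bijective f := by
    constructor
    · rintro ⟨p, g⟩ ⟨q, g'⟩ h
      have h' : germ hQ G V p p.2 g = germ hQ G V q q.2 g' := congrArg Subtype.val h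
      obtain rfl : p = q := Subtype.ext (germ_eq_iff.1 h').1
      rw [germ_injective hG h']
    · rintro ⟨e, he⟩
      obtain ⟨g, hg⟩ := exists_germ_eq hG e he
      exact ⟨⟨⟨_, he⟩, g⟩, Subtype.ext hg⟩
  have hc : Continuous f := by
    refine Continuous.subtype_mk ?_ _
    rw [continuous_prod_of_discrete_right]
    exact fun g => continuous_germ V g
  have ho : IsOpenMap f := by
    intro S hS
    rw [((Q V).2.preimage Etale.continuous_proj).isOpenEmbedding_subtypeVal.isOpen_iff_image_isOpen]
    have : Subtype.val '' (f '' S) = ⋃ g : I, {e : Etale hQ G c | ∃ (p : X) (hp : p ∈ Q V),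
        p ∈ Subtype.val '' ((fun p : Q V => (p, g)) ⁻¹' S) ∧ germ hQ G V p hp g = e} := by
      ext e
      simp only [mem_image, mem_iUnion, mem_ofPred_eq, mem_preimage]
      constructor
      · rintro ⟨_, ⟨⟨p, g⟩, hp, rfl⟩, rfl⟩
        exact ⟨g, p, p.2, ⟨p, hp, rfl⟩, rfl⟩
      · rintro ⟨g, _, hp, ⟨p, hpS, rfl⟩, rfl⟩
        exact ⟨_, ⟨(p, g), hpS, rfl⟩, rfl⟩
    refine (congrArg IsOpen this).mpr ?_
    refine isOpen_iUnion fun g => isOpen_image_germ g ?_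
    exact (Q V).2.isOpenMap_subtype_val _ (hS.preimage (by fun_prop))
  refine ⟨((Equiv.ofBijective f hf).toHomeomorphOfContinuousOpen hc ho).symm, fun e => ?_⟩
  obtain ⟨a, rfl⟩ := hf.2 e
  have : ((Equiv.ofBijective f hf).toHomeomorphOfContinuousOpen hc ho).symm (f a) = a :=
    (Equiv.ofBijective f hf).symm_apply_apply a
  rw [this]
  rfl

/-- A compatible family of generalized elements defines a continuous section. -/
theorem exists_section_of_family {O : Opens X} (s : ∀ V, Q V ≤ O → (c ⟶ G.obj (op V)))
    (hs : ∀ {V W} (h : V ≤ W) (hW : Q W ≤ O), restr G h (s W hW) = s V ((hQ.le_iff.1 h).trans hW)) :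
    ∃ σ : C(O, Etale hQ G c), ∀ V (hV : Q V ≤ O) p (hp : p ∈ Q V),
      σ ⟨p, hV hp⟩ = germ hQ G V p hp (s V hV) := by
  have hB : ∀ p : O, ∃ V, (p : X) ∈ Q V ∧ Q V ≤ O := fun p => hQ.exists_mem O.2 p.2
  choose B hpB hBO using hB
  have key : ∀ V (hV : Q V ≤ O) (p : O) (hp : (p : X) ∈ Q V),
      germ hQ G (B p) p (hpB p) (s (B p) (hBO p)) = germ hQ G V p hp (s V hV) := by
    intro V hV p hp
    obtain ⟨Z, hZB, hZV, hZ⟩ := hQ.exists_le (hpB p) hp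
    exact germ_eq_iff.2 ⟨rfl, Z, hZB, hZV, hZ, by rw [hs, hs]⟩
  refine ⟨⟨fun p => germ hQ G (B p) p (hpB p) (s (B p) (hBO p)), ?_⟩,
    fun V hV p hp => key V hV ⟨p, hV hp⟩ hp⟩
  refine continuous_iff_continuousAt.2 fun p => ?_
  have hN : (Subtype.val ⁻¹' (Q (B p) : Set X) : Set O) ∈ 𝓝 p :=
    ((Q (B p)).2.preimage continuous_subtype_val).mem_nhds (hpB p)
  refine ContinuousOn.continuousAt (s := Subtype.val ⁻¹' (Q (B p) : Set X)) ?_ hN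
  rw [continuousOn_iff_continuous_domRestrict]
  have : Continuous fun q : (Subtype.val ⁻¹' (Q (B p) : Set X) : Set O) =>
      germ hQ G (B p) (q : O) q.2 (s (B p) (hBO p)) :=
    (continuous_germ (B p) (s (B p) (hBO p))).comp
      (f := fun q : (Subtype.val ⁻¹' (Q (B p) : Set X) : Set O) => (⟨(q : O), q.2⟩ : Q (B p)))
      (by fun_prop)
  convert this using 1
  ext q
  exact key _ (hBO p) q q.2

/-- A continuous section is given on a connected basis element by a generalized element. -/
theorem exists_germ_of_section (hG : InvertsAll G) {V : P} (σ : Q V → Etale hQ G c)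
    (hσ : Continuous σ) (hσ' : ∀ p, Etale.proj hQ G c (σ p) = p) :
    ∃ g, ∀ p : Q V, σ p = germ hQ G V p p.2 g := by
  obtain ⟨p₀, hp₀⟩ := (hQ.isConnected V).nonempty
  have hp₀' : Etale.proj hQ G c (σ ⟨p₀, hp₀⟩) ∈ Q V := by rw [hσ']; exact hp₀
  obtain ⟨g, hg⟩ := exists_germ_eq hG _ hp₀'
  refine ⟨g, fun p => ?_⟩
  have : PreconnectedSpace (Q V) :=
    isPreconnected_iff_preconnectedSpace.1 (hQ.isConnected V).isPreconnected
  -- Two lifts to a covering space that agree at one point agree on the connected set `Q V`.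
  refine congrFun ((isCoveringMap_proj hG).eq_of_comp_eq hσ (continuous_germ V g) ?_
    ⟨p₀, hp₀⟩ ?_) p
  · ext q
    simp [hσ']
  · rw [← hg]
    congr 1
    exact hσ' _

end Etale

/-! ### Families of sections and homotopies -/

section Family

variable {X : Type*} [TopologicalSpace X] {P : Type w} [Preorder P] {Q : P → Opens X}
  {C : Type u} [Category.{v} C]

/-- The generalized elements `s V`, for `Q V ≤ O`, are compatible with restrictions. -/
structure IsCompatible (Q : P → Opens X) (G : Pᵒᵖ ⥤ C) {c : C} (O : Opens X)
    (s : ∀ V, Q V ≤ O → (c ⟶ G.obj (op V))) : Prop where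
  restr_eq : ∀ {V W : P} (h : V ≤ W) (hV : Q V ≤ O) (hW : Q W ≤ O), restr G h (s W hW) = s V hV

variable (hQ : IsConnectedBasis Q) {G : Pᵒᵖ ⥤ C} (hG : InvertsAll G) {c : C} {O₀ O₁ : Opens X}
  (hO : O₀ ≤ O₁) (H : C(unitInterval × O₀, O₁)) (ρ : C(O₁, O₀))
  (h0 : ∀ p : O₀, (H (0, p) : X) = p) (h1 : ∀ p, H (1, ρ p) = p)

include hQ hG h0 h1

/-- Each point `q` of `O₁` is the end of the path `H (·, ρ q)`, which starts in `O₀`. There the two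
sections agree, and uniqueness of path lifting carries the equality to `q`. -/
theorem IsCompatible.ext_of_homotopy {s s' : ∀ V, Q V ≤ O₁ → (c ⟶ G.obj (op V))}
    (hs : IsCompatible Q G O₁ s) (hs' : IsCompatible Q G O₁ s')
    (h : ∀ V (hV : Q V ≤ O₀), s V (hV.trans hO) = s' V (hV.trans hO)) : s = s' := by
  obtain ⟨σ, hσ⟩ := exists_section_of_family (hQ := hQ) s fun h hW => hs.restr_eq h _ hW
  obtain ⟨σ', hσ'⟩ := exists_section_of_family (hQ := hQ) s' fun h hW => hs'.restr_eq h _ hW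
  have hp : ∀ p : O₁, Etale.proj hQ G c (σ p) = p ∧ Etale.proj hQ G c (σ' p) = p := fun p => by
    obtain ⟨V, hpV, hV⟩ := hQ.exists_mem O₁.2 p.2
    exact ⟨by rw [hσ V hV p hpV, proj_germ], by rw [hσ' V hV p hpV, proj_germ]⟩
  funext V hV
  obtain ⟨p, hpV⟩ := (hQ.isConnected V).nonempty
  refine germ_injective hG (hp := hpV) (hQ := hQ) ?_
  rw [← hσ V hV, ← hσ' V hV]
  set q : O₁ := ⟨p, hV hpV⟩ with hq
  have := congrFun ((isCoveringMap_proj hG (hQ := hQ) (c := c)).eq_of_comp_eq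
    (g₁ := fun t => σ (H (t, ρ q))) (g₂ := fun t => σ' (H (t, ρ q))) (by fun_prop) (by fun_prop)
    (by ext t; simp [hp]) 0 ?_) 1
  · simpa only [h1] using this
  · obtain ⟨W, hpW, hW⟩ := hQ.exists_mem O₀.2 (ρ q).2
    have hW' : Q W ≤ O₀ := hW
    have hH : H (0, ρ q) = ⟨ρ q, hO (ρ q).2⟩ := Subtype.ext (h0 _)
    rw [hH, hσ W (hW'.trans hO) _ hpW, hσ' W (hW'.trans hO) _ hpW, h W hW']

/-- Lift the homotopy `H` to the étale space, starting from the section over `O₀`, and read the lift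
at time 1, transported by `ρ`. -/
theorem IsCompatible.exists_extension_of_homotopy (h1' : ∀ p, ρ (H (1, p)) = p)
    {s : ∀ V, Q V ≤ O₀ → (c ⟶ G.obj (op V))} (hs : IsCompatible Q G O₀ s) :
    ∃ s' : ∀ V, Q V ≤ O₁ → (c ⟶ G.obj (op V)), IsCompatible Q G O₁ s' ∧
      ∀ V (hV : Q V ≤ O₀), s' V (hV.trans hO) = s V hV := by
  have cov := isCoveringMap_proj hG (hQ := hQ) (c := c)
  obtain ⟨σ, hσ⟩ := exists_section_of_family (hQ := hQ) s fun h hW => hs.restr_eq h _ hW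
  have hp : ∀ p : O₀, Etale.proj hQ G c (σ p) = p := fun p => by
    obtain ⟨V, hpV, hV⟩ := hQ.exists_mem O₀.2 p.2
    rw [hσ V hV p hpV, proj_germ]
  let K : C(unitInterval × O₀, X) := ⟨fun q => H q, by fun_prop⟩
  let Z := cov.liftHomotopy K σ fun p => (h0 p).trans (hp p).symm
  have hZp : ∀ q, Etale.proj hQ G c (Z q) = H q := fun q =>
    congrFun (cov.liftHomotopy_lifts K σ fun p => (h0 p).trans (hp p).symm) q
  let τ : O₁ → Etale hQ G c := fun p => Z (1, ρ p)
  have hτ : Continuous τ := by fun_prop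
  have hτp : ∀ p, Etale.proj hQ G c (τ p) = p := fun p => by rw [hZp, h1]
  have hτσ : ∀ p : O₀, τ ⟨p, hO p.2⟩ = σ p := fun p => by
    -- Both sides lift the path `H (·, p)`. They agree at time 1 because `ρ` inverts the final
    -- stage, hence also at time 0, where they are the new and the old section.
    have := congrFun (cov.eq_of_comp_eq (g₁ := fun t => τ (H (t, p))) (g₂ := fun t => Z (t, p))
      (by fun_prop) (by fun_prop) (by ext t; simp [hτp, hZp]) 1 (by simp [τ, h1'])) 0
    have hH : H (0, p) = ⟨p, hO p.2⟩ := Subtype.ext (h0 _)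
    rw [← hH, this]
    exact cov.liftHomotopy_zero ..
  have hg : ∀ V (hV : Q V ≤ O₁), ∃ g : c ⟶ G.obj (op V),
      ∀ p : Q V, τ ⟨p, hV p.2⟩ = germ hQ G V p p.2 g := fun V hV =>
    exists_germ_of_section hG (fun p : Q V => τ ⟨p, hV p.2⟩) (by fun_prop) fun p => hτp _
  choose s' hs' using hg
  refine ⟨s', ⟨fun {V W} h hV hW => ?_⟩, fun V hV => ?_⟩
  · obtain ⟨p, hpV⟩ := (hQ.isConnected V).nonempty
    refine germ_injective hG (hp := hpV) (hQ := hQ) ?_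
    rw [germ_restr, ← hs' V hV ⟨p, hpV⟩, ← hs' W hW ⟨p, hQ.le_iff.1 h hpV⟩]
  · obtain ⟨p, hpV⟩ := (hQ.isConnected V).nonempty
    refine germ_injective hG (hp := hpV) (hQ := hQ) ?_
    rw [← hs' V (hV.trans hO) ⟨p, hpV⟩, ← hσ V hV]
    exact hτσ ⟨p, hV hpV⟩

end Family

/-! ### Maps between configuration spaces -/

section ConfMap

variable {k : ℕ} {N N' : Type w} 

/-- A lift of a configuration to an ordered configuration. -/
noncomputable def Conf.lift (p : Conf k N) : OrdConf k N := (Conf.mk'_surjective p).choose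

theorem Conf.mk'_lift (p : Conf k N) : Conf.mk' p.lift = p := (Conf.mk'_surjective p).choose_spec

theorem Conf.lift_mem (p : Conf k N) (i : Fin k) : p.lift.1 i ∈ p.points := by
  have : p.lift.1 i ∈ (Conf.mk' p.lift).points := Conf.mem_mk'.2 ⟨i, rfl⟩
  rwa [p.mk'_lift] at this

/-- The image of a configuration in `S` under an injective map defined on `S`. -/
noncomputable def Conf.map {S : Set N} (f : S → N') (hf : Function.Injective f) (p : Conf k N)
    (hp : ∀ a ∈ p.points, a ∈ S) : Conf k N' :=
  Conf.mk' ⟨fun i => f ⟨p.lift.1 i, hp _ (p.lift_mem i)⟩,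
    fun _ _ h => p.lift.2 (congrArg Subtype.val (hf h))⟩

variable {S : Set N} {f : S → N'} {hf : Function.Injective f} 

/-- The image does not depend on the ordering chosen by `Conf.lift`. -/
theorem Conf.map_mk' {x : OrdConf k N} {hp : ∀ a ∈ (Conf.mk' x).points, a ∈ S} :
    Conf.map f hf (Conf.mk' x) hp = Conf.mk' ⟨fun i => f ⟨x.1 i, hp _ (Conf.mem_mk'.2 ⟨i, rfl⟩)⟩,
      fun _ _ h => x.2 (congrArg Subtype.val (hf h))⟩ := by
  obtain ⟨σ, hσ⟩ := Conf.mk'_eq_iff.1 (Conf.mk' x).mk'_lift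
  refine Conf.mk'_eq_iff.2 ⟨σ, fun i => ?_⟩
  simp only [hσ]

theorem Conf.mem_map {p : Conf k N} {hp : ∀ a ∈ p.points, a ∈ S} {b : N'} :
    b ∈ (Conf.map f hf p hp).points ↔ ∃ (a : N) (ha : a ∈ p.points), f ⟨a, hp a ha⟩ = b := by
  obtain ⟨x, rfl⟩ := Conf.mk'_surjective p
  rw [Conf.map_mk', Conf.mem_mk']
  constructor
  · rintro ⟨i, rfl⟩
    exact ⟨x.1 i, Conf.mem_mk'.2 ⟨i, rfl⟩, rfl⟩
  · rintro ⟨a, ha, rfl⟩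
    obtain ⟨i, rfl⟩ := Conf.mem_mk'.1 ha
    exact ⟨i, rfl⟩

theorem Conf.ext_points {p q : Conf k N} (h : ∀ a, a ∈ p.points ↔ a ∈ q.points) : p = q := by
  have := Finset.ext h
  cases p; cases q; simp_all

theorem Conf.continuous_map [TopologicalSpace N] [TopologicalSpace N'] {A : Type*}
    [TopologicalSpace A] {f : A × S → N'} (hfc : Continuous f)
    (hf : ∀ t, Function.Injective fun a => f (t, a)) {O : Set (Conf k N)}
    (hO : ∀ p ∈ O, ∀ a ∈ p.points, a ∈ S) :
    Continuous fun q : A × O => Conf.map (fun a => f (q.1, a)) (hf q.1) q.2 (hO _ q.2.2) := by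
  -- Openness makes the quotient map stay a quotient map after restriction to `O` and after a
  -- product with `A`, so continuity can be tested on ordered configurations.
  have hq : IsOpenQuotientMap (O.restrictPreimage (Conf.mk' : OrdConf k N → Conf k N)) :=
    ⟨Conf.mk'_surjective.restrictPreimage O, Conf.continuous_mk'.restrictPreimage,
      Conf.isOpenMap_mk'.restrictPreimage O⟩
  rw [← ((IsOpenQuotientMap.id (X := A)).prodMap hq).continuous_comp_iff]
  have hS : ∀ (x : (Conf.mk' ⁻¹' O : Set (OrdConf k N))) i, x.1.1 i ∈ S := fun x i =>
    hO _ x.2 _ (Conf.mem_mk'.2 ⟨i, rfl⟩)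
  have : Continuous fun q : A × (Conf.mk' ⁻¹' O : Set (OrdConf k N)) =>
      (⟨fun i => f (q.1, ⟨q.2.1.1 i, hS q.2 i⟩), fun _ _ h =>
        q.2.1.2 (congrArg Subtype.val (hf q.1 h))⟩ : OrdConf k N') := by
    refine Continuous.subtype_mk (continuous_pi fun i => hfc.comp ?_) _
    refine continuous_fst.prodMk (Continuous.subtype_mk ?_ _)
    exact (OrdConf.continuous_apply i).comp (continuous_subtype_val.comp continuous_snd)
  convert Conf.continuous_mk'.comp this using 1
  ext q : 1
  exact Conf.map_mk' (f := fun a => f (q.1, a)) (x := q.2.1) (hf := hf q.1) (hp := hO _ q.2.2)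

end ConfMap

/-! ### Isotopies acting on spread configurations -/

section IsotopySpread

variable {k : ℕ} {E : Type*} [NormedAddCommGroup E] [NormedSpace ℝ E]
  {N : Type w} [TopologicalSpace N] [ChartedSpace E N]

/-- Move all points of a configuration by the isotopy; injectivity of each stage keeps them
distinct. The last stage is a homeomorphism onto `W`, and its inverse induces `ρ`. -/
theorem IsIsotopyEquiv.exists_homotopy [LocallyConnectedSpace N] {U W : Opens N}
    (h : IsIsotopyEquiv E U W) :
    ∃ (H : C(unitInterval × spread k U, spread k W)) (ρ : C(spread k W, spread k U)),
      (∀ p : spread k U, (H (0, p) : Conf k N) = p) ∧ (∀ p, H (1, ρ p) = p) ∧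
        ∀ p, ρ (H (1, p)) = p := by
  obtain ⟨hUW, L, hLc, hL0, hL1, hL⟩ := h
  have hsurj : Function.Surjective fun x : U => L (x, 1) := fun y => by
    have : (y : N) ∈ range (fun x : U => ((L (x, 1) : W) : N)) := by rw [hL1]; exact y.2
    obtain ⟨x, hx⟩ := this
    exact ⟨x, Subtype.ext hx⟩
  let e : U ≃ₜ W := (hL 1).isEmbedding.toHomeomorphOfSurjective hsurj
  have he : ∀ x, e x = L (x, 1) := fun x => rfl
  let F : unitInterval × (U : Set N) → N := fun q => L (q.2, q.1)
  have hF : Continuous F := by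
    have : Continuous fun q : unitInterval × U => (L (q.2, q.1) : N) := by fun_prop
    exact this
  have hFi : ∀ t, Function.Injective fun a => F (t, a) := fun t a b hab =>
    (hL t).isEmbedding.injective (Subtype.ext hab)
  -- A trivial parameter, so that `Conf.continuous_map` also covers the inverse of the last stage.
  let R : Unit × (W : Set N) → N := fun q => e.symm q.2
  have hR : Continuous R := by
    have : Continuous fun q : Unit × W => (e.symm q.2 : N) := by fun_prop
    exact this
  have hRi : ∀ t, Function.Injective fun a => R (t, a) := fun t a b hab =>
    e.symm.injective (Subtype.ext hab)
  have hpath : ∀ (a : U) t, Linked (W : Set N) (L (a, t)) (L (a, 1)) := fun a t => by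
    refine ⟨range fun s => (L (a, s) : N), ?_, isPreconnected_range (by fun_prop), ⟨t, rfl⟩,
      ⟨1, rfl⟩⟩
    rintro _ ⟨s, rfl⟩
    exact (L (a, s)).2
  have hmem : ∀ q : unitInterval × spread k U,
      Conf.map (fun a => F (q.1, a)) (hFi q.1) q.2 q.2.2.1 ∈ spread k W := by
    rintro ⟨t, p, hp⟩
    refine ⟨fun b hb => ?_, fun b hb b' hb' hne hl => ?_⟩
    · obtain ⟨a, ha, rfl⟩ := Conf.mem_map.1 hb
      exact (L _).2
    · obtain ⟨a, ha, rfl⟩ := Conf.mem_map.1 hb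
      obtain ⟨a', ha', rfl⟩ := Conf.mem_map.1 hb'
      -- Points linked at time `t` stay linked along their tracks up to time 1. The inverse
      -- homeomorphism then links the original points in `U`.
      have h1 := ((hpath ⟨a, hp.1 a ha⟩ t).symm.trans hl).trans (hpath ⟨a', hp.1 a' ha'⟩ t)
      have h2 := Linked.map (V := (W : Set N)) (W := (U : Set N)) (f := e.symm)
        e.symm.continuous h1
      rw [← he, ← he, e.symm_apply_apply, e.symm_apply_apply] at h2
      refine hp.2 a ha a' ha' (fun h => hne ?_) h2
      subst h; rfl
  have hmem' : ∀ q : Unit × spread k W,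
      Conf.map (fun a => R (q.1, a)) (hRi q.1) q.2 q.2.2.1 ∈ spread k U := by
    rintro ⟨t, p, hp⟩
    refine ⟨fun b hb => ?_, fun b hb b' hb' hne hl => ?_⟩
    · obtain ⟨a, ha, rfl⟩ := Conf.mem_map.1 hb
      exact (e.symm _).2
    · obtain ⟨a, ha, rfl⟩ := Conf.mem_map.1 hb
      obtain ⟨a', ha', rfl⟩ := Conf.mem_map.1 hb'
      have h2 := Linked.map (V := (U : Set N)) (W := (W : Set N)) (f := e)
        e.continuous hl
      simp only [Homeomorph.apply_symm_apply] at h2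
      refine hp.2 a ha a' ha' (fun h => hne ?_) h2
      subst h; rfl
  have hHc := Conf.continuous_map hF hFi (O := (spread k U : Set (Conf k N))) fun p hp => hp.1
  have hρc := (Conf.continuous_map hR hRi (O := (spread k W : Set (Conf k N))) fun p hp => hp.1).comp
    (continuous_const (y := ()) |>.prodMk continuous_id)
  refine ⟨⟨fun q => ⟨_, hmem q⟩, hHc.subtype_mk _⟩, ⟨fun q => ⟨_, hmem' ((), q)⟩, hρc.subtype_mk _⟩,
    fun p => ?_, fun p => Subtype.ext ?_, fun p => Subtype.ext ?_⟩
  · refine Conf.ext_points fun a => Conf.mem_map.trans ?_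
    simp only [F, hL0]
    exact ⟨fun ⟨_, h, h'⟩ => h' ▸ h, fun h => ⟨a, h, rfl⟩⟩
  · refine Conf.ext_points fun a => Conf.mem_map.trans ?_
    constructor
    · rintro ⟨b, hb, rfl⟩
      obtain ⟨c, hc, rfl⟩ := Conf.mem_map.1 hb
      have : (e (e.symm ⟨c, p.2.1 c hc⟩) : N) = c := by rw [e.apply_symm_apply]
      exact (congrArg (· ∈ p.1.points) this).mpr hc
    · intro ha
      refine ⟨e.symm ⟨a, p.2.1 a ha⟩, Conf.mem_map.2 ⟨a, ha, rfl⟩, ?_⟩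
      have : (e (e.symm ⟨a, p.2.1 a ha⟩) : N) = a := by rw [e.apply_symm_apply]
      exact this
  · refine Conf.ext_points fun a => Conf.mem_map.trans ?_
    constructor
    · rintro ⟨b, hb, rfl⟩
      obtain ⟨c, hc, rfl⟩ := Conf.mem_map.1 hb
      have : (e.symm (e ⟨c, p.2.1 c hc⟩) : N) = c := by rw [e.symm_apply_apply]
      exact (congrArg (· ∈ p.1.points) this).mpr hc
    · intro ha
      refine ⟨e ⟨a, p.2.1 a ha⟩, Conf.mem_map.2 ⟨a, ha, rfl⟩, ?_⟩
      have : (e.symm (e ⟨a, p.2.1 a ha⟩) : N) = a := by rw [e.symm_apply_apply]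
      exact this

theorem IsIsotopyEquiv.spread_le [LocallyConnectedSpace N] {U W : Opens N}
    (h : IsIsotopyEquiv E U W) : spread k U ≤ spread k W := fun p hp => by
  obtain ⟨H, _, h0, -⟩ := h.exists_homotopy (k := k)
  have := (H (0, ⟨p, hp⟩)).2
  rwa [h0] at this

end IsotopySpread

/-! ### Parametrized balls -/

section BallParam

variable {E : Type*} [NormedAddCommGroup E] [NormedSpace ℝ E]
  {N : Type*} [TopologicalSpace N] [ChartedSpace E N]

/-- `φ` is a diffeomorphism of the model space onto the open subset `B`, with inverse `ψ`. -/
structure BallParam (B : Opens N) (φ : E → N) (ψ : N → E) : Prop where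
  contMDiff : ContMDiff 𝓘(ℝ, E) 𝓘(ℝ, E) ∞ φ
  contMDiffAt : ∀ x ∈ B, ContMDiffAt 𝓘(ℝ, E) 𝓘(ℝ, E) ∞ ψ x
  mem : ∀ v, φ v ∈ B
  left_inv : ∀ v, ψ (φ v) = v
  right_inv : ∀ x ∈ B, φ (ψ x) = x

theorem BallParam.isConnected {B : Opens N} {φ : E → N} {ψ : N → E} (h : BallParam B φ ψ) :
    IsConnected (B : Set N) := by
  have : (B : Set N) = range φ := by
    ext x
    exact ⟨fun hx => ⟨ψ x, h.right_inv x hx⟩, fun ⟨v, hv⟩ => hv ▸ h.mem v⟩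
  rw [this]
  exact isConnected_range h.contMDiff.continuous

/-- A left inverse smooth at the points of the image gives injective differentials by the chain rule
and the inducing property by continuity. -/
theorem isSmoothEmb_of_leftInverse {X Y : Type*} [TopologicalSpace X] [ChartedSpace E X]
    [TopologicalSpace Y] [ChartedSpace E Y] {f : X → Y} {g : Y → X}
    (hf : ContMDiff 𝓘(ℝ, E) 𝓘(ℝ, E) ∞ f) (hg : ∀ x, ContMDiffAt 𝓘(ℝ, E) 𝓘(ℝ, E) ∞ g (f x))
    (hgf : ∀ x, g (f x) = x) : IsSmoothEmb (E := E) f where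
  contMDiff := hf
  injective_mfderiv x := by
    have h := mfderiv_comp x ((hg x).mdifferentiableAt (by simp))
      ((hf x).mdifferentiableAt (by simp))
    have hid : g ∘ f = id := funext hgf
    rw [hid, mfderiv_id] at h
    intro a b hab
    have ha : a = mfderiv 𝓘(ℝ, E) 𝓘(ℝ, E) g (f x) (mfderiv 𝓘(ℝ, E) 𝓘(ℝ, E) f x a) :=
      DFunLike.congr_fun h a
    have hb : b = mfderiv 𝓘(ℝ, E) 𝓘(ℝ, E) g (f x) (mfderiv 𝓘(ℝ, E) 𝓘(ℝ, E) f x b) :=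
      DFunLike.congr_fun h b
    exact ha.trans ((congrArg _ hab).trans hb.symm)
  isEmbedding := by
    refine ⟨isInducing_iff_nhds.2 fun x => le_antisymm hf.continuous.continuousAt.le_comap ?_,
      Function.LeftInverse.injective hgf⟩
    have h := (hg x).continuousAt.tendsto.le_comap
    rw [hgf] at h
    refine (Filter.comap_mono h).trans ?_
    rw [Filter.comap_comap, show g ∘ f = id from funext hgf, Filter.comap_id]

end BallParam

/-! ### Balls parametrized by the whole model space -/

section UnitBall

variable {E : Type*} [NormedAddCommGroup E] [InnerProductSpace ℝ E]
  {N : Type*} [TopologicalSpace N] [ChartedSpace E N]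

theorem univUnitBall_mem (v : E) : OpenPartialHomeomorph.univUnitBall v ∈ unitBall E :=
  OpenPartialHomeomorph.univUnitBall.map_source (mem_univ v)

theorem univUnitBall_left_inv (v : E) :
    OpenPartialHomeomorph.univUnitBall.symm (OpenPartialHomeomorph.univUnitBall v) = v :=
  OpenPartialHomeomorph.univUnitBall.left_inv (mem_univ v)

theorem univUnitBall_right_inv (v : unitBall E) :
    OpenPartialHomeomorph.univUnitBall (OpenPartialHomeomorph.univUnitBall.symm (v : E)) = v :=
  OpenPartialHomeomorph.univUnitBall.right_inv v.2

theorem contMDiffAt_univUnitBall_symm (v : unitBall E) :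
    ContMDiffAt 𝓘(ℝ, E) 𝓘(ℝ, E) ∞ (OpenPartialHomeomorph.univUnitBall (E := E)).symm v :=
  (OpenPartialHomeomorph.contDiffOn_univUnitBall_symm.contDiffAt
    ((unitBall E).2.mem_nhds v.2)).contMDiffAt

/-- The unit ball is diffeomorphic to `E`; with all of `E` as the domain, the rescalings in
`stretch` are defined everywhere. -/
theorem IsBall.exists_ballParam {B : Opens N} (h : IsBall E B) :
    ∃ (φ : E → N) (ψ : N → E), BallParam B φ ψ := by
  classical
  obtain ⟨d⟩ := h
  let φ : E → N := fun v => d.symm ⟨_, univUnitBall_mem v⟩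
  -- The value 0 outside `B` is arbitrary: smoothness is required only at points of the open set
  -- `B`.
  let ψ : N → E := fun x => if hx : x ∈ B then
    OpenPartialHomeomorph.univUnitBall.symm (d ⟨x, hx⟩ : E) else 0
  have hψ : ∀ x : B, ψ x = OpenPartialHomeomorph.univUnitBall.symm (d x : E) := fun x =>
    dif_pos x.2
  refine ⟨φ, ψ, ?_, ?_, fun v => (d.symm _).2, fun v => ?_, fun x hx => ?_⟩
  · refine contMDiff_subtype_val.comp (d.symm.contMDiff.comp ?_)
    rw [← ContMDiff.subtypeVal_comp_iff]
    exact OpenPartialHomeomorph.contDiff_univUnitBall.contMDiff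
  · intro x hx
    have key : ContMDiffAt 𝓘(ℝ, E) 𝓘(ℝ, E) ∞ (fun y : B => ψ y) ⟨x, hx⟩ := by
      simp only [hψ]
      exact (contMDiffAt_univUnitBall_symm _).comp (⟨x, hx⟩ : B)
        (contMDiff_subtype_val.comp d.contMDiff).contMDiffAt
    exact contMDiffAt_subtype_iff.1 key
  · rw [hψ (d.symm _), d.apply_symm_apply]
    exact univUnitBall_left_inv v
  · simp only [φ, hψ ⟨x, hx⟩, univUnitBall_right_inv]
    simp

theorem BallParam.isBall {B : Opens N} {φ : E → N} {ψ : N → E} (h : BallParam B φ ψ) :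
    IsBall E B := by
  refine ⟨⟨⟨fun x => ⟨_, univUnitBall_mem (ψ x)⟩,
    fun v => ⟨φ (OpenPartialHomeomorph.univUnitBall.symm (v : E)), h.mem _⟩, fun x => ?_,
    fun v => ?_⟩, ?_, ?_⟩⟩
  · exact Subtype.ext (by simp only [univUnitBall_left_inv, h.right_inv x x.2])
  · exact Subtype.ext (by simp only [h.left_inv, univUnitBall_right_inv])
  · rw [← ContMDiff.subtypeVal_comp_iff]
    refine OpenPartialHomeomorph.contDiff_univUnitBall.contMDiff.comp ?_
    exact fun x => contMDiffAt_subtype_iff.2 (h.contMDiffAt x x.2)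
  · rw [← ContMDiff.subtypeVal_comp_iff]
    refine h.contMDiff.comp fun v => ?_
    exact contMDiffAt_subtype_iff.2 (contMDiffAt_univUnitBall_symm v)

theorem IsBall.isConnected {B : Opens N} (h : IsBall E B) : IsConnected (B : Set N) := by
  obtain ⟨φ, ψ, hp⟩ := h.exists_ballParam
  exact hp.isConnected

end UnitBall

/-! ### Stretching an embedding of the model space to an affine isomorphism -/

section Stretch

variable {E : Type*} [NormedAddCommGroup E] [NormedSpace ℝ E]

open scoped Classical in
/-- The family of rescalings of `h` around `0`, joining `h` to its affine approximation at `0`. -/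
noncomputable def stretch (h : E → E) (s : ℝ) (v : E) : E :=
  if s = 0 then h 0 + fderiv ℝ h 0 v else h 0 + s⁻¹ • (h (s • v) - h 0)

open scoped Classical in
/-- The inverse of `stretch h s`, where `h'` is the inverse of `h`. -/
noncomputable def unstretch (h h' : E → E) (s : ℝ) (w : E) : E :=
  if s = 0 then fderiv ℝ h' (h 0) (w - h 0) else s⁻¹ • h' (h 0 + s • (w - h 0))

variable {h h' : E → E}

theorem stretch_one (v : E) : stretch h 1 v = h v := by simp [stretch]

/-- Only `s = 0` needs an argument: the difference quotients of `h` at `0` converge to the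
differential uniformly on bounded sets. -/
theorem continuous_stretch (hh : ContDiff ℝ ∞ h) : Continuous fun p : ℝ × E => stretch h p.1 p.2 := by
  refine continuous_iff_continuousAt.2 fun ⟨s, v⟩ => ?_
  by_cases hs : s = 0
  · subst hs
    have hd : HasFDerivAt h (fderiv ℝ h 0) 0 := (hh.differentiable (by simp) 0).hasFDerivAt
    have hsm : Filter.Tendsto (fun p : ℝ × E => p.1 • p.2) (𝓝 (0, v)) (𝓝 0) := by
      have : Continuous fun p : ℝ × E => p.1 • p.2 := by fun_prop
      simpa using this.tendsto (0, v)
    have key : Filter.Tendsto (fun p : ℝ × E => stretch h p.1 p.2 - (h 0 + fderiv ℝ h 0 p.2))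
        (𝓝 (0, v)) (𝓝 0) := by
      rw [Metric.tendsto_nhds]
      intro ε hε
      have hC : 0 < ‖v‖ + 1 := by positivity
      -- The constant makes the error at most `ε / 2` as long as `‖p.2‖ < ‖v‖ + 1`.
      have ho := hsm.eventually (hd.isLittleO.def (c := ε / (2 * (‖v‖ + 1))) (by positivity))
      have hv : ∀ᶠ p : ℝ × E in 𝓝 (0, v), ‖p.2‖ < ‖v‖ + 1 :=
        (continuous_snd.norm.tendsto (0, v)).eventually (gt_mem_nhds (by simp))
      filter_upwards [ho, hv] with p hp hpv
      rw [dist_zero_right]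
      by_cases h0 : p.1 = 0
      · simpa [stretch, h0] using hε
      · simp only [sub_zero, map_smul, norm_smul] at hp
        have e : stretch h p.1 p.2 - (h 0 + fderiv ℝ h 0 p.2) =
            p.1⁻¹ • (h (p.1 • p.2) - h 0 - p.1 • fderiv ℝ h 0 p.2) := by
          rw [smul_sub _ _ (p.1 • _), smul_smul, inv_mul_cancel₀ h0, one_smul]
          simp only [stretch, h0, if_false]
          abel
        rw [e, norm_smul, norm_inv]
        have h0' : 0 < ‖p.1‖ := norm_pos_iff.2 h0
        calc ‖p.1‖⁻¹ * ‖h (p.1 • p.2) - h 0 - p.1 • fderiv ℝ h 0 p.2‖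
            ≤ ‖p.1‖⁻¹ * (ε / (2 * (‖v‖ + 1)) * (‖p.1‖ * ‖p.2‖)) := by gcongr
          _ = ε / (2 * (‖v‖ + 1)) * ‖p.2‖ := by field_simp
          _ ≤ ε / (2 * (‖v‖ + 1)) * (‖v‖ + 1) := by gcongr
          _ = ε / 2 := by field_simp
          _ < ε := by linarith
    have h2 : Filter.Tendsto (fun p : ℝ × E => h 0 + fderiv ℝ h 0 p.2) (𝓝 (0, v))
        (𝓝 (h 0 + fderiv ℝ h 0 v)) := by
      have : Continuous fun p : ℝ × E => h 0 + fderiv ℝ h 0 p.2 := by fun_prop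
      exact this.tendsto (0, v)
    have h3 := key.add h2
    simp only [sub_add_cancel, zero_add] at h3
    simpa [ContinuousAt, stretch] using h3
  · have he : (fun p : ℝ × E => h 0 + p.1⁻¹ • (h (p.1 • p.2) - h 0)) =ᶠ[𝓝 (s, v)]
        fun p : ℝ × E => stretch h p.1 p.2 := by
      filter_upwards [continuous_fst.continuousAt.eventually_ne (x := (s, v)) hs] with p hp
      simp [stretch, hp]
    refine ContinuousAt.congr ?_ he
    have hc := hh.continuous
    have : ContinuousAt (fun p : ℝ × E => p.1⁻¹) (s, v) := continuousAt_fst.inv₀ hs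
    fun_prop

theorem contDiff_stretch (hh : ContDiff ℝ ∞ h) (s : ℝ) : ContDiff ℝ ∞ (stretch h s) := by
  unfold stretch
  split_ifs
  · exact contDiff_const.add (fderiv ℝ h 0).contDiff
  · fun_prop

theorem unstretch_stretch (hh : ContDiff ℝ ∞ h) (hh' : ∀ v, ContDiffAt ℝ ∞ h' (h v))
    (hl : ∀ v, h' (h v) = v) (s : ℝ) (v : E) : unstretch h h' s (stretch h s v) = v := by
  by_cases hs : s = 0
  · simp only [unstretch, stretch, hs, if_true, add_sub_cancel_left]
    have hc := fderiv_comp (𝕜 := ℝ) 0 ((hh' 0).differentiableAt (by simp))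
      (hh.differentiable (by simp) 0)
    rw [show h' ∘ h = id from funext hl, fderiv_id] at hc
    exact (DFunLike.congr_fun hc v).symm
  · simp [unstretch, stretch, hs, hl, smul_smul]

theorem contDiffAt_unstretch (hh' : ∀ v, ContDiffAt ℝ ∞ h' (h v)) (s : ℝ) (v : E) :
    ContDiffAt ℝ ∞ (unstretch h h' s) (stretch h s v) := by
  by_cases hs : s = 0
  · have : unstretch h h' s = fun w => fderiv ℝ h' (h 0) (w - h 0) := by
      funext w; simp [unstretch, hs]
    rw [this]
    exact ((fderiv ℝ h' (h 0)).contDiff.comp (contDiff_id.sub contDiff_const)).contDiffAt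
  · have : unstretch h h' s = fun w => s⁻¹ • h' (h 0 + s • (w - h 0)) := by
      funext w; simp [unstretch, hs]
    rw [this]
    refine contDiffAt_const.smul (ContDiffAt.comp _ ?_ (by fun_prop))
    convert hh' (s • v) using 1
    simp [stretch, hs, smul_smul]

/-- Since `h'` is a two-sided inverse near `h 0`, the differential of `h` at `0` is onto. So the
stage `s = 0` fills all of `E`, and this lets the isotopy end on the whole target. -/
theorem stretch_zero_unstretch (hh : ContDiff ℝ ∞ h) (hh' : ∀ v, ContDiffAt ℝ ∞ h' (h v))
    (hl : ∀ v, h' (h v) = v) (hr : ∀ᶠ w in 𝓝 (h 0), h (h' w) = w) (w : E) :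
    stretch h 0 (unstretch h h' 0 w) = w := by
  simp only [unstretch, stretch, if_true]
  have h0 : h' (h 0) = 0 := hl 0
  have hc := fderiv_comp (𝕜 := ℝ) (f := h') (g := h) (h 0) (hh.differentiable (by simp) _)
    ((hh' 0).differentiableAt (by simp))
  have hid : h ∘ h' =ᶠ[𝓝 (h 0)] id := hr
  rw [hid.fderiv_eq, fderiv_id, h0] at hc
  have := DFunLike.congr_fun hc (w - h 0)
  simp only [ContinuousLinearMap.id_apply, ContinuousLinearMap.comp_apply] at this
  rw [← this]
  abel

end Stretch

/-! ### Componentwise inclusions of disjoint unions of balls are isotopy equivalences -/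

section BallIsotopy

variable {E : Type*} [NormedAddCommGroup E] [InnerProductSpace ℝ E]
  {N : Type*} [TopologicalSpace N] [ChartedSpace E N]

/-- In parametrizations of the balls, each inclusion `B i ≤ B' i` becomes an embedding `h i` of `E`
into itself. The rescalings `stretch (h i) s` join it, at `s = 1`, to an affine isomorphism at `s =
0`; this is done on all components at once. -/
theorem isIsotopyEquiv_iSup {j : ℕ} {B B' : Fin j → Opens N} (hB : ∀ i, IsBall E (B i))
    (hB' : ∀ i, IsBall E (B' i)) (hd' : Pairwise (Function.onFun Disjoint B'))
    (hle : ∀ i, B i ≤ B' i) : IsIsotopyEquiv E (⨆ i, B i) (⨆ i, B' i) := by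
  have hd : Pairwise (Function.onFun Disjoint B) := fun i l h => (hd' h).mono (hle i) (hle l)
  have huniq : ∀ {B : Fin j → Opens N}, Pairwise (Function.onFun Disjoint B) → ∀ {i l x},
      x ∈ B i → x ∈ B l → i = l := fun hd i l x hi hl => by
    by_contra hne
    exact Set.disjoint_left.1 (Opens.coe_disjoint.2 (hd hne)) hi hl
  choose φ ψ hp using fun i => (hB i).exists_ballParam
  choose φ' ψ' hp' using fun i => (hB' i).exists_ballParam
  let h : Fin j → E → E := fun i v => ψ' i (φ i v)
  let h' : Fin j → E → E := fun i v => ψ i (φ' i v)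
  have hφB' : ∀ i v, φ i v ∈ B' i := fun i v => hle i ((hp i).mem v)
  have hh : ∀ i, ContDiff ℝ ∞ (h i) := fun i => contMDiff_iff_contDiff.1 fun v =>
    ((hp' i).contMDiffAt _ (hφB' i v)).comp v ((hp i).contMDiff v)
  have hφh : ∀ i v, φ' i (h i v) = φ i v := fun i v => (hp' i).right_inv _ (hφB' i v)
  have hh' : ∀ i v, ContDiffAt ℝ ∞ (h' i) (h i v) := fun i v => contMDiffAt_iff_contDiffAt.1 <|
    ((hp i).contMDiffAt _ (by rw [hφh]; exact (hp i).mem v)).comp _ ((hp' i).contMDiff _)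
  have hl : ∀ i v, h' i (h i v) = v := fun i v => by
    simp only [h', hφh, (hp i).left_inv]
  have hr : ∀ i, ∀ᶠ w in 𝓝 (h i 0), h i (h' i w) = w := fun i => by
    have : ∀ᶠ w in 𝓝 (h i 0), φ' i w ∈ B i :=
      (hp' i).contMDiff.continuous.continuousAt.eventually_mem
        ((B i).2.mem_nhds (by rw [hφh]; exact (hp i).mem 0))
    filter_upwards [this] with w hw
    simp only [h, h', (hp i).right_inv _ hw, (hp' i).left_inv]
  choose idx hidx using fun x : (⨆ i, B i : Opens N) => Opens.mem_iSup.1 x.2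
  choose idx' hidx' using fun x : (⨆ i, B' i : Opens N) => Opens.mem_iSup.1 x.2
  let l : Fin j → ℝ → N → N := fun i s x => φ' i (stretch (h i) s (ψ i x))
  let m : Fin j → ℝ → N → N := fun i s y => φ i (unstretch (h i) (h' i) s (ψ' i y))
  have hlB : ∀ i s x, l i s x ∈ B' i := fun i s x => (hp' i).mem _
  have hmB : ∀ i s y, m i s y ∈ B i := fun i s y => (hp i).mem _
  have hml : ∀ i s, ∀ x ∈ B i, m i s (l i s x) = x := fun i s x hx => by
    simp only [m, l, (hp' i).left_inv, unstretch_stretch (hh i) (hh' i) (hl i),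
      (hp i).right_inv x hx]
  -- Time `t` is the stage `s = 1 - t`, so that `t = 0` is the inclusion. Continuity and smoothness
  -- may be checked with the index fixed, as `idx` is locally constant.
  let L : (⨆ i, B i : Opens N) × unitInterval → (⨆ i, B' i : Opens N) := fun q =>
    ⟨l (idx q.1) (1 - q.2) q.1, Opens.mem_iSup.2 ⟨_, hlB _ _ _⟩⟩
  let R : ℝ → (⨆ i, B' i : Opens N) → (⨆ i, B i : Opens N) := fun s y =>
    ⟨m (idx' y) s y, Opens.mem_iSup.2 ⟨_, hmB _ _ _⟩⟩
  have hnear : ∀ x : (⨆ i, B i : Opens N), ∀ᶠ y in 𝓝 x, idx y = idx x := fun x => by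
    filter_upwards [((B (idx x)).2.preimage continuous_subtype_val).mem_nhds (hidx x)] with y hy
    exact huniq hd (hidx y) hy
  have hnear' : ∀ x : (⨆ i, B' i : Opens N), ∀ᶠ y in 𝓝 x, idx' y = idx' x := fun x => by
    filter_upwards [((B' (idx' x)).2.preimage continuous_subtype_val).mem_nhds (hidx' x)] with y hy
    exact huniq hd' (hidx' y) hy
  have hidxL : ∀ q, idx' (L q) = idx q.1 := fun q => huniq hd' (hidx' _) (hlB _ _ _)
  refine ⟨iSup_mono hle, L, ?_, fun x => Subtype.ext ?_, ?_, fun t => ?_⟩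
  · refine Continuous.subtype_mk (continuous_iff_continuousAt.2 fun ⟨x, t⟩ => ?_) _
    have he : (fun q : (⨆ i, B i : Opens N) × unitInterval => l (idx x) (1 - q.2) q.1) =ᶠ[𝓝 (x, t)]
        fun q => l (idx q.1) (1 - q.2) q.1 := by
      filter_upwards [continuousAt_fst.eventually (hnear x)] with q hq
      rw [hq]
    refine ContinuousAt.congr ?_ he
    have h1 : ContinuousAt (fun q : (⨆ i, B i : Opens N) × unitInterval => ψ (idx x) q.1) (x, t) :=
      ContinuousAt.comp (g := ψ (idx x)) (f := fun q : (⨆ i, B i : Opens N) × unitInterval => (q.1 : N))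
        ((hp _).contMDiffAt _ (hidx x)).continuousAt (by fun_prop)
    have h2 : ContinuousAt (fun q : (⨆ i, B i : Opens N) × unitInterval =>
        ((1 - q.2 : ℝ), ψ (idx x) q.1)) (x, t) :=
      ContinuousAt.prodMk
        (continuous_const.sub (continuous_subtype_val.comp continuous_snd)).continuousAt h1
    exact ((hp' (idx x)).contMDiff.continuous.comp (continuous_stretch (hh _))).continuousAt.comp h2
  · simp only [L, l, Set.Icc.coe_zero, sub_zero, stretch_one, hφh, (hp _).right_inv _ (hidx x)]
  · refine Subset.antisymm (range_subset_iff.2 fun x => (L _).2) fun y hy => ?_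
    obtain ⟨i, hi⟩ := Opens.mem_iSup.1 hy
    have hxB : m i 0 y ∈ B i := hmB _ _ _
    let x : (⨆ i, B i : Opens N) := ⟨m i 0 y, Opens.mem_iSup.2 ⟨i, hxB⟩⟩
    refine ⟨x, ?_⟩
    have hix : idx x = i := huniq hd (hidx x) hxB
    simp only [L, hix, Set.Icc.coe_one, sub_self]
    simp only [l, x, m, (hp i).left_inv,
      stretch_zero_unstretch (hh i) (hh' i) (hl i) (hr i), (hp' i).right_inv y hi]
  · refine isSmoothEmb_of_leftInverse (g := R (1 - t)) ?_ ?_ ?_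
    · rw [← ContMDiff.subtypeVal_comp_iff]
      intro x
      have h1 : ContMDiffAt 𝓘(ℝ, E) 𝓘(ℝ, E) ∞ (l (idx x) (1 - t)) (x : N) :=
        ((hp' _).contMDiff.comp (contDiff_stretch (hh _) _).contMDiff).contMDiffAt.comp (x : N)
          ((hp _).contMDiffAt _ (hidx x))
      refine (contMDiffAt_subtype_iff.2 h1).congr_of_eventuallyEq ?_
      filter_upwards [hnear x] with y hy
      simp only [Function.comp_apply, L, hy]
    · intro x
      rw [← ContMDiffAt.subtypeVal_comp_iff]
      have h0 : ContMDiffAt 𝓘(ℝ, E) 𝓘(ℝ, E) ∞ (unstretch (h (idx x)) (h' (idx x)) (1 - t))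
          (ψ' (idx x) (L (x, t))) := by
        simp only [L, l, (hp' _).left_inv]
        exact (contDiffAt_unstretch (hh' _) _ _).contMDiffAt
      have h1 : ContMDiffAt 𝓘(ℝ, E) 𝓘(ℝ, E) ∞ (m (idx x) (1 - t)) (L (x, t) : N) :=
        (hp _).contMDiff.contMDiffAt.comp (L (x, t) : N)
          (h0.comp (L (x, t) : N) ((hp' _).contMDiffAt _ (hlB _ _ _)))
      refine (contMDiffAt_subtype_iff.2 h1).congr_of_eventuallyEq ?_
      filter_upwards [hnear' (L (x, t))] with y hy
      simp only [Function.comp_apply, R, hy, hidxL]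
    · intro x
      refine Subtype.ext ?_
      simp only [R, hidxL]
      exact hml _ _ _ (hidx x)

/-- A single configuration in both products matches their balls by a permutation `σ`. Every point of
`B i` occurs in some configuration of the product, so `B i` lies in the union of the `B' l`, and by
connectedness in `B' (σ i)`. -/
theorem isIsotopyEquiv_of_spreadSet_subset {k : ℕ} {B B' : Fin k → Opens N}
    (hB : ∀ i, IsBall E (B i)) (hB' : ∀ i, IsBall E (B' i))
    (hd : Pairwise (Function.onFun Disjoint B)) (hd' : Pairwise (Function.onFun Disjoint B'))
    (h : spreadSet k ((⨆ i, B i : Opens N) : Set N) ⊆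
      spreadSet k ((⨆ i, B' i : Opens N) : Set N)) :
    IsIsotopyEquiv E (⨆ i, B i) (⨆ i, B' i) := by
  rw [← confProd_eq_spreadSet (fun i => (hB i).isConnected.isPreconnected) hd,
    ← confProd_eq_spreadSet (fun i => (hB' i).isConnected.isPreconnected) hd'] at h
  have hU : ∀ i, (B i : Set N) ⊆ ((⨆ i, B' i : Opens N) : Set N) := fun i a ha => by
    obtain ⟨p, hp, hap⟩ := exists_mem_confProd_of_mem (fun i => (hB i).isConnected.nonempty) hd
      (Opens.mem_iSup.2 ⟨i, ha⟩)
    obtain ⟨y, hy, rfl⟩ := h hp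
    obtain ⟨l, rfl⟩ := Conf.mem_mk'.1 hap
    exact Opens.mem_iSup.2 ⟨l, hy l⟩
  obtain ⟨_, x, hx, rfl⟩ := exists_mem_confProd (fun i => (hB i).isConnected.nonempty) hd
  obtain ⟨y, hy, hyx⟩ := h ⟨x, hx, rfl⟩
  obtain ⟨σ, hσ⟩ := Conf.mk'_eq_iff.1 hyx
  have hσB : ∀ i, x.1 i ∈ B' (σ i) := fun i => hσ i ▸ hy (σ i)
  have hle : ∀ i, B i ≤ B' (σ i) := fun i a ha => by
    obtain ⟨l, hl⟩ := Opens.mem_iSup.1 (hU i ha)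
    have := eq_of_linked_iSup hd' hl (hσB i)
      (linked_of_mem (hB i).isConnected.isPreconnected (hU i) ha (hx i))
    exact this ▸ hl
  rw [← σ.iSup_comp (g := B')]
  exact isIsotopyEquiv_iSup hB (fun i => hB' _) (fun i l hil => hd' (σ.injective.ne hil)) hle

end BallIsotopy

/-! ### Products of disjoint balls are balls in the configuration space -/

section ConfBall

variable {k : ℕ} {E : Type*} [NormedAddCommGroup E] [InnerProductSpace ℝ E]
  {M : Type w} [TopologicalSpace M] [T2Space M] [ChartedSpace E M]

theorem confChart_symm_apply (y : OrdConf k M) (v : ConfModel k E) :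
    (confChart E y).symm v = Conf.mk' ((ordConfChart E y).symm v) := by
  simp [confChart]

theorem eventually_confChart_mk' (y : OrdConf k M) :
    ∀ᶠ z in 𝓝 y, confChart E y (Conf.mk' z) = ordConfChart E y z := by
  filter_upwards [(Conf.isLocalHomeomorph_mk'.localInverseAt y).open_target.mem_nhds
    Conf.isLocalHomeomorph_mk'.self_mem_localInverseAt_target] with z hz
  have := (Conf.isLocalHomeomorph_mk'.localInverseAt y).right_inv hz
  rw [IsLocalHomeomorph.localInverseAt_symm] at this
  simp only [confChart, OpenPartialHomeomorph.coe_trans, Function.comp_apply, this]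

variable [IsManifold 𝓘(ℝ, E) ∞ M]

theorem confChart_mem_maximalAtlas (y : OrdConf k M) :
    confChart E y ∈ IsManifold.maximalAtlas 𝓘(ℝ, ConfModel k E) ∞ (Conf k M) :=
  StructureGroupoid.subset_maximalAtlas _ ⟨y, rfl⟩

/-- The parametrization is `v ↦ {φ₁ v₁, …, φ_k v_k}`. Its inverse orders a configuration by the
balls containing its points, and both are smooth because they act factorwise in the charts. -/
theorem exists_ballParam_confProd {B : Fin k → Opens M} (hB : ∀ i, IsBall E (B i))
    (hd : Pairwise (Function.onFun Disjoint B)) {W : Opens (Conf k M)}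
    (hW : (W : Set (Conf k M)) = confProd B) :
    ∃ (Φ : ConfModel k E → Conf k M) (Ψ : Conf k M → ConfModel k E), BallParam W Φ Ψ := by
  classical
  choose φ ψ hp using fun i => (hB i).exists_ballParam
  have hinj : ∀ v : ConfModel k E, Function.Injective fun i => φ i (v i) := fun v i l h => by
    by_contra hne
    refine Set.disjoint_left.1 (Opens.coe_disjoint.2 (hd hne)) ((hp i).mem (v i)) ?_
    exact (congrArg (· ∈ (B l : Set M)) h).mpr ((hp l).mem (v l))
  let F : ConfModel k E → OrdConf k M := fun v => ⟨fun i => φ i (v i), hinj v⟩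
  have hF : ∀ v i, (F v).1 i ∈ B i := fun v i => (hp i).mem _
  have hW' : ∀ p, p ∈ W ↔ ∃ z : OrdConf k M, (∀ i, z.1 i ∈ B i) ∧ Conf.mk' z = p := fun p => by
    rw [← SetLike.mem_coe, hW, mem_confProd]
  -- The ordering adapted to `B` is unique, so the choice is harmless; the value 0 off the product
  -- is arbitrary.
  let Ψ : Conf k M → ConfModel k E := fun p =>
    if h : ∃ z : OrdConf k M, (∀ i, z.1 i ∈ B i) ∧ Conf.mk' z = p then
      WithLp.toLp 2 fun i => ψ i (h.choose.1 i) else 0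
  have hΨ : ∀ z : OrdConf k M, (∀ i, z.1 i ∈ B i) →
      Ψ (Conf.mk' z) = WithLp.toLp 2 fun i => ψ i (z.1 i) := fun z hz => by
    have h : ∃ z' : OrdConf k M, (∀ i, z'.1 i ∈ B i) ∧ Conf.mk' z' = Conf.mk' z := ⟨z, hz, rfl⟩
    have := eq_of_mk'_eq_mk' hd h.choose_spec.1 hz h.choose_spec.2
    simp only [Ψ, dif_pos h, this]
  have hsrc : ∀ {y : OrdConf k M}, ∀ᶠ z in 𝓝 y, ∀ i, z.1 i ∈ (chartAt E (y.1 i)).source :=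
    fun {y} => Filter.eventually_all.2 fun i =>
      (OrdConf.continuous_apply i).continuousAt.eventually_mem (chart_source_mem_nhds E (y.1 i))
  refine ⟨fun v => Conf.mk' (F v), Ψ, fun v₀ => ?_, fun p hp₀ => ?_, fun v => ?_, fun v => ?_,
    fun p hp₀ => ?_⟩
  · have hFc : Continuous F := by
      refine Continuous.subtype_mk (continuous_pi fun i => ?_) _
      have := (hp i).contMDiff.continuous
      fun_prop
    let g : ConfModel k E → ConfModel k E := fun v => ordConfChart E (F v₀) (F v)
    have hg : ContDiffAt ℝ ∞ g v₀ := by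
      rw [contDiffAt_piLp]
      intro i
      simp only [g, ordConfChart_apply]
      have h1 : ContMDiffAt 𝓘(ℝ, E) 𝓘(ℝ, E) ∞ (fun a => chartAt E ((F v₀).1 i) (φ i a)) (v₀ i) :=
        (contMDiffAt_of_mem_maximalAtlas (IsManifold.chart_mem_maximalAtlas _)
          (mem_chart_source E ((F v₀).1 i))).comp (v₀ i) ((hp i).contMDiff (v₀ i))
      exact (contMDiffAt_iff_contDiffAt.1 h1).comp v₀ (f := fun v : ConfModel k E => v i)
        (by fun_prop)
    have h2 : ContMDiffAt 𝓘(ℝ, ConfModel k E) 𝓘(ℝ, ConfModel k E) ∞ (confChart E (F v₀)).symm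
        (g v₀) := by
      refine contMDiffAt_symm_of_mem_maximalAtlas (confChart_mem_maximalAtlas _) ?_
      have := (confChart E (F v₀)).map_source (mem_confChart_source E (F v₀))
      rwa [(eventually_confChart_mk' (F v₀)).self_of_nhds] at this
    refine (h2.comp v₀ hg.contMDiffAt).congr_of_eventuallyEq ?_
    filter_upwards [hFc.continuousAt.eventually (hsrc (y := F v₀))] with v hv
    rw [Function.comp_apply, confChart_symm_apply,
      (ordConfChart E (F v₀)).left_inv ((mem_ordConfChart_source E).2 hv)]
  · obtain ⟨y, hy, rfl⟩ := (hW' p).1 hp₀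
    let g : ConfModel k E → ConfModel k E := fun v =>
      WithLp.toLp 2 fun i => ψ i ((chartAt E (y.1 i)).symm (v i))
    have hy0 : confChart E y (Conf.mk' y) = ordConfChart E y y :=
      (eventually_confChart_mk' y).self_of_nhds
    have hg : ContDiffAt ℝ ∞ g (confChart E y (Conf.mk' y)) := by
      rw [contDiffAt_piLp, hy0]
      intro i
      have h0 : ordConfChart E y y i = chartAt E (y.1 i) (y.1 i) := ordConfChart_apply E y y i
      have h1 : ContMDiffAt 𝓘(ℝ, E) 𝓘(ℝ, E) ∞ (fun a => ψ i ((chartAt E (y.1 i)).symm a))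
          (ordConfChart E y y i) := by
        rw [h0]
        refine ContMDiffAt.comp (g := ψ i) _ ?_ (contMDiffAt_symm_of_mem_maximalAtlas
          (IsManifold.chart_mem_maximalAtlas _) (mem_chart_target E (y.1 i)))
        rw [(chartAt E (y.1 i)).left_inv (mem_chart_source E (y.1 i))]
        exact (hp i).contMDiffAt _ (hy i)
      exact (contMDiffAt_iff_contDiffAt.1 h1).comp _ (f := fun v : ConfModel k E => v i)
        (by fun_prop)
    have h2 := hg.contMDiffAt.comp (Conf.mk' y) (contMDiffAt_of_mem_maximalAtlas
      (confChart_mem_maximalAtlas y) (mem_confChart_source E y))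
    refine h2.congr_of_eventuallyEq ?_
    -- The quotient map is a local homeomorphism, so a property near `mk' y` can be checked on
    -- ordered configurations near `y`.
    have hmap : Filter.map Conf.mk' (𝓝 y) = 𝓝 (Conf.mk' y) :=
      Conf.isLocalHomeomorph_mk'.map_nhds_eq y
    rw [Filter.EventuallyEq, ← hmap, Filter.eventually_map]
    have hyB : ∀ᶠ z in 𝓝 y, ∀ i, z.1 i ∈ B i := Filter.eventually_all.2 fun i =>
      (OrdConf.continuous_apply i).continuousAt.eventually_mem ((B i).2.mem_nhds (hy i))
    filter_upwards [hyB, hsrc (y := y), eventually_confChart_mk' (E := E) y] with z hz hzs hzc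
    rw [hΨ z hz, Function.comp_apply, hzc]
    simp only [g, ordConfChart_apply]
    congr 1
    funext i
    rw [(chartAt E (y.1 i)).left_inv (hzs i)]
  · exact (hW' _).2 ⟨F v, hF v, rfl⟩
  · rw [hΨ _ (hF v)]
    ext i
    exact (hp i).left_inv _
  · obtain ⟨y, hy, rfl⟩ := (hW' p).1 hp₀
    rw [hΨ y hy]
    congr 1
    exact Subtype.ext (funext fun i => (hp i).right_inv _ (hy i))

theorem isBallBasis_confBasis {𝓑 : Set (Opens M)} (h𝓑 : IsBallBasis E 𝓑) :
    IsBallBasis (ConfModel k E) (confBasis k 𝓑) := by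
  constructor
  · refine Opens.isBasis_iff_nbhd.2 fun {U p} hp => ?_
    obtain ⟨x, rfl⟩ := Conf.mk'_surjective p
    obtain ⟨B, hB, hd, hx, hU⟩ := exists_confProd_subset h𝓑.1 U.2 hp
    have ho : IsOpen (confProd B) := by
      refine Conf.isOpenMap_mk' _ ?_
      simp only [ofPred_forall]
      exact isOpen_iInter_of_finite fun i => (B i).2.preimage (OrdConf.continuous_apply i)
    exact ⟨⟨_, ho⟩, ⟨B, hB, hd, rfl⟩, ⟨x, hx, rfl⟩, hU⟩
  · rintro W ⟨B, hB, hd, hW⟩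
    obtain ⟨Φ, Ψ, h⟩ := exists_ballParam_confProd (fun i => h𝓑.2 _ (hB i)) hd hW
    exact h.isBall

end ConfBall

/-! ### The basis of all balls -/

section AllBalls

variable {E : Type*} [NormedAddCommGroup E] [InnerProductSpace ℝ E]
  {M : Type w} [TopologicalSpace M] [ChartedSpace E M] [IsManifold 𝓘(ℝ, E) ∞ M]

/-- Small metric balls in charts are balls of the manifold. This is the largest ball basis, from
which `T` is built. -/
theorem isBallBasis_setOf_isBall : IsBallBasis E {B : Opens M | IsBall E B} := by
  refine ⟨Opens.isBasis_iff_nbhd.2 fun {U x} hx => ?_, fun B hB => hB⟩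
  let c := chartAt E x
  have hO : c.target ∩ c.symm ⁻¹' U ∈ 𝓝 (c x) :=
    (c.isOpen_inter_preimage_symm U.2).mem_nhds
      ⟨mem_chart_target E x, by rw [mem_preimage, c.left_inv (mem_chart_source E x)]; exact hx⟩
  obtain ⟨r, hr, hball⟩ := Metric.mem_nhds_iff.1 hO
  let u := OpenPartialHomeomorph.univBall (c x) r
  have hut : u.target = Metric.ball (c x) r := OpenPartialHomeomorph.univBall_target _ hr
  have hus : u.source = univ := OpenPartialHomeomorph.univBall_source _ _
  have hu : ∀ v, u v ∈ Metric.ball (c x) r := fun v => hut ▸ u.map_source (hus ▸ mem_univ v)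
  let B : Opens M := ⟨c.source ∩ c ⁻¹' Metric.ball (c x) r,
    c.isOpen_inter_preimage Metric.isOpen_ball⟩
  refine ⟨B, ?_, ⟨mem_chart_source E x, Metric.mem_ball_self hr⟩, fun z hz => ?_⟩
  · refine BallParam.isBall (φ := fun v => c.symm (u v)) (ψ := fun z => u.symm (c z))
      ⟨fun v => ?_, fun z hz => ?_, fun v => ⟨?_, ?_⟩, fun v => ?_, fun z hz => ?_⟩
    · exact (contMDiffAt_symm_of_mem_maximalAtlas (IsManifold.chart_mem_maximalAtlas x)
        (hball (hu v)).1).comp v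
        (OpenPartialHomeomorph.contDiff_univBall (n := ⊤)).contMDiff.contMDiffAt
    · exact (((OpenPartialHomeomorph.contDiffOn_univBall_symm (n := ⊤)).contDiffAt
        (Metric.isOpen_ball.mem_nhds hz.2)).contMDiffAt).comp z
        (contMDiffAt_of_mem_maximalAtlas (IsManifold.chart_mem_maximalAtlas x) hz.1)
    · exact c.map_target (hball (hu v)).1
    · rw [mem_preimage, c.right_inv (hball (hu v)).1]
      exact hu v
    · simp only [c.right_inv (hball (hu v)).1]
      exact u.left_inv (hus ▸ mem_univ v)
    · rw [u.right_inv (hut ▸ hz.2), c.left_inv hz.1]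
  · have := (hball hz.2).2
    rwa [mem_preimage, c.left_inv hz.1] at this

end AllBalls

/-! ### Disjoint unions of balls and their configurations -/

section BallUnion

variable {k j : ℕ} {E : Type*} [NormedAddCommGroup E] [InnerProductSpace ℝ E]
  {N : Type w} [TopologicalSpace N] [ChartedSpace E N]

theorem BasisUnion.isBallUnion {𝓑 : Set (Opens N)} (h𝓑 : IsBallBasis E 𝓑)
    (V : BasisUnion E k 𝓑) : IsBallUnion E k V.carrier := by
  obtain ⟨B, hB, hd, hV⟩ := V.exists_eq
  exact ⟨B, fun i => h𝓑.2 _ (hB i), hd, hV⟩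

variable [LocallyConnectedSpace N]

theorem IsBallUnion.spread_eq_bot {V : Opens N} (hV : IsBallUnion E j V) (hjk : j < k) :
    spread k V = ⊥ := by
  obtain ⟨B, hB, -, rfl⟩ := hV
  exact Opens.ext (spreadSet_eq_empty (fun i => (hB i).isConnected.isPreconnected) hjk)

theorem IsBallUnion.isConnected_spread {V : Opens N} (hV : IsBallUnion E k V) :
    IsConnected (spread k V : Set (Conf k N)) := by
  obtain ⟨B, hB, hd, rfl⟩ := hV
  rw [coe_spread, ← confProd_eq_spreadSet (fun i => (hB i).isConnected.isPreconnected) hd]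
  exact ⟨exists_mem_confProd (fun i => (hB i).isConnected.nonempty) hd,
    isPreconnected_confProd (fun i => (hB i).isConnected.isPreconnected) hd⟩

/-- Every point of `V` belongs to some spread configuration of `V`, one point being chosen in each
other ball. -/
theorem IsBallUnion.le_of_spread_subset {V : Opens N} (hV : IsBallUnion E k V) {U : Set N}
    (h : ∀ p ∈ spread k V, ∀ a ∈ p.points, a ∈ U) : (V : Set N) ⊆ U := by
  obtain ⟨B, hB, hd, rfl⟩ := hV
  intro a ha
  obtain ⟨p, hp, hap⟩ := exists_mem_confProd_of_mem (fun i => (hB i).isConnected.nonempty) hd ha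
  rw [confProd_eq_spreadSet (fun i => (hB i).isConnected.isPreconnected) hd] at hp
  exact h p hp a hap

theorem IsBallUnion.le_of_spread_le {V U : Opens N} (hV : IsBallUnion E k V)
    (h : spread k V ≤ spread k U) : V ≤ U :=
  hV.le_of_spread_subset fun _ hp a ha => (h hp).1 a ha

/-- One common configuration suffices: the others arise from it by moving points inside connected
balls. -/
theorem IsBallUnion.spread_le {V U : Opens N} (hV : IsBallUnion E k V) (h : V ≤ U) {p : Conf k N}
    (hp : p ∈ spread k V) (hpU : p ∈ spread k U) : spread k V ≤ spread k U := by
  obtain ⟨B, hB, hd, rfl⟩ := hV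
  have hBp : ∀ i, IsPreconnected (B i : Set N) := fun i => (hB i).isConnected.isPreconnected
  rw [mem_spread, ← confProd_eq_spreadSet hBp hd] at hp
  have := confProd_subset_spreadSet hBp
    (fun i => SetLike.coe_subset_coe.2 ((le_iSup B i).trans h)) hp hpU
  rwa [confProd_eq_spreadSet hBp hd] at this

theorem IsBallUnion.isIsotopyEquiv {V W : Opens N} (hV : IsBallUnion E k V)
    (hW : IsBallUnion E k W) (h : spread k V ≤ spread k W) : IsIsotopyEquiv E V W := by
  obtain ⟨B, hB, hd, rfl⟩ := hV
  obtain ⟨B', hB', hd', rfl⟩ := hW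
  exact isIsotopyEquiv_of_spreadSet_subset hB hB' hd hd' h

theorem spread_le_of_le_of_le {V U U' : Opens N} (hVU : V ≤ U) (hUU' : U ≤ U')
    (h : spread k V ≤ spread k U') : spread k V ≤ spread k U := fun _ hp =>
  spreadSet_mono_of_subset hUU' (h hp) fun a ha => hVU (hp.1 a ha)

variable [T2Space N]

theorem exists_basisUnion {𝓑 : Set (Opens N)} (h𝓑 : IsBallBasis E 𝓑) {O : Set (Conf k N)}
    (hO : IsOpen O) {p : Conf k N} (hp : p ∈ O) :
    ∃ V : BasisUnion E k 𝓑, p ∈ spread k V.carrier ∧ (spread k V.carrier : Set (Conf k N)) ⊆ O := by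
  obtain ⟨x, rfl⟩ := Conf.mk'_surjective p
  obtain ⟨B, hB, hd, hx, hBO⟩ := exists_confProd_subset h𝓑.1 hO hp
  have he := confProd_eq_spreadSet (fun i => (h𝓑.2 _ (hB i)).isConnected.isPreconnected) hd
  refine ⟨⟨⨆ i, B i, B, hB, hd, rfl⟩, ?_, ?_⟩
  · rw [mem_spread, ← he]
    exact ⟨x, hx, rfl⟩
  · rwa [coe_spread, ← he]

theorem isConnectedBasis_spread {𝓑 : Set (Opens N)} (h𝓑 : IsBallBasis E 𝓑) :
    IsConnectedBasis fun V : BasisUnion E k 𝓑 => spread k V.carrier where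
  le_iff {V W} := ⟨IsIsotopyEquiv.spread_le,
    (V.isBallUnion h𝓑).isIsotopyEquiv (W.isBallUnion h𝓑)⟩
  exists_mem hO _ hx := exists_basisUnion h𝓑 hO hx
  isConnected V := (V.isBallUnion h𝓑).isConnected_spread

/-- A configuration contained in `U` lies in an element of the basis contained in `U`. -/
theorem exists_basisUnion_le {𝓑 : Set (Opens N)} (h𝓑 : IsBallBasis E 𝓑) {U : Opens N}
    {p : Conf k N} (hp : ∀ a ∈ p.points, a ∈ U) :
    ∃ V : BasisUnion E k 𝓑, p ∈ spread k V.carrier ∧ V.carrier ≤ U := by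
  obtain ⟨V, hpV, hV⟩ := exists_basisUnion h𝓑 (isOpen_setOf_points_subset U) hp
  exact ⟨V, hpV, (V.isBallUnion h𝓑).le_of_spread_subset fun q hq => hV hq⟩

end BallUnion

/-! ### A point of a non-isolated configuration can be moved close to another one -/

section Moving

variable {N : Type*} [TopologicalSpace N] [LocallyConnectedSpace N]

/-- Otherwise the component of `a` in `U \ Z` would be open and closed in the component of `a` in
`U`, hence equal to it, although the latter contains `b`. The point `z` may differ from `b`: in
dimension one, other points of `Z` can block the way. -/
theorem exists_mem_closure_connectedComponentIn {U : Set N} (hU : IsOpen U) {Z : Set N}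
    (hZ : IsClosed Z) {a b : N} (ha : a ∉ Z) (hb : b ∈ Z) (hab : Linked U a b) :
    ∃ z ∈ Z, z ∈ closure (connectedComponentIn (U \ Z) a) := by
  by_contra! h
  obtain ⟨haU, hbA⟩ := linked_iff.1 hab
  have hO : IsOpen (U \ Z) := hU.sdiff hZ
  set A := connectedComponentIn U a with hA
  set A₁ := connectedComponentIn (U \ Z) a with hA₁
  have haA₁ : a ∈ A₁ := mem_connectedComponentIn ⟨haU, ha⟩
  have hsub : A ⊆ A₁ ∪ (closure A₁)ᶜ := fun y hy => by
    by_cases hyc : y ∈ closure A₁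
    · left
      have hyZ : y ∉ Z := fun hyZ => h y hyZ hyc
      have hyUZ : y ∈ U \ Z := ⟨connectedComponentIn_subset _ _ hy, hyZ⟩
      obtain ⟨c, hc, hc'⟩ := mem_closure_iff.1 hyc _ (hO.connectedComponentIn (x := y))
        (mem_connectedComponentIn hyUZ)
      rw [hA₁, connectedComponentIn_eq hc', ← connectedComponentIn_eq hc]
      exact mem_connectedComponentIn hyUZ
    · exact Or.inr hyc
  have hsub' : A ⊆ A₁ := isPreconnected_connectedComponentIn.subset_left_of_subset_union
    hO.connectedComponentIn isClosed_closure.isOpen_compl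
    (Set.disjoint_left.2 fun y hy hy' => hy' (subset_closure hy)) hsub
    ⟨a, mem_connectedComponentIn haU, haA₁⟩
  exact (connectedComponentIn_subset _ _ (hsub' hbA)).2 hb

end Moving

/-! ### Vanishing on configurations that are not spread out -/

section Vanishing

variable {k : ℕ} {E : Type*} [NormedAddCommGroup E] [InnerProductSpace ℝ E]
  {N : Type w} [TopologicalSpace N] [T2Space N] [LocallyConnectedSpace N] [ChartedSpace E N]
  {C : Type u} [Category.{v} C] [HasZeroMorphisms C]

/-- In a compatible family of generalized elements of a very good functor which vanishes on unions
of fewer than `k` balls, the elements at unions of `k` balls two of which are contained in one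
component vanish. -/
theorem IsVeryGood.eq_zero_of_not_spread_le {𝓑 : Set (Opens N)} (h𝓑 : IsBallBasis E 𝓑)
    {F : (Opens N)ᵒᵖ ⥤ C} (hF : IsVeryGood E (𝟭 (Opens N)) F)
    (h0 : ∀ (j : ℕ) (V : Opens N), j < k → IsBallUnion E j V → IsZero (F.obj (op V)))
    {U : Opens N} {c : C} (x : ∀ V : Opens N, V ≤ U → (∃ j ≤ k, IsBallUnion E j V) →
      (c ⟶ F.obj (op V)))
    (hx : ∀ V W (h : V ≤ W) hV hV' hW hW', x W hW hW' ≫ F.map (homOfLE h).op = x V hV hV')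
    {V : Opens N} (hVU : V ≤ U) (hV : IsBallUnion E k V) (hns : ¬ spread k V ≤ spread k U) :
    x V hVU ⟨k, le_rfl, hV⟩ = 0 := by
  classical
  have hshrink : ∀ {V W : Opens N} (hVU : V ≤ U) (hWU : W ≤ U) (hV : IsBallUnion E k V)
      (hW : IsBallUnion E k W), spread k V ≤ spread k W →
      (x V hVU ⟨k, le_rfl, hV⟩ = 0 ↔ x W hWU ⟨k, le_rfl, hW⟩ = 0) := by
    intro V W hVU hWU hV hW h
    have hle := hV.le_of_spread_le h
    have hiso : IsIso (F.map (homOfLE hle).op) :=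
      hF (homOfLE hle) (hV.isIsotopyEquiv hW h)
    rw [← hx V W hle hVU ⟨k, le_rfl, hV⟩ hWU ⟨k, le_rfl, hW⟩]
    exact ⟨fun h => by rwa [← cancel_mono (F.map (homOfLE hle).op), zero_comp],
      fun h => by rw [h, zero_comp]⟩
  -- Vanishing is thus a property of configurations in `U`, independent of the union of balls around
  -- them: compare two unions through a basis element inside both.
  have hpt : ∀ {V W : Opens N} (hVU : V ≤ U) (hWU : W ≤ U) (hV : IsBallUnion E k V)
      (hW : IsBallUnion E k W) {p : Conf k N}, p ∈ spread k V → p ∈ spread k W →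
      (x V hVU ⟨k, le_rfl, hV⟩ = 0 ↔ x W hWU ⟨k, le_rfl, hW⟩ = 0) := by
    intro V W hVU hWU hV hW p hpV hpW
    obtain ⟨Z, -, hZ⟩ := exists_basisUnion h𝓑 ((spread k V).2.inter (spread k W).2) ⟨hpV, hpW⟩
    have h1 : spread k Z.carrier ≤ spread k V := fun q hq => (hZ hq).1
    have h2 : spread k Z.carrier ≤ spread k W := fun q hq => (hZ hq).2
    have hZb := Z.isBallUnion h𝓑
    have hZU := (hZb.le_of_spread_le h1).trans hVU
    rw [← hshrink hZU hVU hZb hV h1, hshrink hZU hWU hZb hW h2]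
  obtain ⟨p, hpV, hpU⟩ := SetLike.not_le_iff_exists.1 hns
  obtain ⟨z, rfl⟩ := Conf.mk'_surjective p
  rw [mem_spread, mk'_mem_spreadSet] at hpU
  have hzU : ∀ i, z.1 i ∈ U := fun i => hVU (hpV.1 _ (Conf.mem_mk'.2 ⟨i, rfl⟩))
  obtain ⟨i, l, hil, hlink⟩ : ∃ i l, i ≠ l ∧ Linked (U : Set N) (z.1 i) (z.1 l) := by
    by_contra! h
    exact hpU ⟨hzU, fun i l hil hl => (h i l hil) hl⟩
  obtain _ | k := k
  · exact i.elim0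
  let Z : Set N := range fun m => z.1 (i.succAbove m)
  have hmemZ : ∀ m, m ≠ i → z.1 m ∈ Z := fun m hm => by
    obtain ⟨m', rfl⟩ := Fin.exists_succAbove_eq hm
    exact ⟨m', rfl⟩
  have hiZ : z.1 i ∉ Z := by
    rintro ⟨m, hm⟩
    exact Fin.succAbove_ne i m (z.2 hm)
  -- Inside `U` minus the other points, the `i`-th point can come arbitrarily close to one of them,
  -- here number `m₀`.
  obtain ⟨_, ⟨m₀, rfl⟩, hclos⟩ := exists_mem_closure_connectedComponentIn U.2
    (finite_range _).isClosed hiZ (hmemZ l hil.symm) hlink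
  set A := connectedComponentIn ((U : Set N) \ Z) (z.1 i) with hA
  have hAsub : A ⊆ (U : Set N) \ Z := connectedComponentIn_subset _ _
  have hinj : ∀ a ∉ Z, Function.Injective (Function.update z.1 i a) := by
    intro a ha m m' h
    by_cases hm : m = i <;> by_cases hm' : m' = i
    · rw [hm, hm']
    · subst hm
      rw [Function.update_self, Function.update_of_ne hm'] at h
      exact absurd (h ▸ hmemZ m' hm') ha
    · subst hm'
      rw [Function.update_self, Function.update_of_ne hm] at h
      exact absurd (h ▸ hmemZ m hm) ha
    · rw [Function.update_of_ne hm, Function.update_of_ne hm'] at h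
      exact z.2 h
  have hupd : Continuous fun a : A => Function.update z.1 i (a : N) :=
    continuous_const.update i continuous_subtype_val
  let g : A → Conf (k + 1) N := fun a => Conf.mk' ⟨_, hinj a (hAsub a.2).2⟩
  have hg : Continuous g := Conf.continuous_mk'.comp
    (hupd.subtype_mk fun a => hinj a (hAsub a.2).2)
  have hgU : ∀ a, ∀ b ∈ (g a).points, b ∈ U := by
    intro a b hb
    obtain ⟨m, rfl⟩ := Conf.mem_mk'.1 hb
    by_cases hm : m = i
    · subst hm
      simpa using (hAsub a.2).1
    · simpa [Function.update_of_ne hm] using hzU m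
  choose V' hV' hV'U using fun a => exists_basisUnion_le h𝓑 (hgU a)
  have hV'b : ∀ a, IsBallUnion E (k + 1) (V' a).carrier := fun a => (V' a).isBallUnion h𝓑
  -- Vanishing is locally constant as the `i`-th point varies in the connected set `A`; it is enough
  -- to find one position where it holds.
  let f : A → Prop := fun a => x (V' a).carrier (hV'U a) ⟨k + 1, le_rfl, hV'b a⟩ = 0
  have hf : IsLocallyConstant f := by
    rw [IsLocallyConstant.iff_eventually_eq]
    intro a
    filter_upwards [hg.continuousAt.eventually_mem ((spread (k + 1) (V' a).carrier).2.mem_nhds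
      (hV' a))] with b hb
    exact propext (hpt (hV'U b) (hV'U a) (hV'b b) (hV'b a) (hV' b) hb)
  have : PreconnectedSpace A := isPreconnected_iff_preconnectedSpace.1
    isPreconnected_connectedComponentIn
  have hiA : z.1 i ∈ A := mem_connectedComponentIn ⟨hzU i, hiZ⟩
  have hgi : g ⟨z.1 i, hiA⟩ = Conf.mk' z := by
    simp only [g, Function.update_eq_self]
  suffices ∃ a, f a by
    obtain ⟨a, ha⟩ := this
    rw [hf.apply_eq_of_preconnectedSpace a ⟨z.1 i, hiA⟩] at ha
    exact (hpt (hV'U _) hVU (hV'b _) hV (hgi ▸ hV' _) hpV).1 ha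
  obtain ⟨B, hB, hd, hzB, hBU⟩ := exists_confProd_subset h𝓑.1 (isOpen_setOf_points_subset U)
    (x := z) fun b hb => by
      obtain ⟨m, rfl⟩ := Conf.mem_mk'.1 hb
      exact hzU m
  have hBb : ∀ m, IsBall E (B m) := fun m => h𝓑.2 _ (hB m)
  have hBU' : (⨆ m, B m) ≤ U := by
    refine IsBallUnion.le_of_spread_subset (E := E) ⟨B, hBb, hd, rfl⟩ fun q hq => ?_
    rw [mem_spread, ← confProd_eq_spreadSet (fun m => (hBb m).isConnected.isPreconnected) hd] at hq
    exact hBU hq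
  obtain ⟨a, haB, haA⟩ := mem_closure_iff.1 hclos _ (B (i.succAbove m₀)).2 (hzB _)
  refine ⟨⟨a, haA⟩, ?_⟩
  -- With the moved point in the ball of `m₀`, the ball of `i` can be dropped. The whole
  -- configuration lies in one ball fewer, where `F` is zero.
  let W : Opens N := ⨆ m, B (i.succAbove m)
  have hWU : W ≤ U := (iSup_comp_le B _).trans hBU'
  have hW : IsBallUnion E k W :=
    ⟨_, fun m => hBb _, fun m m' h => hd (i.succAbove_right_injective.ne h), rfl⟩
  have hgW : ∀ b ∈ (g ⟨a, haA⟩).points, b ∈ W := by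
    intro b hb
    obtain ⟨m, rfl⟩ := Conf.mem_mk'.1 hb
    by_cases hm : m = i
    · subst hm
      have : a ∈ W := Opens.mem_iSup.2 ⟨m₀, haB⟩
      simpa using this
    · obtain ⟨m', rfl⟩ := Fin.exists_succAbove_eq hm
      have : z.1 (i.succAbove m') ∈ W := Opens.mem_iSup.2 ⟨m', hzB _⟩
      simpa [Function.update_of_ne hm] using this
  obtain ⟨V₀, hgV₀, hV₀W⟩ := exists_basisUnion_le h𝓑 hgW
  refine (hpt (hV₀W.trans hWU) (hV'U _) (V₀.isBallUnion h𝓑) (hV'b _) hgV₀ (hV' _)).1 ?_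
  rw [← hx V₀.carrier W hV₀W _ _ hWU ⟨k, k.le_succ, hW⟩, (h0 k W k.lt_succ_self hW).eq_of_tgt
    (x W hWU ⟨k, k.le_succ, hW⟩) 0, zero_comp]

end Vanishing

/-! ### Generalized elements of polynomial approximations -/

section PolyApprox

variable {E : Type*} [NormedAddCommGroup E] [NormedSpace ℝ E]
  {N : Type w} [TopologicalSpace N] [ChartedSpace E N]
  {C : Type u} [Category.{v} C] [HasLimitsOfSize.{w, w} C]

/-- The projections of `T_k F(U)`. -/
noncomputable def polyApproxπ (k : ℤ) (F : (Opens N)ᵒᵖ ⥤ C) {U V : Opens N} (hVU : V ≤ U)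
    (hV : ∃ j : ℕ, (j : ℤ) ≤ k ∧ IsBallUnion E j V) : polyApprox E k F U ⟶ F.obj (op V) :=
  limit.π ((ballOpensIncl E k U).op ⋙ F) (op ⟨V, hVU, hV⟩)

theorem toPolyApprox_π (k : ℤ) (F : (Opens N)ᵒᵖ ⥤ C) {U V : Opens N} (hVU : V ≤ U)
    (hV : ∃ j : ℕ, (j : ℤ) ≤ k ∧ IsBallUnion E j V) :
    toPolyApprox E k F U ≫ polyApproxπ k F hVU hV = F.map (homOfLE hVU).op :=
  limit.lift_π _ _

theorem polyApproxπ_map (k : ℤ) (F : (Opens N)ᵒᵖ ⥤ C) {U V W : Opens N} (h : V ≤ W) (hVU : V ≤ U)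
    (hV : ∃ j : ℕ, (j : ℤ) ≤ k ∧ IsBallUnion E j V) (hWU : W ≤ U)
    (hW : ∃ j : ℕ, (j : ℤ) ≤ k ∧ IsBallUnion E j W) :
    polyApproxπ k F hWU hW ≫ F.map (homOfLE h).op = polyApproxπ k F hVU hV :=
  limit.w ((ballOpensIncl E k U).op ⋙ F)
    (homOfLE (show (⟨V, hVU, hV⟩ : BallOpens E k U) ≤ ⟨W, hWU, hW⟩ from h)).op

theorem polyApprox_hom_ext {k : ℤ} {F : (Opens N)ᵒᵖ ⥤ C} {U : Opens N} {c : C}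
    {f g : c ⟶ polyApprox E k F U}
    (h : ∀ V (hVU : V ≤ U) (hV : ∃ j : ℕ, (j : ℤ) ≤ k ∧ IsBallUnion E j V),
      f ≫ polyApproxπ k F hVU hV = g ≫ polyApproxπ k F hVU hV) : f = g :=
  limit.hom_ext fun V => h V.unop.1 V.unop.2.1 V.unop.2.2

variable [HasZeroMorphisms C]

/-- `V` itself belongs to `O_k(V)`, so the identity of `F(V)` factors through the zero object `T_k
F(V)`. -/
theorem isZero_of_isZero_polyApprox {k : ℤ} {F : (Opens N)ᵒᵖ ⥤ C} {V : Opens N}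
    (hV : ∃ j : ℕ, (j : ℤ) ≤ k ∧ IsBallUnion E j V) (h : IsZero (polyApprox E k F V)) :
    IsZero (F.obj (op V)) := by
  rw [IsZero.iff_id_eq_zero]
  have h1 := toPolyApprox_π k F (le_refl V) hV
  rw [h.eq_zero_of_tgt (toPolyApprox E k F V), zero_comp] at h1
  exact (h1.trans (F.map_id _)).symm

theorem isZero_polyApprox {k : ℤ} {F : (Opens N)ᵒᵖ ⥤ C} {U : Opens N}
    (h : ∀ V, (∃ j : ℕ, (j : ℤ) ≤ k ∧ IsBallUnion E j V) → IsZero (F.obj (op V))) :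
    IsZero (polyApprox E k F U) := by
  rw [IsZero.iff_id_eq_zero]
  exact polyApprox_hom_ext fun V hVU hV => (h V hV).eq_of_tgt _ _

theorem IsVeryGoodHomogeneous.isZero_obj {k : ℕ} {F : (Opens N)ᵒᵖ ⥤ C}
    (hF : IsVeryGoodHomogeneous E k F) (j : ℕ) (V : Opens N) (hj : j < k)
    (hV : IsBallUnion E j V) : IsZero (F.obj (op V)) :=
  isZero_of_isZero_polyApprox ⟨j, by lia, hV⟩ (hF.isZero V)

end PolyApprox

/-! ### The homogeneous functor extending a functor on the basis -/

section Extension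

variable {k : ℕ} {E : Type*} [NormedAddCommGroup E] [InnerProductSpace ℝ E]
  {N : Type w} [TopologicalSpace N] [LocallyConnectedSpace N] [ChartedSpace E N]
  {C : Type u} [Category.{v} C] [HasLimitsOfSize.{w, w} C]
  {𝓑 : Set (Opens N)}

/-- The elements of the basis whose points are spread out in `U`. -/
abbrev SpreadIn (E : Type*) [NormedAddCommGroup E] [InnerProductSpace ℝ E]
    {N : Type w} [TopologicalSpace N] [LocallyConnectedSpace N] [ChartedSpace E N]
    (k : ℕ) (𝓑 : Set (Opens N)) (U : Opens N) : Type w :=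
  {V : BasisUnion E k 𝓑 // spread k V.carrier ≤ spread k U}

/-- The inclusion of `SpreadIn E k 𝓑 U` into the basis. -/
def spreadInIncl (E : Type*) [NormedAddCommGroup E] [InnerProductSpace ℝ E]
    {N : Type w} [TopologicalSpace N] [LocallyConnectedSpace N] [ChartedSpace E N]
    (k : ℕ) (𝓑 : Set (Opens N)) (U : Opens N) : SpreadIn E k 𝓑 U ⥤ BasisUnion E k 𝓑 :=
  Monotone.functor (f := fun V : SpreadIn E k 𝓑 U => (V : BasisUnion E k 𝓑)) fun _ _ h => h

/-- The limit of `G` over the elements of the basis whose points are spread out in `U`. -/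
noncomputable def extObj (G : (BasisUnion E k 𝓑)ᵒᵖ ⥤ C) (U : Opens N) : C :=
  limit ((spreadInIncl E k 𝓑 U).op ⋙ G)

/-- The projections of `extObj G U`. -/
noncomputable def extπ (G : (BasisUnion E k 𝓑)ᵒᵖ ⥤ C) {U : Opens N} (V : BasisUnion E k 𝓑)
    (h : spread k V.carrier ≤ spread k U) : extObj G U ⟶ G.obj (op V) :=
  limit.π ((spreadInIncl E k 𝓑 U).op ⋙ G) (op ⟨V, h⟩)

theorem extπ_map (G : (BasisUnion E k 𝓑)ᵒᵖ ⥤ C) {U : Opens N} {V W : BasisUnion E k 𝓑}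
    (h : V ≤ W) (hV : spread k V.carrier ≤ spread k U) (hW : spread k W.carrier ≤ spread k U) :
    extπ G W hW ≫ G.map (homOfLE h).op = extπ G V hV :=
  limit.w ((spreadInIncl E k 𝓑 U).op ⋙ G)
    (homOfLE (show (⟨V, hV⟩ : SpreadIn E k 𝓑 U) ≤ ⟨W, hW⟩ from h)).op

theorem ext_hom_ext {G : (BasisUnion E k 𝓑)ᵒᵖ ⥤ C} {U : Opens N} {c : C} {f g : c ⟶ extObj G U}
    (h : ∀ V (hV : spread k V.carrier ≤ spread k U), f ≫ extπ G V hV = g ≫ extπ G V hV) : f = g :=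
  limit.hom_ext fun V => h V.unop.1 V.unop.2

/-- The generalized element of `extObj G U` defined by a compatible family. -/
noncomputable def extLift {G : (BasisUnion E k 𝓑)ᵒᵖ ⥤ C} {U : Opens N} {c : C}
    (s : ∀ V : BasisUnion E k 𝓑, spread k V.carrier ≤ spread k U → (c ⟶ G.obj (op V)))
    (hs : IsCompatible (fun V : BasisUnion E k 𝓑 => spread k V.carrier) G (spread k U) s) :
    c ⟶ extObj G U :=
  limit.lift ((spreadInIncl E k 𝓑 U).op ⋙ G)
    { pt := c
      π :=
        { app := fun V => s V.unop.1 V.unop.2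
          naturality := fun V W f =>
            (Category.id_comp _).trans (hs.restr_eq f.unop.le W.unop.2 V.unop.2).symm } }

theorem extLift_π {G : (BasisUnion E k 𝓑)ᵒᵖ ⥤ C} {U : Opens N} {c : C}
    (s : ∀ V : BasisUnion E k 𝓑, spread k V.carrier ≤ spread k U → (c ⟶ G.obj (op V)))
    (hs : IsCompatible (fun V : BasisUnion E k 𝓑 => spread k V.carrier) G (spread k U) s)
    (V : BasisUnion E k 𝓑) (hV : spread k V.carrier ≤ spread k U) :
    extLift s hs ≫ extπ G V hV = s V hV :=
  limit.lift_π _ _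

theorem isCompatible_extπ {G : (BasisUnion E k 𝓑)ᵒᵖ ⥤ C} {U : Opens N} {c : C}
    (f : c ⟶ extObj G U) :
    IsCompatible (fun V : BasisUnion E k 𝓑 => spread k V.carrier) G (spread k U)
      fun V hV => f ≫ extπ G V hV :=
  ⟨fun h hV hW => by rw [restr, Category.assoc, extπ_map G h hV hW]⟩

/-- The part of `spread k U` that is spread in `U'` is open and closed: by connectedness it contains
or misses each basis element. This is what makes extension by zero compatible with restriction. -/
theorem BasisUnion.spread_le_iff (h𝓑 : IsBallBasis E 𝓑) {U U' : Opens N} (hU : U ≤ U')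
    {V W : BasisUnion E k 𝓑} (h : V ≤ W) (hW : spread k W.carrier ≤ spread k U) :
    spread k V.carrier ≤ spread k U' ↔ spread k W.carrier ≤ spread k U' := by
  have hVW : spread k V.carrier ≤ spread k W.carrier := IsIsotopyEquiv.spread_le h
  refine ⟨fun hV => ?_, hVW.trans⟩
  obtain ⟨p, hp⟩ := (V.isBallUnion h𝓑).isConnected_spread.nonempty
  exact (W.isBallUnion h𝓑).spread_le (((W.isBallUnion h𝓑).le_of_spread_le hW).trans hU)
    (hVW hp) (hV hp)

variable [HasZeroMorphisms C]

open scoped Classical in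
theorem isCompatible_extMap (h𝓑 : IsBallBasis E 𝓑) (G : (BasisUnion E k 𝓑)ᵒᵖ ⥤ C) {U U' : Opens N}
    (hU : U ≤ U') :
    IsCompatible (fun V : BasisUnion E k 𝓑 => spread k V.carrier) G (spread k U)
      fun V _ => if h : spread k V.carrier ≤ spread k U' then extπ G V h else 0 := by
  refine ⟨fun {V W} h hV hW => ?_⟩
  have := BasisUnion.spread_le_iff h𝓑 hU h hW
  by_cases hV' : spread k V.carrier ≤ spread k U'
  · rw [dif_pos hV', dif_pos (this.1 hV'), restr, extπ_map]
  · rw [dif_neg hV', dif_neg fun h => hV' (this.2 h), restr, zero_comp]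

/-- The functoriality of `extObj`: restriction of sections, followed by extension by zero. -/
noncomputable def extMap (h𝓑 : IsBallBasis E 𝓑) (G : (BasisUnion E k 𝓑)ᵒᵖ ⥤ C) {U U' : Opens N}
    (hU : U ≤ U') : extObj G U' ⟶ extObj G U :=
  extLift _ (isCompatible_extMap h𝓑 G hU)

theorem extMap_π (h𝓑 : IsBallBasis E 𝓑) (G : (BasisUnion E k 𝓑)ᵒᵖ ⥤ C) {U U' : Opens N}
    (hU : U ≤ U') (V : BasisUnion E k 𝓑) (hV : spread k V.carrier ≤ spread k U)
    (hV' : spread k V.carrier ≤ spread k U') :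
    extMap h𝓑 G hU ≫ extπ G V hV = extπ G V hV' := by
  classical
  exact (extLift_π _ (isCompatible_extMap h𝓑 G hU) V hV).trans (dif_pos hV')

theorem extMap_π_zero (h𝓑 : IsBallBasis E 𝓑) (G : (BasisUnion E k 𝓑)ᵒᵖ ⥤ C) {U U' : Opens N}
    (hU : U ≤ U') (V : BasisUnion E k 𝓑) (hV : spread k V.carrier ≤ spread k U)
    (hV' : ¬ spread k V.carrier ≤ spread k U') :
    extMap h𝓑 G hU ≫ extπ G V hV = 0 := by
  classical
  exact (extLift_π _ (isCompatible_extMap h𝓑 G hU) V hV).trans (dif_neg hV')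

/-- The homogeneous functor on `O(N)` extending a functor on the basis. -/
noncomputable def extFunctor (h𝓑 : IsBallBasis E 𝓑) (G : (BasisUnion E k 𝓑)ᵒᵖ ⥤ C) :
    (Opens N)ᵒᵖ ⥤ C where
  obj U := extObj G U.unop
  map f := extMap h𝓑 G f.unop.le
  map_id U := ext_hom_ext fun V hV => by rw [extMap_π h𝓑 G _ V hV hV, Category.id_comp]
  map_comp {U'' U' U} f g := ext_hom_ext fun V hV => by
    rw [Category.assoc]
    -- A product spread in the largest set is spread in the intermediate one too, so extending by
    -- zero in one step or in two gives the same section.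
    by_cases h'' : spread k V.carrier ≤ spread k U''.unop
    · have h' : spread k V.carrier ≤ spread k U'.unop :=
        spread_le_of_le_of_le (((V.isBallUnion h𝓑).le_of_spread_le hV).trans g.unop.le)
          f.unop.le h''
      rw [extMap_π h𝓑 G _ V hV h'', extMap_π h𝓑 G _ V hV h', extMap_π h𝓑 G _ V h' h'']
    · rw [extMap_π_zero h𝓑 G _ V hV h'']
      by_cases h' : spread k V.carrier ≤ spread k U'.unop
      · rw [extMap_π h𝓑 G _ V hV h', extMap_π_zero h𝓑 G _ V h' h'']
      · rw [extMap_π_zero h𝓑 G _ V hV h', comp_zero]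

/-- The projections of `extFunctor`. -/
noncomputable def extFunctorπ (h𝓑 : IsBallBasis E 𝓑) (G : (BasisUnion E k 𝓑)ᵒᵖ ⥤ C) {U : Opens N}
    (V : BasisUnion E k 𝓑) (hV : spread k V.carrier ≤ spread k U) :
    (extFunctor h𝓑 G).obj (op U) ⟶ G.obj (op V) :=
  extπ G V hV

section

variable {h𝓑 : IsBallBasis E 𝓑} {G : (BasisUnion E k 𝓑)ᵒᵖ ⥤ C} {U U' : Opens N}

theorem extFunctorπ_map {V W : BasisUnion E k 𝓑} (h : V ≤ W) (hV : spread k V.carrier ≤ spread k U)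
    (hW : spread k W.carrier ≤ spread k U) :
    extFunctorπ h𝓑 G W hW ≫ G.map (homOfLE h).op = extFunctorπ h𝓑 G V hV :=
  extπ_map G h hV hW

theorem map_extFunctorπ (f : op U' ⟶ op U) (V : BasisUnion E k 𝓑)
    (hV : spread k V.carrier ≤ spread k U) (hV' : spread k V.carrier ≤ spread k U') :
    (extFunctor h𝓑 G).map f ≫ extFunctorπ h𝓑 G V hV = extFunctorπ h𝓑 G V hV' :=
  extMap_π h𝓑 G f.unop.le V hV hV'

theorem map_extFunctorπ_zero (f : op U' ⟶ op U) (V : BasisUnion E k 𝓑)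
    (hV : spread k V.carrier ≤ spread k U) (hV' : ¬ spread k V.carrier ≤ spread k U') :
    (extFunctor h𝓑 G).map f ≫ extFunctorπ h𝓑 G V hV = 0 :=
  extMap_π_zero h𝓑 G f.unop.le V hV hV'

theorem extFunctor_hom_ext {c : C} {f g : c ⟶ (extFunctor h𝓑 G).obj (op U)}
    (h : ∀ V (hV : spread k V.carrier ≤ spread k U),
      f ≫ extFunctorπ h𝓑 G V hV = g ≫ extFunctorπ h𝓑 G V hV) : f = g :=
  ext_hom_ext h

theorem isCompatible_extFunctorπ {c : C} (f : c ⟶ (extFunctor h𝓑 G).obj (op U)) :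
    IsCompatible (fun V : BasisUnion E k 𝓑 => spread k V.carrier) G (spread k U)
      fun V hV => f ≫ extFunctorπ h𝓑 G V hV :=
  isCompatible_extπ f

variable (h𝓑) in
/-- The generalized element of `extFunctor h𝓑 G` defined by a compatible family. -/
noncomputable def extFunctorLift {c : C}
    (s : ∀ V : BasisUnion E k 𝓑, spread k V.carrier ≤ spread k U → (c ⟶ G.obj (op V)))
    (hs : IsCompatible (fun V : BasisUnion E k 𝓑 => spread k V.carrier) G (spread k U) s) :
    c ⟶ (extFunctor h𝓑 G).obj (op U) :=
  extLift s hs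

theorem extFunctorLift_π {c : C}
    (s : ∀ V : BasisUnion E k 𝓑, spread k V.carrier ≤ spread k U → (c ⟶ G.obj (op V)))
    (hs : IsCompatible (fun V : BasisUnion E k 𝓑 => spread k V.carrier) G (spread k U) s)
    (V : BasisUnion E k 𝓑) (hV : spread k V.carrier ≤ spread k U) :
    extFunctorLift h𝓑 s hs ≫ extFunctorπ h𝓑 G V hV = s V hV :=
  extLift_π s hs V hV

end

theorem isCompatible_extFunctorπ_comp (h𝓑 : IsBallBasis E 𝓑) {G G' : (BasisUnion E k 𝓑)ᵒᵖ ⥤ C}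
    (η : G ⟶ G') {U : Opens N} :
    IsCompatible (fun V : BasisUnion E k 𝓑 => spread k V.carrier) G' (spread k U)
      fun V hV => extFunctorπ h𝓑 G V hV ≫ η.app (op V) :=
  ⟨fun h hV hW => by
    dsimp only [restr]
    rw [Category.assoc, ← η.naturality, ← Category.assoc, extFunctorπ_map h hV hW]⟩

/-- The functoriality of `extFunctor`. -/
noncomputable def extFunctorMap (h𝓑 : IsBallBasis E 𝓑) {G G' : (BasisUnion E k 𝓑)ᵒᵖ ⥤ C}
    (η : G ⟶ G') : extFunctor h𝓑 G ⟶ extFunctor h𝓑 G' where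
  app U := extFunctorLift h𝓑 (fun V hV => extFunctorπ h𝓑 G (U := U.unop) V hV ≫ η.app (op V))
    (isCompatible_extFunctorπ_comp h𝓑 η)
  naturality U' U f := by
    obtain ⟨U⟩ := U
    obtain ⟨U'⟩ := U'
    refine extFunctor_hom_ext fun V hV => ?_
    rw [Category.assoc, Category.assoc, extFunctorLift_π]
    by_cases h' : spread k V.carrier ≤ spread k U'
    · rw [map_extFunctorπ f V hV h', extFunctorLift_π, ← Category.assoc, map_extFunctorπ f V hV h']
    · rw [map_extFunctorπ_zero f V hV h', comp_zero, ← Category.assoc,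
        map_extFunctorπ_zero f V hV h', zero_comp]

theorem extFunctorMap_app_π {h𝓑 : IsBallBasis E 𝓑} {G G' : (BasisUnion E k 𝓑)ᵒᵖ ⥤ C}
    (η : G ⟶ G') {U : Opens N} (V : BasisUnion E k 𝓑)
    (hV : spread k V.carrier ≤ spread k U) :
    (extFunctorMap h𝓑 η).app (op U) ≫ extFunctorπ h𝓑 G' V hV =
      extFunctorπ h𝓑 G V hV ≫ η.app (op V) :=
  extFunctorLift_π _ (isCompatible_extFunctorπ_comp h𝓑 η) V hV

/-- `spread k U` is empty, so it contains no nonempty basis element and the limit is over the empty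
category. -/
theorem isZero_extFunctor (h𝓑 : IsBallBasis E 𝓑) (G : (BasisUnion E k 𝓑)ᵒᵖ ⥤ C) (j : ℕ)
    (U : Opens N) (hj : j < k) (hU : IsBallUnion E j U) :
    IsZero ((extFunctor h𝓑 G).obj (op U)) := by
  rw [IsZero.iff_id_eq_zero]
  refine extFunctor_hom_ext fun V hV => ?_
  obtain ⟨p, hp⟩ := (V.isBallUnion h𝓑).isConnected_spread.nonempty
  have := hV hp
  rw [hU.spread_eq_bot hj] at this
  exact this.elim

variable [T2Space N]

/-- `V` is the largest basis element in its own spread set, so the limit is attained there. -/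
theorem isIso_extFunctorπ_self (h𝓑 : IsBallBasis E 𝓑) (G : (BasisUnion E k 𝓑)ᵒᵖ ⥤ C)
    (V : BasisUnion E k 𝓑) :
    IsIso (extFunctorπ h𝓑 G V (le_refl (spread k V.carrier))) := by
  have hle : ∀ {W : BasisUnion E k 𝓑}, spread k W.carrier ≤ spread k V.carrier → W ≤ V :=
    fun h => (isConnectedBasis_spread h𝓑).le_iff.2 h
  have hs : IsCompatible (fun V : BasisUnion E k 𝓑 => spread k V.carrier) G (spread k V.carrier)
      fun W hW => G.map (homOfLE (hle hW)).op :=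
    ⟨fun h hV hW => (G.map_comp (homOfLE (hle hW)).op (homOfLE h).op).symm⟩
  refine ⟨extFunctorLift h𝓑 _ hs, ?_, ?_⟩
  · refine extFunctor_hom_ext fun W hW => ?_
    rw [Category.assoc, extFunctorLift_π, extFunctorπ_map (hle hW) hW, Category.id_comp]
  · rw [extFunctorLift_π]
    exact G.map_id _

/-- For an isotopy equivalence the spread sets are nested, so the transition map is plain
restriction of sections. The homotopy of configurations makes it bijective on maps from every test
object. -/
theorem isVeryGood_extFunctor (h𝓑 : IsBallBasis E 𝓑) {G : (BasisUnion E k 𝓑)ᵒᵖ ⥤ C}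
    (hG : InvertsAll G) : IsVeryGood E (𝟭 (Opens N)) (extFunctor h𝓑 G) := by
  intro U W f h
  have hQ := isConnectedBasis_spread (k := k) h𝓑
  have hUW : spread k U ≤ spread k W := IsIsotopyEquiv.spread_le h
  obtain ⟨H, ρ, h0, h1, h1'⟩ := h.exists_homotopy (k := k)
  have hπ : ∀ (V : BasisUnion E k 𝓑) (hV : spread k V.carrier ≤ spread k U),
      (extFunctor h𝓑 G).map f.op ≫ extFunctorπ h𝓑 G V hV = extFunctorπ h𝓑 G V (hV.trans hUW) :=
    fun V hV => map_extFunctorπ f.op V hV (hV.trans hUW)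
  refine isIso_of_yoneda_map_bijective _ fun c => ⟨fun a b hab => ?_, fun b => ?_⟩
  · have key := (isCompatible_extFunctorπ a).ext_of_homotopy hQ hG hUW H ρ h0 h1
      (isCompatible_extFunctorπ b) fun V hV => by
        dsimp only at hab
        rw [← hπ V hV, ← Category.assoc, hab, Category.assoc]
    exact extFunctor_hom_ext fun V hV => congrFun (congrFun key V) hV
  · obtain ⟨s, hs, hs'⟩ :=
      (isCompatible_extFunctorπ b).exists_extension_of_homotopy hQ hG hUW H ρ h0 h1 h1'
    refine ⟨extFunctorLift h𝓑 s hs, extFunctor_hom_ext fun V hV => ?_⟩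
    rw [Category.assoc, hπ V hV, extFunctorLift_π, hs']

theorem isPolynomial_extFunctor (h𝓑 : IsBallBasis E 𝓑) {G : (BasisUnion E k 𝓑)ᵒᵖ ⥤ C}
    (hG : InvertsAll G) : IsPolynomial E k (extFunctor h𝓑 G) := by
  intro U
  have hVb : ∀ V : BasisUnion E k 𝓑, ∃ j : ℕ, (j : ℤ) ≤ k ∧ IsBallUnion E j V.carrier := fun V =>
    ⟨k, le_rfl, V.isBallUnion h𝓑⟩
  have hVU : ∀ {V : BasisUnion E k 𝓑}, spread k V.carrier ≤ spread k U → V.carrier ≤ U :=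
    fun {V} h => (V.isBallUnion h𝓑).le_of_spread_le h
  refine isIso_of_yoneda_map_bijective _ fun c => ⟨fun a b hab => ?_, fun x => ?_⟩
  · refine extFunctor_hom_ext fun V hV => ?_
    -- The component of a section at a spread `V` is read off from its image at `V`, an object of
    -- `O_k(U)`.
    have hm : ∀ f : c ⟶ (extFunctor h𝓑 G).obj (op U), f ≫ extFunctorπ h𝓑 G V hV =
        (f ≫ toPolyApprox E k (extFunctor h𝓑 G) U) ≫ polyApproxπ k _ (hVU hV) (hVb V) ≫
          extFunctorπ h𝓑 G V le_rfl := fun f => by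
      rw [Category.assoc, ← Category.assoc (toPolyApprox _ _ _ _), toPolyApprox_π,
        map_extFunctorπ _ V le_rfl hV]
    dsimp only at hab
    rw [hm a, hm b, hab]
  · let s : ∀ V : BasisUnion E k 𝓑, spread k V.carrier ≤ spread k U → (c ⟶ G.obj (op V)) :=
      fun V hV => x ≫ polyApproxπ k _ (hVU hV) (hVb V) ≫ extFunctorπ h𝓑 G V le_rfl
    have hs : IsCompatible (fun V : BasisUnion E k 𝓑 => spread k V.carrier) G (spread k U) s := by
      refine ⟨fun {V W} h hV hW => ?_⟩
      have hVW : spread k V.carrier ≤ spread k W.carrier := IsIsotopyEquiv.spread_le h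
      have hle := (V.isBallUnion h𝓑).le_of_spread_le hVW
      simp only [s, restr, Category.assoc]
      rw [extFunctorπ_map h hVW, ← polyApproxπ_map k _ hle (hVU hV) (hVb V) (hVU hW) (hVb W),
        Category.assoc, map_extFunctorπ _ V le_rfl hVW]
    refine ⟨extFunctorLift h𝓑 s hs, polyApprox_hom_ext fun V hV hVb' => ?_⟩
    dsimp only
    rw [Category.assoc, toPolyApprox_π]
    refine extFunctor_hom_ext fun W hW => ?_
    have hWV := (W.isBallUnion h𝓑).le_of_spread_le hW
    have hR : (x ≫ polyApproxπ k _ hV hVb') ≫ extFunctorπ h𝓑 G W hW =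
        x ≫ polyApproxπ k (extFunctor h𝓑 G) (hWV.trans hV) (hVb W) ≫
          extFunctorπ h𝓑 G W le_rfl := by
      rw [← polyApproxπ_map k _ hWV (hWV.trans hV) (hVb W) hV hVb', Category.assoc,
        Category.assoc, map_extFunctorπ _ W le_rfl hW]
    rw [hR, Category.assoc]
    -- On products spread in `U` the family was used to define the section; on the others the
    -- section is zero by definition and the family by the moving argument.
    by_cases hWU : spread k W.carrier ≤ spread k U
    · rw [map_extFunctorπ _ W hW hWU, extFunctorLift_π]
    · rw [map_extFunctorπ_zero _ W hW hWU, comp_zero]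
      have := (isVeryGood_extFunctor h𝓑 hG).eq_zero_of_not_spread_le h𝓑 (isZero_extFunctor h𝓑 G)
        (U := U) (c := c) (fun V hV hVb => x ≫ polyApproxπ k _ hV
          (hVb.imp fun j h => ⟨by exact_mod_cast h.1, h.2⟩))
        (fun V W h hV hV' hW hW' => by rw [Category.assoc, polyApproxπ_map])
        (hWV.trans hV) (W.isBallUnion h𝓑) hWU
      rw [← Category.assoc, this, zero_comp]

theorem isVeryGoodHomogeneous_extFunctor (h𝓑 : IsBallBasis E 𝓑) {G : (BasisUnion E k 𝓑)ᵒᵖ ⥤ C}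
    (hG : InvertsAll G) : IsVeryGoodHomogeneous E k (extFunctor h𝓑 G) where
  veryGood := isVeryGood_extFunctor h𝓑 hG
  polynomial := isPolynomial_extFunctor h𝓑 hG
  isZero _ := isZero_polyApprox fun V ⟨j, hj, hV⟩ => isZero_extFunctor h𝓑 G j V (by lia) hV

end Extension

/-! ### Restriction to a basis is an equivalence -/

section Comparison

variable {k : ℕ} {E : Type*} [NormedAddCommGroup E] [InnerProductSpace ℝ E]
  {N : Type w} [TopologicalSpace N] [ChartedSpace E N]
  {C : Type u} [Category.{v} C] {𝓑 : Set (Opens N)}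

theorem InvertsAll.of_isVeryGood {G : (BasisUnion E k 𝓑)ᵒᵖ ⥤ C}
    (hG : IsVeryGood E (basisIncl E k 𝓑) G) : InvertsAll G :=
  fun _ _ h => hG (homOfLE h) h

theorem IsVeryGood.invertsAll {F : (Opens N)ᵒᵖ ⥤ C} (hF : IsVeryGood E (𝟭 (Opens N)) F) :
    InvertsAll ((basisIncl E k 𝓑).op ⋙ F) :=
  fun _ _ h => hF ((basisIncl E k 𝓑).map (homOfLE h)) h

/-- The map to the values on the basis induced by an inclusion. -/
def basisRestr (F : (Opens N)ᵒᵖ ⥤ C) {U : Opens N} (V : BasisUnion E k 𝓑) (h : V.carrier ≤ U) :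
    F.obj (op U) ⟶ ((basisIncl E k 𝓑).op ⋙ F).obj (op V) :=
  F.map (homOfLE h).op

theorem map_basisRestr (F : (Opens N)ᵒᵖ ⥤ C) {U U' : Opens N} (f : op U' ⟶ op U)
    (V : BasisUnion E k 𝓑) (h : V.carrier ≤ U) :
    F.map f ≫ basisRestr F V h = basisRestr F V (h.trans f.unop.le) :=
  (F.map_comp _ _).symm

theorem isIso_basisRestr_self (F : (Opens N)ᵒᵖ ⥤ C) (V : BasisUnion E k 𝓑) :
    IsIso (basisRestr F V le_rfl) :=
  ⟨𝟙 (F.obj (op V.carrier)), (Category.comp_id _).trans (F.map_id _),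
    (Category.id_comp _).trans (F.map_id _)⟩

variable [LocallyConnectedSpace N]

theorem isCompatible_basisRestr (h𝓑 : IsBallBasis E 𝓑) (F : (Opens N)ᵒᵖ ⥤ C) (U : Opens N) :
    IsCompatible (fun V : BasisUnion E k 𝓑 => spread k V.carrier)
      ((basisIncl E k 𝓑).op ⋙ F) (spread k U) fun V hV =>
        basisRestr F V ((V.isBallUnion h𝓑).le_of_spread_le hV) :=
  ⟨fun _ _ _ => (F.map_comp _ _).symm⟩

theorem IsVeryGood.isIso_map {F : (Opens N)ᵒᵖ ⥤ C} (hF : IsVeryGood E (𝟭 (Opens N)) F)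
    {V W : Opens N} (hV : IsBallUnion E k V) (hW : IsBallUnion E k W)
    (h : spread k V ≤ spread k W) (f : V ⟶ W) : IsIso (F.map f.op) :=
  hF f (hV.isIsotopyEquiv hW h)

variable [T2Space N] [HasLimitsOfSize.{w, w} C] [HasZeroMorphisms C] {F : (Opens N)ᵒᵖ ⥤ C}

/-- A homogeneous functor kills inclusions of unions of `k` balls which are not spread out. -/
theorem IsVeryGoodHomogeneous.map_eq_zero (h𝓑 : IsBallBasis E 𝓑) (hF : IsVeryGoodHomogeneous E k F)
    {U V : Opens N} (h : V ≤ U) (hV : IsBallUnion E k V)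
    (hns : ¬ spread k V ≤ spread k U) : F.map (homOfLE h).op = 0 :=
  hF.veryGood.eq_zero_of_not_spread_le h𝓑 hF.isZero_obj (U := U) (c := F.obj (op U))
    (fun _ hV _ => F.map (homOfLE hV).op) (fun _ _ _ _ _ _ _ => (F.map_comp _ _).symm) h hV hns

/-- The comparison of a homogeneous functor with the extension of its restriction to the basis. -/
noncomputable def toExtFunctor (h𝓑 : IsBallBasis E 𝓑) (hF : IsVeryGoodHomogeneous E k F) :
    F ⟶ extFunctor h𝓑 ((basisIncl E k 𝓑).op ⋙ F) where
  app U := extFunctorLift h𝓑 _ (isCompatible_basisRestr h𝓑 F U.unop)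
  naturality U' U f := by
    obtain ⟨U⟩ := U
    obtain ⟨U'⟩ := U'
    refine extFunctor_hom_ext fun V hV => ?_
    rw [Category.assoc, Category.assoc, extFunctorLift_π, map_basisRestr]
    by_cases h' : spread k V.carrier ≤ spread k U'
    · rw [map_extFunctorπ f V hV h', extFunctorLift_π]
    · rw [map_extFunctorπ_zero f V hV h', comp_zero]
      -- Naturality of the comparison means that `F`, too, kills what the extension by zero kills.
      exact hF.map_eq_zero h𝓑 _ (V.isBallUnion h𝓑) h'

variable (h𝓑 : IsBallBasis E 𝓑) (hF : IsVeryGoodHomogeneous E k F)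

theorem toExtFunctor_app_π {U : Opens N} (V : BasisUnion E k 𝓑)
    (hV : spread k V.carrier ≤ spread k U) :
    (toExtFunctor h𝓑 hF).app (op U) ≫ extFunctorπ h𝓑 _ V hV =
      basisRestr F V ((V.isBallUnion h𝓑).le_of_spread_le hV) :=
  extFunctorLift_π _ (isCompatible_basisRestr h𝓑 F U) V hV

theorem isIso_toExtFunctor_app_basis (V : BasisUnion E k 𝓑) :
    IsIso ((toExtFunctor h𝓑 hF).app (op V.carrier)) := by
  have := isIso_extFunctorπ_self h𝓑 ((basisIncl E k 𝓑).op ⋙ F) V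
  have h : IsIso ((toExtFunctor h𝓑 hF).app (op V.carrier) ≫
      extFunctorπ h𝓑 ((basisIncl E k 𝓑).op ⋙ F) V le_rfl) := by
    rw [toExtFunctor_app_π]
    exact isIso_basisRestr_self F V
  exact IsIso.of_isIso_comp_right _ (extFunctorπ h𝓑 ((basisIncl E k 𝓑).op ⋙ F) V le_rfl)

/-- For `j < k` both sides are zero. For `j = k`, shrink to a basis element inside: both functors
are very good, so naturality reduces to the case of the basis. -/
theorem isIso_toExtFunctor_app_ballUnion {j : ℕ} (hj : j ≤ k) {V : Opens N}
    (hV : IsBallUnion E j V) : IsIso ((toExtFunctor h𝓑 hF).app (op V)) := by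
  obtain hj | rfl := hj.lt_or_eq
  · exact ⟨0, (hF.isZero_obj j V hj hV).eq_of_src _ _,
      (isZero_extFunctor h𝓑 _ j V hj hV).eq_of_src _ _⟩
  · obtain ⟨p, hp⟩ := hV.isConnected_spread.nonempty
    obtain ⟨W, -, hW⟩ := exists_basisUnion h𝓑 (spread j V).2 hp
    have hW' : spread j W.carrier ≤ spread j V := hW
    have f : W.carrier ⟶ V := homOfLE ((W.isBallUnion h𝓑).le_of_spread_le hW')
    have h1 := hF.veryGood.isIso_map (W.isBallUnion h𝓑) hV hW' f
    have h2 := (isVeryGood_extFunctor h𝓑 (hF.veryGood.invertsAll (k := j))).isIso_map (W.isBallUnion h𝓑) hV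
      hW' f
    have h3 := isIso_toExtFunctor_app_basis h𝓑 hF W
    have hn := (toExtFunctor h𝓑 hF).naturality f.op
    have h4 : IsIso ((toExtFunctor h𝓑 hF).app (op V) ≫
        (extFunctor h𝓑 ((basisIncl E j 𝓑).op ⋙ F)).map f.op) := by
      rw [← hn]
      infer_instance
    exact IsIso.of_isIso_comp_right _ ((extFunctor h𝓑 ((basisIncl E j 𝓑).op ⋙ F)).map f.op)

/-- Both functors are polynomial, so the comparison at `U` is the limit over `O_k(U)` of comparisons
on unions of at most `k` balls. -/
instance isIso_toExtFunctor : IsIso (toExtFunctor h𝓑 hF) := by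
  have happ : ∀ U, IsIso ((toExtFunctor h𝓑 hF).app U) := by
    rintro ⟨U⟩
    let α := Functor.whiskerLeft (ballOpensIncl E k U).op (toExtFunctor h𝓑 hF)
    have hα : ∀ V, IsIso (α.app V) := fun V => by
      obtain ⟨j, hj, hV⟩ := V.unop.2.2
      exact isIso_toExtFunctor_app_ballUnion h𝓑 hF (by exact_mod_cast hj) hV
    have hαi : IsIso α := NatIso.isIso_of_isIso_app α
    let β : polyApprox E k F U ⟶ polyApprox E k (extFunctor h𝓑 ((basisIncl E k 𝓑).op ⋙ F)) U :=
      limMap α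
    have hβ : IsIso β := isIso_limMap α
    have h1 := hF.polynomial U
    have h2 := isPolynomial_extFunctor h𝓑 (hF.veryGood.invertsAll (k := k) (𝓑 := 𝓑)) U
    have hsq : (toExtFunctor h𝓑 hF).app (op U) ≫ toPolyApprox E k _ U =
        toPolyApprox E k F U ≫ β := by
      refine polyApprox_hom_ext fun V hVU hV => ?_
      have h3 : β ≫ polyApproxπ k (extFunctor h𝓑 ((basisIncl E k 𝓑).op ⋙ F)) hVU hV =
          polyApproxπ k F hVU hV ≫ (toExtFunctor h𝓑 hF).app (op V) := limMap_π α _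
      rw [Category.assoc, toPolyApprox_π, Category.assoc, h3, ← Category.assoc, toPolyApprox_π,
        (toExtFunctor h𝓑 hF).naturality]
    have h4 : IsIso (toPolyApprox E k F U ≫ β) := IsIso.comp_isIso' h1 hβ
    rw [← hsq] at h4
    exact IsIso.of_isIso_comp_right _ (toPolyApprox E k _ U)
  exact NatIso.isIso_of_isIso_app _

end Comparison

/-! ### Restriction to a ball basis: faithful, full, essentially surjective -/

section Restriction

variable {k : ℕ} {E : Type*} [NormedAddCommGroup E] [InnerProductSpace ℝ E]
  {N : Type w} [TopologicalSpace N] [LocallyConnectedSpace N] [ChartedSpace E N] [T2Space N]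
  {C : Type u} [Category.{v} C] [HasLimitsOfSize.{w, w} C] {𝓑 : Set (Opens N)}

theorem restrictToBasis_faithful [HasZeroMorphisms C] (h𝓑 : IsBallBasis E 𝓑) :
    (restrictToBasis E C k 𝓑).Faithful where
  map_injective {F F'} f g h := by
    have happ : ∀ V : BasisUnion E k 𝓑, f.hom.app (op V.carrier) = g.hom.app (op V.carrier) :=
      fun V => congrArg (fun a => a.hom.app (op V)) h
    refine ObjectProperty.hom_ext _ ?_
    rw [← cancel_mono (toExtFunctor h𝓑 F'.property)]
    ext ⟨U⟩
    refine extFunctor_hom_ext fun V hV => ?_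
    simp only [NatTrans.comp_app, Category.assoc]
    rw [toExtFunctor_app_π]
    exact ((f.hom.naturality _).symm.trans (congrArg (fun a => F.obj.map _ ≫ a) (happ V))).trans
      (g.hom.naturality _)

/-- Extend the transformation through `extFunctorMap` and conjugate by the comparison isomorphisms.
-/
theorem restrictToBasis_full [HasZeroMorphisms C] (h𝓑 : IsBallBasis E 𝓑) :
    (restrictToBasis E C k 𝓑).Full where
  map_surjective {F F'} η := by
    let κ := toExtFunctor h𝓑 F.property
    let κ' := toExtFunctor h𝓑 F'.property
    have hκi : IsIso κ' := isIso_toExtFunctor h𝓑 F'.property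
    let η' : (basisIncl E k 𝓑).op ⋙ F.obj ⟶ (basisIncl E k 𝓑).op ⋙ F'.obj := η.hom
    let ε : extFunctor h𝓑 ((basisIncl E k 𝓑).op ⋙ F.obj) ⟶
      extFunctor h𝓑 ((basisIncl E k 𝓑).op ⋙ F'.obj) := extFunctorMap h𝓑 η'
    refine ⟨ObjectProperty.homMk (κ ≫ ε ≫ inv κ'), ObjectProperty.hom_ext _ ?_⟩
    ext ⟨V⟩
    have hκ' := isIso_toExtFunctor_app_basis h𝓑 F'.property V
    change (κ ≫ ε ≫ inv κ').app (op V.carrier) = η.hom.app (op V)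
    have h2 : (κ ≫ ε ≫ inv κ').app (op V.carrier) ≫ κ'.app (op V.carrier) =
        (κ ≫ ε).app (op V.carrier) := by
      rw [← NatTrans.comp_app, Category.assoc, Category.assoc, IsIso.inv_hom_id, Category.comp_id]
    refine (cancel_mono (κ'.app (op V.carrier))).1 (h2.trans ?_)
    refine extFunctor_hom_ext fun W hW => ?_
    have hWV : W ≤ V := (isConnectedBasis_spread h𝓑).le_iff.2 hW
    rw [NatTrans.comp_app, Category.assoc, extFunctorMap_app_π, ← Category.assoc,
      toExtFunctor_app_π]
    refine (η.hom.naturality (homOfLE hWV).op).trans ?_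
    refine Eq.trans ?_ (Category.assoc _ _ _).symm
    exact congrArg (η'.app (op V) ≫ ·) (toExtFunctor_app_π h𝓑 F'.property W hW).symm

theorem restrictToBasis_essSurj [HasZeroMorphisms C] (h𝓑 : IsBallBasis E 𝓑) :
    (restrictToBasis E C k 𝓑).EssSurj where
  mem_essImage G := by
    have hG := InvertsAll.of_isVeryGood G.property
    refine ⟨⟨extFunctor h𝓑 G.obj, isVeryGoodHomogeneous_extFunctor h𝓑 hG⟩,
      ⟨ObjectProperty.isoMk (P := fun F => IsVeryGood E (basisIncl E k 𝓑) F)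
        (NatIso.ofComponents (fun V => @asIso _ _ _ _ (extFunctorπ h𝓑 G.obj V.unop le_rfl)
          (isIso_extFunctorπ_self h𝓑 G.obj V.unop)) fun {W V} f => ?_)⟩⟩
    have h : V.unop ≤ W.unop := f.unop.le
    have hVW : spread k V.unop.carrier ≤ spread k W.unop.carrier := IsIsotopyEquiv.spread_le h
    exact (map_extFunctorπ (h𝓑 := h𝓑) (G := G.obj) ((basisIncl E k 𝓑).map f.unop).op V.unop le_rfl hVW).trans
      (extFunctorπ_map (h𝓑 := h𝓑) (G := G.obj) h hVW le_rfl).symm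

theorem restrictToBasis_isEquivalence [HasZeroObject C] (h𝓑 : IsBallBasis E 𝓑) :
    (restrictToBasis E C k 𝓑).IsEquivalence := by
  -- The statement involves no zero morphisms, so any choice may serve in the proof.
  have : HasZeroMorphisms C := HasZeroObject.zeroMorphismsOfZeroObject
  exact
    { faithful := restrictToBasis_faithful h𝓑
      full := restrictToBasis_full h𝓑
      essSurj := restrictToBasis_essSurj h𝓑 }

end Restriction

theorem locallyConnectedSpace_conf (E : Type*) [NormedAddCommGroup E] [NormedSpace ℝ E]
    (M : Type w) [TopologicalSpace M] [T2Space M] [ChartedSpace E M] (k : ℕ) :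
    LocallyConnectedSpace (Conf k M) :=
  ChartedSpace.locallyConnectedSpace (ConfModel k E) (Conf k M)

/-! ### Unions of `k` balls as balls in the configuration space -/

section BasisUnionEquiv

variable {k : ℕ} {E : Type*} [NormedAddCommGroup E] [InnerProductSpace ℝ E]
  {M : Type w} [TopologicalSpace M] [LocallyConnectedSpace M] [ChartedSpace E M]
  {𝓑 : Set (Opens M)}

theorem spread_mem_confBasis (h𝓑 : IsBallBasis E 𝓑) (U : BasisUnion E k 𝓑) :
    spread k U.carrier ∈ confBasis k 𝓑 := by
  obtain ⟨B, hB, hd, hU⟩ := U.exists_eq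
  refine ⟨B, hB, hd, ?_⟩
  rw [confProd_eq_spreadSet (fun i => (h𝓑.2 _ (hB i)).isConnected.isPreconnected) hd, hU, coe_spread]

variable [T2Space M]

/-- A disjoint union of `k` elements of the basis, as an element of the product basis of the
configuration space. -/
def BasisUnion.conf (h𝓑 : IsBallBasis E 𝓑) (U : BasisUnion E k 𝓑) :
    BasisUnion (ConfModel k E) 1 (confBasis k 𝓑) where
  carrier := spread k U.carrier
  exists_eq := ⟨fun _ => spread k U.carrier, fun _ => spread_mem_confBasis h𝓑 U,
    fun i j h => absurd (Subsingleton.elim i j) h, by simp⟩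

theorem BasisUnion.conf_bijective (h𝓑 : IsBallBasis E 𝓑) :
    Function.Bijective (BasisUnion.conf h𝓑 (k := k)) := by
  refine ⟨fun U V h => ?_, fun W => ?_⟩
  · have h' : spread k U.carrier = spread k V.carrier := congrArg BasisUnion.carrier h
    exact BasisUnion.ext (le_antisymm ((U.isBallUnion h𝓑).le_of_spread_le h'.le)
      ((V.isBallUnion h𝓑).le_of_spread_le h'.ge))
  · obtain ⟨S, hS, -, hW⟩ := W.exists_eq
    obtain ⟨B, hB, hd, hSB⟩ := hS 0
    refine ⟨⟨⨆ i, B i, B, hB, hd, rfl⟩, BasisUnion.ext ?_⟩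
    have hW' : W.carrier = S 0 := by rw [hW, iSup_unique]; rfl
    rw [hW']
    refine Opens.ext ?_
    rw [hSB, confProd_eq_spreadSet (fun i => (h𝓑.2 _ (hB i)).isConnected.isPreconnected) hd]
    rfl

variable [IsManifold 𝓘(ℝ, E) ∞ M]

/-- Isotopy equivalence in `M` and in `F_k(M)` both amount to inclusion of the products. In `F_k(M)`
this holds because the products are balls, by the case of a single component. -/
theorem BasisUnion.conf_le_conf (h𝓑 : IsBallBasis E 𝓑) {U V : BasisUnion E k 𝓑} :
    U.conf h𝓑 ≤ V.conf h𝓑 ↔ U ≤ V := by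
  refine ⟨fun h => (isConnectedBasis_spread h𝓑).le_iff.2 h.choose, fun h => ?_⟩
  have hball : ∀ U : BasisUnion E k 𝓑, IsBall (ConfModel k E) (spread k U.carrier) := fun U =>
    (isBallBasis_confBasis h𝓑).2 _ (spread_mem_confBasis h𝓑 U)
  have := isIsotopyEquiv_iSup (j := 1) (fun _ => hball U) (fun _ => hball V)
    (fun i j h => absurd (Subsingleton.elim i j) h) fun _ => IsIsotopyEquiv.spread_le h
  rwa [iSup_const, iSup_const] at this

/-- The category of disjoint unions of `k` elements of a basis is isomorphic to the category of
elements of the product basis of the configuration space. -/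
noncomputable def basisUnionEquiv (h𝓑 : IsBallBasis E 𝓑) :
    BasisUnion E k 𝓑 ≃o BasisUnion (ConfModel k E) 1 (confBasis k 𝓑) where
  toEquiv := Equiv.ofBijective _ (BasisUnion.conf_bijective h𝓑)
  map_rel_iff' := BasisUnion.conf_le_conf h𝓑

end BasisUnionEquiv

/-! ### Functoriality in the basis -/

section ChangeOfBasis

variable {E : Type*} [NormedAddCommGroup E] [NormedSpace ℝ E]
  {N : Type w} [TopologicalSpace N] [ChartedSpace E N]
  (C : Type u) [Category.{v} C] {k : ℕ} {𝓑 : Set (Opens N)}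

theorem precompBasis_isEquivalence {E' : Type*} [NormedAddCommGroup E'] [NormedSpace ℝ E']
    {N' : Type w} [TopologicalSpace N'] [ChartedSpace E' N'] {l : ℕ} {𝓑' : Set (Opens N')}
    (Φ : BasisUnion E k 𝓑 ≃o BasisUnion E' l 𝓑') : (precompBasis C Φ).IsEquivalence := by
  have he : (Φ.monotone.functor).IsEquivalence := Φ.equivalence.isEquivalence_functor
  have hf : (precompBasis C Φ ⋙ ObjectProperty.ι _).Faithful := inferInstanceAs
    (ObjectProperty.ι _ ⋙ (Functor.whiskeringLeft _ _ C).obj (Φ.monotone.functor).op).Faithful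
  have hF : (precompBasis C Φ ⋙ ObjectProperty.ι _).Full := inferInstanceAs
    (ObjectProperty.ι _ ⋙ (Functor.whiskeringLeft _ _ C).obj (Φ.monotone.functor).op).Full
  exact
    { faithful := Functor.Faithful.of_comp _ (ObjectProperty.ι _)
      full := Functor.Full.of_comp_faithful _ (ObjectProperty.ι _)
      essSurj :=
        -- The components come from `Φ.symm (Φ V) = V`; naturality is automatic, as parallel
        -- morphisms of a preorder are equal.
        ⟨fun G => ⟨(precompBasis C Φ.symm).obj G, ⟨ObjectProperty.isoMk
          (P := fun F => IsVeryGood E (basisIncl E k 𝓑) F)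
          (NatIso.ofComponents (fun V => G.obj.mapIso (eqToIso (by
            exact congrArg op (Φ.symm_apply_apply V.unop)))) fun f =>
              (G.obj.map_comp _ _).symm.trans ((congrArg G.obj.map (Subsingleton.elim _ _)).trans
                (G.obj.map_comp _ _)))⟩⟩⟩ }

variable {C}

/-- An inclusion of bases induces an inclusion of categories of disjoint unions. -/
def BasisUnion.ofSubset {𝓐 : Set (Opens N)} (h : 𝓑 ⊆ 𝓐) (U : BasisUnion E k 𝓑) :
    BasisUnion E k 𝓐 :=
  ⟨U.carrier, U.exists_eq.imp fun _ hB => ⟨fun i => h (hB.1 i), hB.2⟩⟩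

theorem BasisUnion.monotone_ofSubset {𝓐 : Set (Opens N)} (h : 𝓑 ⊆ 𝓐) :
    Monotone (BasisUnion.ofSubset h : BasisUnion E k 𝓑 → BasisUnion E k 𝓐) :=
  fun _ _ hUV => hUV

variable (C) in
/-- Restriction along an inclusion of bases. -/
def restrictBasis {𝓐 : Set (Opens N)} (h : 𝓑 ⊆ 𝓐) : VGBasis E C k 𝓐 ⥤ VGBasis E C k 𝓑 :=
  ObjectProperty.lift _
    (ObjectProperty.ι _ ⋙ (Functor.whiskeringLeft _ _ C).obj
      (BasisUnion.monotone_ofSubset h).functor.op)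
    fun F _ _ f => F.property ((BasisUnion.monotone_ofSubset h).functor.map f)

end ChangeOfBasis

/-! ### The equivalence `T` and its compatibility with all ball bases -/

section Equivalence

variable {k : ℕ} {E : Type*} [NormedAddCommGroup E] [InnerProductSpace ℝ E]
  {M : Type w} [TopologicalSpace M] [T2Space M] [LocallyConnectedSpace M] [ChartedSpace E M]
  [IsManifold 𝓘(ℝ, E) ∞ M] {C : Type u} [Category.{v} C] [HasLimitsOfSize.{w, w} C]
  {𝓐 𝓑 : Set (Opens M)}

variable (C) in
/-- Restriction of linear functors on the configuration space to the products of balls of `M`. -/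
noncomputable def restrictToConf (h𝓑 : IsBallBasis E 𝓑) :
    VGHomogeneous (ConfModel k E) (Conf k M) C 1 ⥤ VGBasis E C k 𝓑 :=
  restrictToBasis (ConfModel k E) C 1 (confBasis k 𝓑) ⋙ precompBasis C (basisUnionEquiv h𝓑)

/-- Restriction to the products of balls is compatible with restriction to smaller bases. -/
noncomputable def restrictToConfCompRestrictBasis (h𝓐 : IsBallBasis E 𝓐)
    (h𝓑 : IsBallBasis E 𝓑) (h : 𝓑 ⊆ 𝓐) :
    restrictToConf C h𝓐 ⋙ restrictBasis C h ≅ restrictToConf (k := k) C h𝓑 :=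
  Iso.refl _

/-- Restriction to a basis is compatible with restriction to smaller bases. -/
noncomputable def restrictToBasisCompRestrictBasis (h : 𝓑 ⊆ 𝓐) :
    restrictToBasis E C k 𝓐 ⋙ restrictBasis C h ≅ restrictToBasis E C k 𝓑 :=
  Iso.refl _

variable [HasZeroObject C] [LocallyConnectedSpace (Conf k M)]

variable (k C) in
theorem restrictToConf_isEquivalence (h𝓑 : IsBallBasis E 𝓑) :
    (restrictToConf (k := k) C h𝓑).IsEquivalence := by
  have := restrictToBasis_isEquivalence (k := 1) (C := C) (isBallBasis_confBasis (k := k) h𝓑)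
  have := precompBasis_isEquivalence C (basisUnionEquiv (k := k) h𝓑)
  exact Functor.isEquivalence_trans _ _

variable (k C) in
/-- The equivalence of homogeneous functors of degree `k` on `M` with linear functors on the
configuration space, through their restrictions to a basis. -/
noncomputable def homogeneousEquivLinear (h𝓐 : IsBallBasis E 𝓐) :
    VGHomogeneous E M C k ≌ VGHomogeneous (ConfModel k E) (Conf k M) C 1 :=
  have := restrictToBasis_isEquivalence (k := k) (C := C) h𝓐
  have := restrictToConf_isEquivalence k C h𝓐
  (restrictToBasis E C k 𝓐).asEquivalence.trans (restrictToConf C h𝓐).asEquivalence.symm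

/-- The equivalence is the identity on restrictions to the basis. -/
noncomputable def homogeneousEquivLinearCompRestrict (h𝓐 : IsBallBasis E 𝓐) :
    (homogeneousEquivLinear k C h𝓐).functor ⋙ restrictToConf C h𝓐 ≅ restrictToBasis E C k 𝓐 :=
  have := restrictToBasis_isEquivalence (k := k) (C := C) h𝓐
  have := restrictToConf_isEquivalence k C h𝓐
  Functor.associator _ _ _ ≪≫
    Functor.isoWhiskerLeft (restrictToBasis E C k 𝓐)
      (restrictToConf C h𝓐).asEquivalence.counitIso ≪≫ Functor.rightUnitor _

/-- The equivalence is the identity on restrictions to smaller bases. -/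
noncomputable def homogeneousEquivLinearCompRestrictOfSubset (h𝓐 : IsBallBasis E 𝓐)
    (h𝓑 : IsBallBasis E 𝓑) (h : 𝓑 ⊆ 𝓐) :
    (homogeneousEquivLinear k C h𝓐).functor ⋙ restrictToConf C h𝓑 ≅ restrictToBasis E C k 𝓑 :=
  Functor.isoWhiskerLeft _ (restrictToConfCompRestrictBasis h𝓐 h𝓑 h).symm ≪≫
    (Functor.associator _ _ _).symm ≪≫
    Functor.isoWhiskerRight (homogeneousEquivLinearCompRestrict h𝓐) (restrictBasis C h) ≪≫
    restrictToBasisCompRestrictBasis h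

theorem exists_homogeneousEquivLinear :
    ∃ T : VGHomogeneous E M C k ≌ VGHomogeneous (ConfModel k E) (Conf k M) C 1,
      ∀ 𝓑 : Set (Opens M), IsBallBasis E 𝓑 → IsBallBasis (ConfModel k E) (confBasis k 𝓑) ∧
        ∃ Φ : BasisUnion E k 𝓑 ≃o BasisUnion (ConfModel k E) 1 (confBasis k 𝓑),
          (∀ (U : BasisUnion E k 𝓑) (B : Fin k → Opens M),
            (∀ i, B i ∈ 𝓑) → Pairwise (Function.onFun Disjoint B) → U.carrier = ⨆ i, B i →
              ((Φ U).carrier : Set (Conf k M)) = confProd B) ∧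
          (restrictToBasis E C k 𝓑).IsEquivalence ∧
          (restrictToBasis (ConfModel k E) C 1 (confBasis k 𝓑)).IsEquivalence ∧
          Nonempty (T.functor ⋙ restrictToBasis (ConfModel k E) C 1 (confBasis k 𝓑) ⋙
            precompBasis C Φ ≅ restrictToBasis E C k 𝓑) := by
  -- `T` has to be fixed before `𝓑`. It is built from the basis of all balls, which contains every
  -- ball basis, by `h𝓑.2`.
  have h𝓐 := isBallBasis_setOf_isBall (E := E) (M := M)
  refine ⟨homogeneousEquivLinear k C h𝓐, fun 𝓑 h𝓑 => ⟨isBallBasis_confBasis h𝓑,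
    basisUnionEquiv h𝓑, fun U B hB hd hU => ?_, restrictToBasis_isEquivalence h𝓑,
    restrictToBasis_isEquivalence (isBallBasis_confBasis h𝓑),
    ⟨homogeneousEquivLinearCompRestrictOfSubset h𝓐 h𝓑 h𝓑.2⟩⟩⟩
  rw [confProd_eq_spreadSet (fun i => (h𝓑.2 _ (hB i)).isConnected.isPreconnected) hd, ← hU]
  rfl

end Equivalence

end ManifoldCalculus

open ManifoldCalculus in
theorem corollary3 {n : ℕ} {M : Type w} [TopologicalSpace M] [T2Space M]
    [SecondCountableTopology M] [ChartedSpace (EuclideanSpace ℝ (Fin n)) M]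
    [IsManifold 𝓘(ℝ, EuclideanSpace ℝ (Fin n)) ∞ M]
    {C : Type u} [Category.{v} C] [HasZeroObject C] [HasLimitsOfSize.{w, w} C] (k : ℕ) :
    ∃ T : VGHomogeneous (EuclideanSpace ℝ (Fin n)) M C k ≌
        VGHomogeneous (ConfModel k (EuclideanSpace ℝ (Fin n))) (Conf k M) C 1,
      ∀ 𝓑 : Set (Opens M), IsBallBasis (EuclideanSpace ℝ (Fin n)) 𝓑 →
        IsBallBasis (ConfModel k (EuclideanSpace ℝ (Fin n))) (confBasis k 𝓑) ∧
        ∃ Φ : BasisUnion (EuclideanSpace ℝ (Fin n)) k 𝓑 ≃o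
            BasisUnion (ConfModel k (EuclideanSpace ℝ (Fin n))) 1 (confBasis k 𝓑),
          (∀ (U : BasisUnion (EuclideanSpace ℝ (Fin n)) k 𝓑) (B : Fin k → Opens M),
            (∀ i, B i ∈ 𝓑) → Pairwise (Function.onFun Disjoint B) → U.carrier = ⨆ i, B i →
              ((Φ U).carrier : Set (Conf k M)) = confProd B) ∧
          (restrictToBasis (EuclideanSpace ℝ (Fin n)) C k 𝓑).IsEquivalence ∧
          (restrictToBasis (ConfModel k (EuclideanSpace ℝ (Fin n))) C 1
            (confBasis k 𝓑)).IsEquivalence ∧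
          Nonempty (T.functor ⋙
              restrictToBasis (ConfModel k (EuclideanSpace ℝ (Fin n))) C 1 (confBasis k 𝓑) ⋙
              precompBasis C Φ ≅
            restrictToBasis (EuclideanSpace ℝ (Fin n)) C k 𝓑) := by
  have hM : LocallyConnectedSpace M :=
    ChartedSpace.locallyConnectedSpace (EuclideanSpace ℝ (Fin n)) M
  have hconf := locallyConnectedSpace_conf (EuclideanSpace ℝ (Fin n)) M k
  exact exists_homogeneousEquivLinear
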